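/- Let $p,q\in L_2(0,\pi)$ be real valued, $h_1,h_2\in\mathbb R$, $h_2>0$, and consider the Dirac problem $$By'+\Omega(x)y=\lambda y\quad(0<x<\pi),\qquad y_1(0)=0,\qquad (\lambda+h_1)y_1(\pi)+h_2y_2(\pi)=0,$$ $$B=\begin{pmatrix}0&1\\-1&0\end{pmatrix},\qquad \Omega(x)=\begin{pmatrix}p(x)&q(x)\\q(x)&-p(x)\end{pmatrix}.$$ Let $\varphi(x,\lambda)$ be the solution of the system with $\varphi(0,\lambda)=(0,-1)^T$, and for an eigenvalue $\mu$ let $$\alpha(\mu)=\int_0^\pi\bigl(\varphi_1(x,\mu)^2+\varphi_2(x,\mu)^2\bigr)dx+\tfrac1{h_2}\varphi_1(\pi,\mu)^2$$ be its normalizing number. Put $\varphi_0(x,\lambda)=(\sin\lambda x,-\cos\lambda x)^T$. For real numbers $\lambda_n,\alpha_n$ $(n\in\mathbb Z)$ let $$F(x,t)=\sum_{n=-\infty}^{\infty}\Bigl[\tfrac1{\alpha_n}\varphi_0(x,\lambda_n)\varphi_0(t,\lambda_n)^T-\tfrac1\pi\varphi_0(x,n)\varphi_0(t,n)^T\Bigr]$$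 (limit of the symmetric partial sums, in $L_2(0,\pi)$ with respect to $t$ for each fixed $x\in[0,\pi]$, with $F$ measurable in $(x,t)$). The main equation with a $2\times2$ matrix kernel $G$ is $$G(x,t)+K(x,t)+\int_0^xK(x,\xi)G(\xi,t)\,d\xi=0,\qquad 0<t<x.$$ (a) Let $\lambda_n$ $(n\in\mathbb Z)$ be pairwise distinct eigenvalues of the problem, numbered so that $|\lambda_n-n|<\frac12$ for all but finitely many $n$, and let $\alpha_n=\alpha(\lambda_n)$. Then the series for $F$ converges. Let $E$ be any finite set, possibly empty, of eigenvalues not among the $\lambda_n$, and put $$G(x,t)=F(x,t)+\sum_{\mu\in E}\tfrac1{\alpha(\mu)}\varphi_0(x,\mu)\varphi_0(t,\mu)^T.$$ Then for each fixed $x\in(0,\pi]$ the main equation with kernel $G$ has a unique solution $K(x,\cdot)\in L_2(0,x)$, where the equation is understood for almost every $t\in(0,x)$. For $E=\emptyset$ this is the main equation with kernel $F$; if $E$ consists of all eigenvalues not among the $\lambda_n$, then $G$ involves the whole spectrum. (b) The same holds with $G=F$ for arbitrary real numbers $\lambda_n,\alpha_n$ $(n\in\mathbb Z)$ with the $\lambda_n$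 pairwise distinct, $\alpha_n>0$, $\sum_n(\lambda_n-n)^2<\infty$ and $\sum_n(\alpha_n-\pi)^2<\infty$: the series for $F$ converges, and for each $x\in(0,\pi]$ the main equation with kernel $F$ has a unique solution $K(x,\cdot)\in L_2(0,x)$. The matrix functions $K(x,\cdot)$ may be taken real valued or complex valued; both existence and uniqueness hold in either class. -/

import Mathlib

open MeasureTheory Set Filter Topology

namespace DiracGLM

/-- The constant matrix `B` of the Dirac system. -/
def B : Matrix (Fin 2) (Fin 2) ℝ := !![0, 1; -1, 0]

/-- The potential matrix `Ω(x)` with entries `p, q, q, -p`. -/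
def Om (p q : ℝ → ℝ) (x : ℝ) : Matrix (Fin 2) (Fin 2) ℝ := !![p x, q x; q x, -p x]

/-- `y` is a solution of `B y' + Ω(x) y = μ y` on `(0, π)`: its components are absolutely continuous on
`[0, π]` and the equation holds almost everywhere. -/
structure IsDiracSolution (p q : ℝ → ℝ) (μ : ℝ) (y : ℝ → Fin 2 → ℝ) : Prop where
  absCont : ∀ i, AbsolutelyContinuousOnInterval (fun x => y x i) 0 Real.pi
  eqn : ∀ᵐ x ∂(volume.restrict (Ioo 0 Real.pi)), ∃ y' : Fin 2 → ℝ,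
    HasDerivAt y y' x ∧ Matrix.mulVec B y' + Matrix.mulVec (Om p q x) (y x) = μ • y x

/-- `μ` is an eigenvalue of the boundary value problem: the system has a nontrivial solution with
`y₁(0) = 0` and `(μ + h₁) y₁(π) + h₂ y₂(π) = 0`. The problem is self-adjoint (with the inner product
of `L₂(0, π; ℂ²) ⊕ ℂ` in which the last summand has weight `1 / h₂`), so all its eigenvalues are
real. -/
def IsEigenvalue (p q : ℝ → ℝ) (h₁ h₂ μ : ℝ) : Prop :=
  ∃ y : ℝ → Fin 2 → ℝ, IsDiracSolution p q μ y ∧ (∃ x ∈ Icc 0 Real.pi, y x ≠ 0) ∧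
    y 0 0 = 0 ∧ (μ + h₁) * y Real.pi 0 + h₂ * y Real.pi 1 = 0

/-- `a` is the normalizing number at the point `μ`: the integral of `|φ(x, μ)|²` over `(0, π)` plus
`φ₁(π, μ)² / h₂`, where `φ(·, μ)` is the solution of the system with `φ(0, μ) = (0, -1)`. -/
def IsNormalizingNumber (p q : ℝ → ℝ) (h₂ μ a : ℝ) : Prop :=
  ∃ y : ℝ → Fin 2 → ℝ, IsDiracSolution p q μ y ∧ y 0 = ![0, -1] ∧
    a = (∫ x in Ioo 0 Real.pi, (y x 0 ^ 2 + y x 1 ^ 2)) + 1 / h₂ * y Real.pi 0 ^ 2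

/-- Spectral data indexed by the integers: pairwise distinct eigenvalues `lam n`, numbered so that
`lam n` is within distance less than `1 / 2` of `n` for all but finitely many `n`, and their normalizing
numbers `α n`. -/
structure IsSpectralData (p q : ℝ → ℝ) (h₁ h₂ : ℝ) (lam α : ℤ → ℝ) : Prop where
  injective : Function.Injective lam
  eigenvalue : ∀ n, IsEigenvalue p q h₁ h₂ (lam n)
  normalizing : ∀ n, IsNormalizingNumber p q h₂ (lam n) (α n)
  numbering : ∀ᶠ n : ℤ in cofinite, |lam n - n| < 1 / 2

/-- The solution `φ₀(x, μ)` of the system with zero potential. -/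
noncomputable def phi0 (x μ : ℝ) : Fin 2 → ℝ := ![Real.sin (μ * x), -Real.cos (μ * x)]

/-- The matrix `φ₀(x, μ) φ₀(t, μ)ᵀ`. -/
noncomputable def phi0Mat (x t μ : ℝ) : Matrix (Fin 2) (Fin 2) ℝ :=
  Matrix.vecMulVec (phi0 x μ) (phi0 t μ)

/-- Symmetric partial sums of the series that defines the kernel `F(x, t)`. -/
noncomputable def kernelSum (lam α : ℤ → ℝ) (N : ℕ) (x t : ℝ) : Matrix (Fin 2) (Fin 2) ℝ :=
  ∑ n ∈ Finset.Icc (-(N : ℤ)) (N : ℤ),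
    ((1 / α n) • phi0Mat x t (lam n) - (1 / Real.pi) • phi0Mat x t (n : ℝ))

/-- `F` is the sum of the series: `F` is measurable on the square, and for each `x` the series
converges to `F(x, ·)` in `L₂(0, π)`, entry by entry. -/
structure IsKernel (lam α : ℤ → ℝ) (F : ℝ → ℝ → Matrix (Fin 2) (Fin 2) ℝ) : Prop where
  measurable : ∀ i j, AEStronglyMeasurable (fun z : ℝ × ℝ => F z.1 z.2 i j)
    ((volume.restrict (Ioo 0 Real.pi)).prod (volume.restrict (Ioo 0 Real.pi)))
  memLp : ∀ x ∈ Icc 0 Real.pi, ∀ i j,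
    MemLp (fun t => F x t i j) 2 (volume.restrict (Ioo 0 Real.pi))
  tendsto : ∀ x ∈ Icc 0 Real.pi, ∀ i j,
    Tendsto (fun N : ℕ => eLpNorm (fun t => kernelSum lam α N x t i j - F x t i j) 2
      (volume.restrict (Ioo 0 Real.pi))) atTop (𝓝 0)

/-- The space `L₂(0, x)` of (classes of) matrix functions with entries in `𝕜`. -/
abbrev L2Mat (𝕜 : Type*) [RCLike 𝕜] (x : ℝ) : Type _ :=
  Matrix (Fin 2) (Fin 2) (Lp 𝕜 2 (volume.restrict (Ioo 0 x)))

/-- `K = K(x, ·)` satisfies `F(x, t) + K(x, t) + ∫₀ˣ K(x, ξ) F(ξ, t) dξ = 0` for almost every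
`t` in `(0, x)`, entry by entry. -/
def SolvesMainEquation {𝕜 : Type*} [RCLike 𝕜] (F : ℝ → ℝ → Matrix (Fin 2) (Fin 2) ℝ) (x : ℝ)
    (K : L2Mat 𝕜 x) : Prop :=
  ∀ i j, ∀ᵐ t ∂(volume.restrict (Ioo 0 x)),
    ((F x t i j : ℝ) : 𝕜) + K i j t
      + ∫ ξ in Ioo 0 x, ∑ k, K i k ξ * ((F ξ t k j : ℝ) : 𝕜) = 0

end DiracGLM

namespace DiracGLM

lemma ac_lipschitzOn_comp {X Y : Type*} [PseudoMetricSpace X] [PseudoMetricSpace Y] {f : ℝ → X}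
    {g : X → Y} {K : NNReal} {s : Set X} {a b : ℝ} (hg : LipschitzOnWith K g s)
    (hf : AbsolutelyContinuousOnInterval f a b) (hs : ∀ x ∈ uIcc a b, f x ∈ s) :
    AbsolutelyContinuousOnInterval (fun x => g (f x)) a b := by
  have h1 := Tendsto.const_mul (K : ℝ) hf
  rw [mul_zero] at h1
  refine squeeze_zero' (Eventually.of_forall fun t => Finset.sum_nonneg fun i _ => dist_nonneg) ?_ h1
  have : ∀ᶠ E in AbsolutelyContinuousOnInterval.totalLengthFilter ⊓
      𝓟 (AbsolutelyContinuousOnInterval.disjWithin a b),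
      E ∈ AbsolutelyContinuousOnInterval.disjWithin a b :=
    eventually_inf_principal.mpr (by simp)
  filter_upwards [this] with E hE
  rw [Finset.mul_sum]
  exact Finset.sum_le_sum fun i hi =>
    hg.dist_le_mul _ (hs _ (hE.1 i hi).1) _ (hs _ (hE.1 i hi).2)

lemma ac_lipschitz_comp {X Y : Type*} [PseudoMetricSpace X] [PseudoMetricSpace Y] {f : ℝ → X}
    {g : X → Y} {K : NNReal} {a b : ℝ} (hg : LipschitzWith K g)
    (hf : AbsolutelyContinuousOnInterval f a b) :
    AbsolutelyContinuousOnInterval (fun x => g (f x)) a b :=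
  ac_lipschitzOn_comp (s := univ) hg.lipschitzOnWith hf (fun _ _ => mem_univ _)

lemma ac_ofReal {f : ℝ → ℝ} {a b : ℝ} (hf : AbsolutelyContinuousOnInterval f a b) :
    AbsolutelyContinuousOnInterval (fun x => (f x : ℂ)) a b :=
  ac_lipschitz_comp Complex.isometry_ofReal.lipschitz hf

lemma ac_re {f : ℝ → ℂ} {a b : ℝ} (hf : AbsolutelyContinuousOnInterval f a b) :
    AbsolutelyContinuousOnInterval (fun x => (f x).re) a b :=
  ac_lipschitz_comp (g := Complex.reCLM) Complex.reCLM.lipschitz hf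

lemma ac_im {f : ℝ → ℂ} {a b : ℝ} (hf : AbsolutelyContinuousOnInterval f a b) :
    AbsolutelyContinuousOnInterval (fun x => (f x).im) a b :=
  ac_lipschitz_comp (g := Complex.imCLM) Complex.imCLM.lipschitz hf

lemma ac_of_re_im {f g : ℝ → ℝ} {a b : ℝ} (hf : AbsolutelyContinuousOnInterval f a b)
    (hg : AbsolutelyContinuousOnInterval g a b) :
    AbsolutelyContinuousOnInterval (fun x => (f x : ℂ) + (g x : ℂ) * Complex.I) a b := by
  have := (ac_ofReal hf).add ((ac_ofReal hg).const_smul Complex.I)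
  have e : (fun x => (f x : ℂ) + (g x : ℂ) * Complex.I) =
      (fun x => (f x : ℂ)) + fun x => Complex.I • (g x : ℂ) := by
    funext x
    rw [Pi.add_apply, smul_eq_mul, mul_comm Complex.I]
  rwa [e]

/-- The fundamental theorem of calculus for absolutely continuous complex functions. -/
lemma ac_integral_eq_sub {f f' : ℝ → ℂ} {a b : ℝ} (hf : AbsolutelyContinuousOnInterval f a b)
    (h : ∀ᵐ x, x ∈ uIcc a b → HasDerivAt f (f' x) x) :
    IntervalIntegrable f' volume a b ∧ ∫ x in a..b, f' x = f b - f a := by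
  have hre := ac_re hf
  have him := ac_im hf
  have dre : ∀ᵐ x, x ∈ uIoc a b → deriv (fun x => (f x).re) x = (f' x).re := by
    filter_upwards [h] with x hx hx'
    exact (Complex.reCLM.hasFDerivAt.comp_hasDerivAt x (hx (uIoc_subset_uIcc hx'))).deriv
  have dim : ∀ᵐ x, x ∈ uIoc a b → deriv (fun x => (f x).im) x = (f' x).im := by
    filter_upwards [h] with x hx hx'
    exact (Complex.imCLM.hasFDerivAt.comp_hasDerivAt x (hx (uIoc_subset_uIcc hx'))).deriv
  have ire : IntervalIntegrable (fun x => (f' x).re) volume a b :=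
    hre.intervalIntegrable_deriv.congr_ae ((ae_restrict_iff' measurableSet_uIoc).2 dre)
  have iim : IntervalIntegrable (fun x => (f' x).im) volume a b :=
    him.intervalIntegrable_deriv.congr_ae ((ae_restrict_iff' measurableSet_uIoc).2 dim)
  have e1 : ∫ x in a..b, (f' x).re = (f b).re - (f a).re := by
    rw [← hre.integral_deriv_eq_sub]
    exact (intervalIntegral.integral_congr_ae dre).symm
  have e2 : ∫ x in a..b, (f' x).im = (f b).im - (f a).im := by
    rw [← him.integral_deriv_eq_sub]
    exact (intervalIntegral.integral_congr_ae dim).symm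
  have ec : f' = fun x => ((f' x).re : ℂ) + ((f' x).im : ℂ) * Complex.I := by
    funext x; simp
  have i1 : IntervalIntegrable (fun x => ((f' x).re : ℂ)) volume a b := by
    rw [intervalIntegrable_iff] at ire ⊢; exact ire.ofReal
  have i2 : IntervalIntegrable (fun x => ((f' x).im : ℂ)) volume a b := by
    rw [intervalIntegrable_iff] at iim ⊢; exact iim.ofReal
  refine ⟨by rw [ec]; exact i1.add (i2.mul_const _), ?_⟩
  rw [ec, intervalIntegral.integral_add i1 (i2.mul_const _), intervalIntegral.integral_mul_const,
    intervalIntegral.integral_ofReal, intervalIntegral.integral_ofReal, e1, e2]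
  apply Complex.ext <;> simp

lemma ac_intervalIntegral {f : ℝ → ℂ} {a b : ℝ} (h : IntervalIntegrable f volume a b) :
    AbsolutelyContinuousOnInterval (fun x => ∫ v in a..x, f v) a b := by
  have ire : IntervalIntegrable (fun x => (f x).re) volume a b := by
    rw [intervalIntegrable_iff] at h ⊢; exact h.re
  have iim : IntervalIntegrable (fun x => (f x).im) volume a b := by
    rw [intervalIntegrable_iff] at h ⊢; exact h.im
  have H := ac_of_re_im (ire.absolutelyContinuousOnInterval_intervalIntegral left_mem_uIcc)
    (iim.absolutelyContinuousOnInterval_intervalIntegral left_mem_uIcc)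
  refine Tendsto.congr' ?_ H
  have : ∀ᶠ E in AbsolutelyContinuousOnInterval.totalLengthFilter ⊓
      𝓟 (AbsolutelyContinuousOnInterval.disjWithin a b),
      E ∈ AbsolutelyContinuousOnInterval.disjWithin a b :=
    eventually_inf_principal.mpr (by simp)
  have key : ∀ x ∈ uIcc a b, ((∫ v in a..x, (f v).re : ℝ) : ℂ) +
      ((∫ v in a..x, (f v).im : ℝ) : ℂ) * Complex.I = ∫ v in a..x, f v := by
    intro x hx
    have hs : uIcc a x ⊆ uIcc a b := uIcc_subset_uIcc_left hx
    have i1 : IntervalIntegrable (fun x => ((f x).re : ℂ)) volume a x := by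
      have := ire.mono_set hs
      rw [intervalIntegrable_iff] at this ⊢; exact this.ofReal
    have i2 : IntervalIntegrable (fun x => ((f x).im : ℂ)) volume a x := by
      have := iim.mono_set hs
      rw [intervalIntegrable_iff] at this ⊢; exact this.ofReal
    rw [← intervalIntegral.integral_ofReal, ← intervalIntegral.integral_ofReal,
      ← intervalIntegral.integral_mul_const, ← intervalIntegral.integral_add i1 (i2.mul_const _)]
    simp
  filter_upwards [this] with E hE
  refine Finset.sum_congr rfl fun i hi => ?_
  rw [key _ (hE.1 i hi).1, key _ (hE.1 i hi).2]

lemma ac_of_contDiff {f : ℝ → ℂ} (hf : ContDiff ℝ 1 f) (a b : ℝ) :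
    AbsolutelyContinuousOnInterval f a b :=
  hf.contDiffOn.absolutelyContinuousOnInterval

/-- The Cauchy-Schwarz inequality for integrals. -/
lemma norm_integral_mul_sq_le {X 𝕜 : Type*} [RCLike 𝕜] [MeasurableSpace X] {μ : Measure X}
    {f g : X → 𝕜} (hf : MemLp f 2 μ) (hg : MemLp g 2 μ) :
    ‖∫ x, f x * g x ∂μ‖ ^ 2 ≤ (∫ x, ‖f x‖ ^ 2 ∂μ) * ∫ x, ‖g x‖ ^ 2 ∂μ := by
  have h2 : ENNReal.ofReal 2 = 2 := by norm_num
  have h1 : ‖∫ x, f x * g x ∂μ‖ ≤ ∫ x, ‖f x‖ * ‖g x‖ ∂μ := by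
    refine (norm_integral_le_integral_norm _).trans_eq ?_
    simp
  have h3 := integral_mul_le_Lp_mul_Lq_of_nonneg (μ := μ) (p := 2) (q := 2)
    (f := fun x => ‖f x‖) (g := fun x => ‖g x‖) (by constructor <;> norm_num)
    (ae_of_all _ fun _ => norm_nonneg _) (ae_of_all _ fun _ => norm_nonneg _)
    (by rw [h2]; exact hf.norm) (by rw [h2]; exact hg.norm)
  have h4 := h1.trans h3
  simp only [Real.rpow_ofNat, ← Real.sqrt_eq_rpow] at h4
  calc _ ≤ (√(∫ x, ‖f x‖ ^ 2 ∂μ) * √(∫ x, ‖g x‖ ^ 2 ∂μ)) ^ 2 := by gcongr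
    _ = _ := by
      rw [mul_pow, Real.sq_sqrt (integral_nonneg fun _ => by positivity),
        Real.sq_sqrt (integral_nonneg fun _ => by positivity)]

/-- Parseval's identity on `(a, b]`. -/
lemma hasSum_sq_expIntegral {a b : ℝ} (hab : a < b) {f : ℝ → ℂ}
    (hf : MemLp f 2 (volume.restrict (Ioc a b))) :
    HasSum (fun n : ℤ => ‖∫ x in a..b, f x * Complex.exp (Complex.I * ((2 * Real.pi * n / (b - a) * x : ℝ) : ℂ))‖ ^ 2)
      ((b - a) * ∫ x in a..b, ‖f x‖ ^ 2) := by
  have hpos : 0 < b - a := sub_pos.2 hab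
  have h := ((hasSum_sq_fourierCoeffOn hab hf).mul_left ((b - a) ^ 2))
  rw [← (Equiv.neg ℤ).hasSum_iff] at h
  have e : (fun n : ℤ => ‖∫ x in a..b, f x * Complex.exp (Complex.I *
      ((2 * Real.pi * n / (b - a) * x : ℝ) : ℂ))‖ ^ 2) =
      (fun i => (b - a) ^ 2 * ‖fourierCoeffOn hab f i‖ ^ 2) ∘ ⇑(Equiv.neg ℤ) := by
    funext n
    rw [Function.comp_apply, fourierCoeffOn_eq_integral, norm_smul, mul_pow, ← mul_assoc]
    have : (b - a) ^ 2 * ‖(1 / (b - a) : ℝ)‖ ^ 2 = 1 := by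
      rw [Real.norm_eq_abs, sq_abs]; field_simp
    rw [this, one_mul]
    congr 2
    refine intervalIntegral.integral_congr fun x _ => ?_
    simp only [Equiv.neg_apply, neg_neg, fourier_coe_apply, smul_eq_mul]
    rw [mul_comm]
    congr 2
    push_cast
    ring
  rw [e]
  convert! h using 1
  rw [smul_eq_mul]; field_simp

end DiracGLM

namespace DiracGLM

/-- The integral of `h` against the exponential with frequency `l` over `(-π, π)`. -/
noncomputable def expCoeff (h : ℝ → ℂ) (l : ℝ) : ℂ :=
  ∫ x in (-Real.pi)..Real.pi, h x * Complex.exp (Complex.I * ((l * x : ℝ) : ℂ))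

/-- Completeness in `L₂(-π, π)` of the exponentials with frequencies in `A`. -/
def ExpComplete (A : Set ℝ) : Prop :=
  ∀ h : ℝ → ℂ, MemLp h 2 (volume.restrict (Ioc (-Real.pi) Real.pi)) →
    (∀ l ∈ A, expCoeff h l = 0) → h =ᵐ[volume.restrict (Ioc (-Real.pi) Real.pi)] 0

lemma norm_exp_I_mul (t : ℝ) : ‖Complex.exp (Complex.I * (t : ℂ))‖ = 1 := by
  rw [mul_comm, Complex.norm_exp_ofReal_mul_I]

lemma contDiff_exp_mul (l : ℝ) :
    ContDiff ℝ 1 fun x : ℝ => Complex.exp (Complex.I * ((l * x : ℝ) : ℂ)) := by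
  have h : ContDiff ℝ 1 fun x : ℝ => ((l * x : ℝ) : ℂ) :=
    Complex.ofRealCLM.contDiff.comp (contDiff_const.mul contDiff_id)
  exact (contDiff_const.mul h).cexp

lemma hasDerivAt_exp_mul (l x : ℝ) :
    HasDerivAt (fun x : ℝ => Complex.exp (Complex.I * ((l * x : ℝ) : ℂ)))
      (Complex.exp (Complex.I * ((l * x : ℝ) : ℂ)) * (Complex.I * (l : ℂ))) x := by
  have h : HasDerivAt (fun x : ℝ => ((l * x : ℝ) : ℂ)) (l : ℂ) x := by
    have := ((hasDerivAt_id x).const_mul l).ofReal_comp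
    simpa using this
  exact (h.const_mul _).cexp

lemma neg_pi_lt_pi : -Real.pi < Real.pi := by linarith [Real.pi_pos]

lemma memLp_mul_exp {h : ℝ → ℂ} {s : Set ℝ} (hh : MemLp h 2 (volume.restrict s)) (l : ℝ) :
    MemLp (fun x => h x * Complex.exp (Complex.I * ((l * x : ℝ) : ℂ))) 2 (volume.restrict s) := by
  refine hh.congr_norm (hh.1.mul ?_) (ae_of_all _ fun x => ?_)
  · exact Continuous.aestronglyMeasurable (by fun_prop)
  · rw [norm_mul, norm_exp_I_mul, mul_one]

lemma intervalIntegrable_of_memLp {E : Type*} [NormedAddCommGroup E] {h : ℝ → E} {a b : ℝ} (hab : a ≤ b)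
    (hh : MemLp h 2 (volume.restrict (Ioc a b))) : IntervalIntegrable h volume a b := by
  rw [intervalIntegrable_iff, uIoc_of_le hab]
  exact hh.integrable one_le_two

lemma hasSum_sq_expCoeff {h : ℝ → ℂ} (hh : MemLp h 2 (volume.restrict (Ioc (-Real.pi) Real.pi))) :
    HasSum (fun n : ℤ => ‖expCoeff h n‖ ^ 2)
      (2 * Real.pi * ∫ x in (-Real.pi)..Real.pi, ‖h x‖ ^ 2) := by
  have h1 := hasSum_sq_expIntegral neg_pi_lt_pi hh
  have e : Real.pi - -Real.pi = 2 * Real.pi := by ring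
  rw [e] at h1
  have e2 : ∀ n : ℤ, 2 * Real.pi * n / (2 * Real.pi) = (n : ℝ) := fun n => by
    field_simp
  simp_rw [e2] at h1
  exact h1

lemma ae_eq_zero_of_integral_sq {h : ℝ → ℂ}
    (hh : MemLp h 2 (volume.restrict (Ioc (-Real.pi) Real.pi)))
    (h0 : ∫ x in (-Real.pi)..Real.pi, ‖h x‖ ^ 2 ≤ 0) :
    h =ᵐ[volume.restrict (Ioc (-Real.pi) Real.pi)] 0 := by
  rw [intervalIntegral.integral_of_le neg_pi_lt_pi.le] at h0
  have h1 := le_antisymm h0 (integral_nonneg fun _ => by positivity)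
  rw [integral_eq_zero_iff_of_nonneg (fun _ => by positivity) hh.integrable_norm_pow'] at h1
  filter_upwards [h1] with x hx
  simpa using hx

lemma ae_eq_zero_of_expCoeff_ne {h : ℝ → ℂ}
    (hh : MemLp h 2 (volume.restrict (Ioc (-Real.pi) Real.pi))) (b : ℝ)
    (h0 : ∀ l, l ≠ b → expCoeff h l = 0) :
    h =ᵐ[volume.restrict (Ioc (-Real.pi) Real.pi)] 0 := by
  have hm := memLp_mul_exp hh (b + 1 / 2)
  have hs := hasSum_sq_expCoeff hm
  have e : ∀ n : ℤ, expCoeff (fun x => h x * Complex.exp (Complex.I * (((b + 1 / 2) * x : ℝ) : ℂ))) n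
      = 0 := by
    intro n
    rw [← h0 (n + (b + 1 / 2))]
    · unfold expCoeff
      refine intervalIntegral.integral_congr fun x _ => ?_
      simp only
      rw [mul_assoc, ← Complex.exp_add]
      congr 2
      push_cast
      ring
    · intro hb
      have h2 : ((2 * n + 1 : ℤ) : ℝ) = 0 := by push_cast; linarith
      have h3 : (2 * n + 1 : ℤ) = 0 := by exact_mod_cast h2
      omega
  simp only [e, norm_zero, ne_eq, OfNat.ofNat_ne_zero, not_false_eq_true, zero_pow, norm_mul,
    norm_exp_I_mul, mul_one] at hs
  have h4 := hs.unique hasSum_zero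
  refine ae_eq_zero_of_integral_sq hh ?_
  have := Real.pi_pos
  by_contra hc
  push Not at hc
  have : 0 < 2 * Real.pi * ∫ x in (-Real.pi)..Real.pi, ‖h x‖ ^ 2 := by positivity
  linarith

lemma exists_expCoeff_factor {h : ℝ → ℂ}
    (hh : MemLp h 2 (volume.restrict (Ioc (-Real.pi) Real.pi))) {a : ℝ} (ha : expCoeff h a = 0) :
    ∃ u : ℝ → ℂ, MemLp u 2 (volume.restrict (Ioc (-Real.pi) Real.pi)) ∧
      ∀ l, expCoeff h l = Complex.I * ((a - l : ℝ) : ℂ) * expCoeff u l := by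
  have hle := neg_pi_lt_pi.le
  have hg := intervalIntegrable_of_memLp hle (memLp_mul_exp hh a)
  set J : ℝ → ℂ := fun x => ∫ s in (-Real.pi)..x, h s * Complex.exp (Complex.I * ((a * s : ℝ) : ℂ))
    with hJ
  have hJac : AbsolutelyContinuousOnInterval J (-Real.pi) Real.pi := ac_intervalIntegral hg
  have hJc : ContinuousOn J (Icc (-Real.pi) Real.pi) := by
    rw [← uIcc_of_le hle]; exact hJac.continuousOn
  have hexp : ∀ l : ℝ, Continuous fun x : ℝ => Complex.exp (Complex.I * ((l * x : ℝ) : ℂ)) :=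
    fun l => by fun_prop
  have huc : ContinuousOn (fun x => J x * Complex.exp (Complex.I * ((-a * x : ℝ) : ℂ)))
    (Icc (-Real.pi) Real.pi) := hJc.mul (hexp _).continuousOn
  refine ⟨fun x => J x * Complex.exp (Complex.I * ((-a * x : ℝ) : ℂ)), ?_, fun l => ?_⟩
  · obtain ⟨C, hC⟩ := isCompact_Icc.exists_bound_of_continuousOn huc
    refine MemLp.of_bound ?_ C ?_
    · exact (huc.mono Ioc_subset_Icc_self).aestronglyMeasurable measurableSet_Ioc
    · exact (ae_restrict_iff' measurableSet_Ioc).2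
        (ae_of_all _ fun x hx => hC x (Ioc_subset_Icc_self hx))
  · have hd : ∀ᵐ x, x ∈ uIcc (-Real.pi) Real.pi →
        HasDerivAt (fun x => Complex.exp (Complex.I * (((l - a) * x : ℝ) : ℂ)) • J x)
          (Complex.I * ((l - a : ℝ) : ℂ) * (J x * Complex.exp (Complex.I * ((-a * x : ℝ) : ℂ)) *
            Complex.exp (Complex.I * ((l * x : ℝ) : ℂ))) +
            h x * Complex.exp (Complex.I * ((l * x : ℝ) : ℂ))) x := by
      filter_upwards [hg.ae_hasDerivAt_integral] with x hx hx'
      have h1 := hx hx' (-Real.pi) left_mem_uIcc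
      have h2 := hasDerivAt_exp_mul (l - a) x
      refine (h2.smul h1).congr_deriv ?_
      have e1 : Complex.exp (Complex.I * (((l - a) * x : ℝ) : ℂ)) =
          Complex.exp (Complex.I * ((-a * x : ℝ) : ℂ)) * Complex.exp (Complex.I * ((l * x : ℝ) : ℂ)) := by
        rw [← Complex.exp_add]; congr 1; push_cast; ring
      have e2 : Complex.exp (Complex.I * ((l * x : ℝ) : ℂ)) =
          Complex.exp (Complex.I * (((l - a) * x : ℝ) : ℂ)) *
            Complex.exp (Complex.I * ((a * x : ℝ) : ℂ)) := by
        rw [← Complex.exp_add]; congr 1; push_cast; ring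
      simp only [smul_eq_mul]
      rw [mul_assoc (J x), ← e1]
      conv_rhs => rw [e2]
      ring
    have hac : AbsolutelyContinuousOnInterval
        (fun x => Complex.exp (Complex.I * (((l - a) * x : ℝ) : ℂ)) • J x) (-Real.pi) Real.pi := by
      exact (ac_of_contDiff (contDiff_exp_mul _) _ _).fun_smul hJac
    obtain ⟨_, h2⟩ := ac_integral_eq_sub hac hd
    have hu : IntervalIntegrable (fun x => J x * Complex.exp (Complex.I * ((-a * x : ℝ) : ℂ)) *
        Complex.exp (Complex.I * ((l * x : ℝ) : ℂ))) volume (-Real.pi) Real.pi := by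
      refine ContinuousOn.intervalIntegrable ?_
      rw [uIcc_of_le hle]
      exact huc.mul (hexp _).continuousOn
    rw [intervalIntegral.integral_add (hu.const_mul _)
      (intervalIntegrable_of_memLp hle (memLp_mul_exp hh l)),
      intervalIntegral.integral_const_mul] at h2
    have hJ1 : J Real.pi = 0 := ha
    have hJ2 : J (-Real.pi) = 0 := intervalIntegral.integral_same
    rw [hJ1, hJ2, smul_zero, smul_zero, sub_zero] at h2
    unfold expCoeff
    push_cast at h2 ⊢
    linear_combination h2

lemma expCoeff_add_smul {h u : ℝ → ℂ}
    (hh : MemLp h 2 (volume.restrict (Ioc (-Real.pi) Real.pi)))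
    (hu : MemLp u 2 (volume.restrict (Ioc (-Real.pi) Real.pi))) (c : ℂ) (l : ℝ) :
    expCoeff (fun x => h x + c * u x) l = expCoeff h l + c * expCoeff u l := by
  have hle := neg_pi_lt_pi.le
  unfold expCoeff
  rw [← intervalIntegral.integral_const_mul, ← intervalIntegral.integral_add
    (intervalIntegrable_of_memLp hle (memLp_mul_exp hh l))
    ((intervalIntegrable_of_memLp hle (memLp_mul_exp hu l)).const_mul c)]
  refine intervalIntegral.integral_congr fun x _ => ?_
  simp only
  ring

/-- One frequency of a complete system of exponentials may be moved. -/
lemma ExpComplete.insert_of_insert {A : Set ℝ} {a b : ℝ} (hA : ExpComplete (insert b A)) (ha : a ∉ A) :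
    ExpComplete (insert a A) := by
  intro h hh h0
  obtain ⟨u, hu, hfac⟩ := exists_expCoeff_factor hh (h0 a (mem_insert _ _))
  have hm : MemLp (fun x => h x + Complex.I * ((b - a : ℝ) : ℂ) * u x) 2
      (volume.restrict (Ioc (-Real.pi) Real.pi)) := hh.add (hu.const_mul _)
  have hc : ∀ l, expCoeff (fun x => h x + Complex.I * ((b - a : ℝ) : ℂ) * u x) l =
      Complex.I * ((b - l : ℝ) : ℂ) * expCoeff u l := by
    intro l
    rw [expCoeff_add_smul hh hu, hfac l]
    push_cast
    ring
  have hz := hA _ hm (by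
    intro l hl
    rw [hc]
    rcases mem_insert_iff.1 hl with rfl | hl
    · simp
    · have h1 := hfac l
      rw [h0 l (mem_insert_of_mem _ hl)] at h1
      have hne : ((a - l : ℝ) : ℂ) ≠ 0 := by
        rw [Complex.ofReal_ne_zero, sub_ne_zero]
        rintro rfl
        exact ha hl
      have h2 : expCoeff u l = 0 := by
        rcases mul_eq_zero.1 h1.symm with h3 | h3
        · exact absurd h3 (mul_ne_zero Complex.I_ne_zero hne)
        · exact h3
      rw [h2, mul_zero])
  refine ae_eq_zero_of_expCoeff_ne hh b fun l hl => ?_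
  have h1 : expCoeff (fun x => h x + Complex.I * ((b - a : ℝ) : ℂ) * u x) l = 0 := by
    unfold expCoeff
    rw [intervalIntegral.integral_of_le neg_pi_lt_pi.le]
    refine integral_eq_zero_of_ae ?_
    filter_upwards [hz] with x hx
    rw [hx]
    simp
  rw [hc] at h1
  have hne : ((b - l : ℝ) : ℂ) ≠ 0 := by
    rw [Complex.ofReal_ne_zero, sub_ne_zero]
    exact hl.symm
  rcases mul_eq_zero.1 h1 with h3 | h3
  · exact absurd h3 (mul_ne_zero Complex.I_ne_zero hne)
  · rw [hfac, h3, mul_zero]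

lemma ExpComplete.mono {A B : Set ℝ} (hA : ExpComplete A) (h : A ⊆ B) : ExpComplete B :=
  fun u hu h0 => hA u hu fun l hl => h0 l (h hl)

/-- Finitely many frequencies of a complete system of exponentials may be moved. -/
lemma ExpComplete.exchange {A : Set ℝ} (k : ℕ) : ∀ S S' : Finset ℝ, (S \ S').card = k →
    S.card ≤ S'.card → Disjoint A S' → ExpComplete (A ∪ S) → ExpComplete (A ∪ S') := by
  induction k with
  | zero =>
    intro S S' h0 _ _ hA
    rw [Finset.card_eq_zero, Finset.sdiff_eq_empty_iff_subset] at h0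
    exact hA.mono (union_subset_union_right _ (by exact_mod_cast h0))
  | succ k ih =>
    intro S S' hk hc hd hA
    obtain ⟨b, hb⟩ : (S \ S').Nonempty := by rw [← Finset.card_pos]; omega
    obtain ⟨a, ha⟩ : (S' \ S).Nonempty := by
      rw [← Finset.card_pos]
      have := Finset.card_sdiff_le_card_sdiff_iff.2 hc
      omega
    rw [Finset.mem_sdiff] at ha hb
    refine ih (insert a (S.erase b)) S' ?_ ?_ hd ?_
    · have : insert a (S.erase b) \ S' = (S \ S').erase b := by
        ext x
        simp only [Finset.mem_sdiff, Finset.mem_insert, Finset.mem_erase]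
        constructor
        · rintro ⟨rfl | h1, h2⟩
          · exact absurd ha.1 h2
          · exact ⟨h1.1, h1.2, h2⟩
        · rintro ⟨h1, h2, h3⟩
          exact ⟨Or.inr ⟨h1, h2⟩, h3⟩
      rw [this, Finset.card_erase_of_mem (Finset.mem_sdiff.2 hb), hk, Nat.add_sub_cancel]
    · rw [Finset.card_insert_of_notMem (fun h => ha.2 (Finset.mem_of_mem_erase h)),
        Finset.card_erase_add_one hb.1]
      exact hc
    · have e1 : A ∪ ((insert a (S.erase b) : Finset ℝ) : Set ℝ) =
          insert a (A ∪ ((S.erase b : Finset ℝ) : Set ℝ)) := by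
        rw [Finset.coe_insert, union_insert]
      have e2 : A ∪ (S : Set ℝ) = insert b (A ∪ ((S.erase b : Finset ℝ) : Set ℝ)) := by
        rw [← union_insert, ← Finset.coe_insert, Finset.insert_erase hb.1]
      rw [e1]
      rw [e2] at hA
      refine hA.insert_of_insert ?_
      rintro (h | h)
      · exact Set.disjoint_left.1 hd h (by exact_mod_cast ha.1)
      · exact ha.2 (Finset.mem_of_mem_erase (by exact_mod_cast h))

lemma norm_exp_sub_exp_le (s t : ℝ) :
    ‖Complex.exp (Complex.I * (s : ℂ)) - Complex.exp (Complex.I * (t : ℂ))‖ ≤ |s - t| := by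
  have e : Complex.exp (Complex.I * (s : ℂ)) - Complex.exp (Complex.I * (t : ℂ)) =
      Complex.exp (Complex.I * (t : ℂ)) * (Complex.exp (Complex.I * ((s - t : ℝ) : ℂ)) - 1) := by
    rw [mul_sub, ← Complex.exp_add, mul_one]
    congr 2
    push_cast
    ring
  rw [e, norm_mul, norm_exp_I_mul, one_mul]
  exact Real.norm_exp_I_mul_ofReal_sub_one_le

lemma norm_expCoeff_sub_sq_le {h : ℝ → ℂ}
    (hh : MemLp h 2 (volume.restrict (Ioc (-Real.pi) Real.pi))) (l m : ℝ) :
    ‖expCoeff h l - expCoeff h m‖ ^ 2 ≤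
      2 * Real.pi * (∫ x in (-Real.pi)..Real.pi, ‖h x‖ ^ 2) * (Real.pi ^ 2 * (l - m) ^ 2) := by
  have hle := neg_pi_lt_pi.le
  have hcont : Continuous fun x : ℝ => Complex.exp (Complex.I * ((l * x : ℝ) : ℂ)) -
      Complex.exp (Complex.I * ((m * x : ℝ) : ℂ)) := by fun_prop
  have hb : ∀ x ∈ Ioc (-Real.pi) Real.pi, ‖Complex.exp (Complex.I * ((l * x : ℝ) : ℂ)) -
      Complex.exp (Complex.I * ((m * x : ℝ) : ℂ))‖ ≤ Real.pi * |l - m| := by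
    intro x hx
    refine (norm_exp_sub_exp_le _ _).trans ?_
    rw [← sub_mul, abs_mul, mul_comm]
    gcongr
    exact abs_le.2 ⟨hx.1.le, hx.2⟩
  have hb' := (ae_restrict_iff' (μ := volume) measurableSet_Ioc).2 (ae_of_all _ hb)
  have hg : MemLp (fun x : ℝ => Complex.exp (Complex.I * ((l * x : ℝ) : ℂ)) -
      Complex.exp (Complex.I * ((m * x : ℝ) : ℂ))) 2 (volume.restrict (Ioc (-Real.pi) Real.pi)) :=
    MemLp.of_bound hcont.aestronglyMeasurable _ hb'
  have e : expCoeff h l - expCoeff h m = ∫ x in Ioc (-Real.pi) Real.pi,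
      h x * (Complex.exp (Complex.I * ((l * x : ℝ) : ℂ)) -
        Complex.exp (Complex.I * ((m * x : ℝ) : ℂ))) := by
    unfold expCoeff
    rw [← intervalIntegral.integral_sub (intervalIntegrable_of_memLp hle (memLp_mul_exp hh l))
      (intervalIntegrable_of_memLp hle (memLp_mul_exp hh m)), intervalIntegral.integral_of_le hle]
    simp_rw [mul_sub]
  rw [e, intervalIntegral.integral_of_le hle]
  refine (norm_integral_mul_sq_le hh hg).trans ?_
  have h2 : ∫ x in Ioc (-Real.pi) Real.pi, ‖Complex.exp (Complex.I * ((l * x : ℝ) : ℂ)) -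
      Complex.exp (Complex.I * ((m * x : ℝ) : ℂ))‖ ^ 2 ≤ 2 * Real.pi * (Real.pi ^ 2 * (l - m) ^ 2) := by
    have h3 : ∫ x in Ioc (-Real.pi) Real.pi, ‖Complex.exp (Complex.I * ((l * x : ℝ) : ℂ)) -
      Complex.exp (Complex.I * ((m * x : ℝ) : ℂ))‖ ^ 2 ≤
        ∫ x in Ioc (-Real.pi) Real.pi, Real.pi ^ 2 * (l - m) ^ 2 := by
      refine integral_mono_ae hg.integrable_norm_pow' (integrable_const _) ?_
      filter_upwards [hb'] with x hx
      calc _ ≤ (Real.pi * |l - m|) ^ 2 := by gcongr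
        _ = _ := by rw [mul_pow, sq_abs]
    refine h3.trans_eq ?_
    rw [integral_const]
    simp only [MeasurableSet.univ, measureReal_restrict_apply, univ_inter, Real.volume_real_Ioc,
      smul_eq_mul]
    rw [max_eq_left (by linarith)]
    ring
  calc _ ≤ (∫ x in Ioc (-Real.pi) Real.pi, ‖h x‖ ^ 2) * (2 * Real.pi * (Real.pi ^ 2 * (l - m) ^ 2)) := by
        gcongr
    _ = _ := by ring

/-- Exponentials whose distinct frequencies are quadratically close to the integers are complete. -/
lemma expComplete_range {lam : ℤ → ℝ} (hinj : Function.Injective lam)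
    (hs : Summable fun n : ℤ => (lam n - n) ^ 2) : ExpComplete (range lam) := by
  have hpi := Real.pi_pos
  obtain ⟨N, hN⟩ := summable_iff_vanishing_norm.1 hs (1 / (2 * Real.pi ^ 2)) (by positivity)
  have hN' : ∀ t : Finset ℤ, Disjoint t N → ∑ n ∈ t, (lam n - n) ^ 2 ≤ 1 / (2 * Real.pi ^ 2) :=
    fun t ht => (le_abs_self _).trans (hN t ht).le
  have hinjZ : Function.Injective (fun n : ℤ => (n : ℝ)) := Int.cast_injective
  have h1 : ExpComplete ((lam '' {n | n ∉ N}) ∪ ((N.image fun n : ℤ => (n : ℝ)) : Finset ℝ)) := by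
    intro h hh h0
    set M := ∫ x in (-Real.pi)..Real.pi, ‖h x‖ ^ 2 with hM
    have hMnn : 0 ≤ M := by
      rw [hM, intervalIntegral.integral_of_le neg_pi_lt_pi.le]
      exact integral_nonneg fun _ => by positivity
    have hle : 2 * Real.pi * M ≤ Real.pi * M := by
      refine hasSum_le_of_sum_le (hasSum_sq_expCoeff hh) fun t => ?_
      have e1 : ∑ n ∈ t, ‖expCoeff h n‖ ^ 2 = ∑ n ∈ t \ N, ‖expCoeff h n‖ ^ 2 := by
        refine (Finset.sum_subset Finset.sdiff_subset fun n hn hn' => ?_).symm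
        have hnN : n ∈ N := by
          by_contra hc
          exact hn' (Finset.mem_sdiff.2 ⟨hn, hc⟩)
        rw [h0 n (Or.inr (by exact_mod_cast Finset.mem_image_of_mem _ hnN))]
        simp
      rw [e1]
      calc ∑ n ∈ t \ N, ‖expCoeff h n‖ ^ 2
          ≤ ∑ n ∈ t \ N, 2 * Real.pi * M * (Real.pi ^ 2 * (lam n - n) ^ 2) := by
            refine Finset.sum_le_sum fun n hn => ?_
            have h2 := norm_expCoeff_sub_sq_le hh (lam n) n
            rw [h0 (lam n) (Or.inl ⟨n, (Finset.mem_sdiff.1 hn).2, rfl⟩), zero_sub, norm_neg] at h2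
            exact h2
        _ = 2 * Real.pi * M * Real.pi ^ 2 * ∑ n ∈ t \ N, (lam n - n) ^ 2 := by
            rw [Finset.mul_sum]
            exact Finset.sum_congr rfl fun n _ => by ring
        _ ≤ 2 * Real.pi * M * Real.pi ^ 2 * (1 / (2 * Real.pi ^ 2)) := by
            gcongr
            exact hN' _ Finset.sdiff_disjoint
        _ = Real.pi * M := by field_simp
    refine ae_eq_zero_of_integral_sq hh ?_
    rw [← hM]
    nlinarith
  have h2 := ExpComplete.exchange _ (N.image fun n : ℤ => (n : ℝ)) (N.image lam) rfl
    (by rw [Finset.card_image_of_injective _ hinjZ, Finset.card_image_of_injective _ hinj])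
    (by
      rw [Set.disjoint_left]
      rintro _ ⟨n, hn, rfl⟩ hx
      rw [Finset.mem_coe, Finset.mem_image] at hx
      obtain ⟨m, hm, hmn⟩ := hx
      exact hn (hinj hmn ▸ hm)) h1
  refine h2.mono ?_
  rintro x (⟨n, _, rfl⟩ | hx)
  · exact mem_range_self n
  · rw [Finset.mem_coe, Finset.mem_image] at hx
    obtain ⟨m, _, rfl⟩ := hx
    exact mem_range_self m

end DiracGLM

namespace DiracGLM

lemma memLp_complex_of_re_im {X : Type*} [MeasurableSpace X] {μ : Measure X} {f g : X → ℝ}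
    (hf : MemLp f 2 μ) (hg : MemLp g 2 μ) :
    MemLp (fun x => (f x : ℂ) + (g x : ℂ) * Complex.I) 2 μ := by
  have h1 : MemLp (fun x => (f x : ℂ)) 2 μ := MemLp.ofReal (K := ℂ) hf
  have h2 : MemLp (fun x => (g x : ℂ)) 2 μ := MemLp.ofReal (K := ℂ) hg
  have h3 : MemLp (fun x => (g x : ℂ) * Complex.I) 2 μ := h2.mul_const Complex.I
  exact h1.add h3

lemma memLp_conj_neg {v : ℝ → ℂ} (hv : MemLp v 2 volume) :
    MemLp (fun x => (starRingEnd ℂ) (v (-x))) 2 volume :=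
  (hv.comp_measurePreserving (Measure.measurePreserving_neg volume)).star

lemma expCoeff_conj_neg (v : ℝ → ℂ) (l : ℝ) :
    expCoeff (fun x => (starRingEnd ℂ) (v (-x))) l = (starRingEnd ℂ) (expCoeff v l) := by
  have hle := neg_pi_lt_pi.le
  unfold expCoeff
  rw [intervalIntegral.integral_of_le hle, intervalIntegral.integral_of_le hle, ← integral_conj,
    ← intervalIntegral.integral_of_le hle, ← intervalIntegral.integral_of_le hle]
  have := intervalIntegral.integral_comp_neg (a := -Real.pi) (b := Real.pi)
    (fun x => (starRingEnd ℂ) (v x * Complex.exp (Complex.I * ((l * x : ℝ) : ℂ))))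
  rw [neg_neg] at this
  rw [← this]
  refine intervalIntegral.integral_congr fun x _ => ?_
  simp only [map_mul, ← Complex.exp_conj, Complex.conj_I, Complex.conj_ofReal]
  congr 2
  push_cast
  ring

lemma expCoeff_add_conj_neg {v : ℝ → ℂ} (hv : MemLp v 2 volume) (l : ℝ) :
    expCoeff (fun x => v x + (starRingEnd ℂ) (v (-x))) l = ((2 * (expCoeff v l).re : ℝ) : ℂ) := by
  have h := expCoeff_add_smul (hv.restrict _) ((memLp_conj_neg hv).restrict _) 1 l
  simp only [one_mul] at h
  rw [h, expCoeff_conj_neg, Complex.add_conj]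

lemma intervalIntegral_indicator_Ioo {E : Type*} [NormedAddCommGroup E] [NormedSpace ℝ E]
    (F : ℝ → E) : ∫ x in (-Real.pi)..Real.pi, (Ioo 0 Real.pi).indicator F x =
      ∫ x in Ioo 0 Real.pi, F x := by
  have hsub : Ioc (-Real.pi) Real.pi ∩ Ioo 0 Real.pi = Ioo 0 Real.pi := by
    refine inter_eq_right.2 fun x hx => ⟨?_, hx.2.le⟩
    linarith [hx.1, Real.pi_pos]
  rw [intervalIntegral.integral_of_le neg_pi_lt_pi.le, setIntegral_indicator measurableSet_Ioo, hsub]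

lemma expCoeff_indicator_re {f g : ℝ → ℝ} (hf : MemLp f 2 (volume.restrict (Ioo 0 Real.pi)))
    (hg : MemLp g 2 (volume.restrict (Ioo 0 Real.pi))) (l : ℝ) :
    (expCoeff ((Ioo 0 Real.pi).indicator fun x => (g x : ℂ) + (f x : ℂ) * Complex.I) l).re =
      -∫ x in Ioo 0 Real.pi, (f x * Real.sin (l * x) - g x * Real.cos (l * x)) := by
  have hwm : MemLp (fun x => (g x : ℂ) + (f x : ℂ) * Complex.I) 2
    (volume.restrict (Ioo 0 Real.pi)) := memLp_complex_of_re_im hg hf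
  have e3 : expCoeff ((Ioo 0 Real.pi).indicator fun x => (g x : ℂ) + (f x : ℂ) * Complex.I) l =
      ∫ x in Ioo 0 Real.pi, ((g x : ℂ) + (f x : ℂ) * Complex.I) *
        Complex.exp (Complex.I * ((l * x : ℝ) : ℂ)) := by
    unfold expCoeff
    rw [← intervalIntegral_indicator_Ioo]
    refine intervalIntegral.integral_congr fun x _ => ?_
    by_cases hx : x ∈ Ioo 0 Real.pi
    · simp only [indicator_of_mem hx]
    · simp only [indicator_of_notMem hx, zero_mul]
  have hint := (memLp_mul_exp hwm l).integrable one_le_two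
  have h5 := integral_re (𝕜 := ℂ) hint
  simp only [RCLike.re_eq_complex_re] at h5
  rw [e3, ← h5, ← integral_neg]
  refine integral_congr_ae (ae_of_all _ fun x => ?_)
  simp only [mul_comm Complex.I, Complex.mul_re, Complex.exp_ofReal_mul_I_re,
    Complex.exp_ofReal_mul_I_im]
  simp

lemma integral_norm_sq_add_conj_neg {f g : ℝ → ℝ} (hf : MemLp f 2 (volume.restrict (Ioo 0 Real.pi)))
    (hg : MemLp g 2 (volume.restrict (Ioo 0 Real.pi))) {v : ℝ → ℂ}
    (hv : v = (Ioo 0 Real.pi).indicator fun x => (g x : ℂ) + (f x : ℂ) * Complex.I) :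
    ∫ x in (-Real.pi)..Real.pi, ‖v x + (starRingEnd ℂ) (v (-x))‖ ^ 2 =
      2 * ∫ x in Ioo 0 Real.pi, (f x ^ 2 + g x ^ 2) := by
  have hle := neg_pi_lt_pi.le
  have hwm : MemLp (fun x => (g x : ℂ) + (f x : ℂ) * Complex.I) 2
    (volume.restrict (Ioo 0 Real.pi)) := memLp_complex_of_re_im hg hf
  have hvm : MemLp v 2 volume := by
    rw [hv]; exact (memLp_indicator_iff_restrict measurableSet_Ioo).2 hwm
  have hvn : MemLp (fun x => v (-x)) 2 volume :=
    hvm.comp_measurePreserving (Measure.measurePreserving_neg volume)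
  have e1 : ∀ x, ‖v x + (starRingEnd ℂ) (v (-x))‖ ^ 2 = ‖v x‖ ^ 2 + ‖v (-x)‖ ^ 2 := by
    intro x
    by_cases hx : x ∈ Ioo 0 Real.pi
    · have : v (-x) = 0 := by
        rw [hv]; exact indicator_of_notMem (fun h => by linarith [hx.1, h.1]) _
      simp [this]
    · have : v x = 0 := by rw [hv]; exact indicator_of_notMem hx _
      simp [this]
  simp_rw [e1]
  have i1 : IntervalIntegrable (fun x => ‖v x‖ ^ 2) volume (-Real.pi) Real.pi := by
    rw [intervalIntegrable_iff, uIoc_of_le hle]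
    exact (hvm.restrict _).integrable_norm_pow'
  have i2 : IntervalIntegrable (fun x => ‖v (-x)‖ ^ 2) volume (-Real.pi) Real.pi := by
    rw [intervalIntegrable_iff, uIoc_of_le hle]
    exact (hvn.restrict _).integrable_norm_pow'
  rw [intervalIntegral.integral_add i1 i2]
  have := intervalIntegral.integral_comp_neg (a := -Real.pi) (b := Real.pi) (fun x => ‖v x‖ ^ 2)
  rw [neg_neg] at this
  rw [this, ← two_mul, ← intervalIntegral_indicator_Ioo]
  congr 1
  refine intervalIntegral.integral_congr fun x _ => ?_
  simp only [hv]
  by_cases hx : x ∈ Ioo 0 Real.pi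
  · rw [indicator_of_mem hx, indicator_of_mem hx, ← Complex.normSq_eq_norm_sq, Complex.normSq_apply]
    simp
    ring
  · rw [indicator_of_notMem hx, indicator_of_notMem hx]
    simp

lemma exists_expCoeff_eq {f g : ℝ → ℝ} (hf : MemLp f 2 (volume.restrict (Ioo 0 Real.pi)))
    (hg : MemLp g 2 (volume.restrict (Ioo 0 Real.pi))) :
    ∃ h : ℝ → ℂ, MemLp h 2 (volume.restrict (Ioc (-Real.pi) Real.pi)) ∧
      (∀ l, expCoeff h l = ((-2 * ∫ x in Ioo 0 Real.pi,
        (f x * Real.sin (l * x) - g x * Real.cos (l * x)) : ℝ) : ℂ)) ∧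
      ∫ x in (-Real.pi)..Real.pi, ‖h x‖ ^ 2 = 2 * ∫ x in Ioo 0 Real.pi, (f x ^ 2 + g x ^ 2) := by
  have hwm : MemLp (fun x => (g x : ℂ) + (f x : ℂ) * Complex.I) 2
    (volume.restrict (Ioo 0 Real.pi)) := memLp_complex_of_re_im hg hf
  have hvm := (memLp_indicator_iff_restrict measurableSet_Ioo).2 hwm
  refine ⟨_, (hvm.add (memLp_conj_neg hvm)).restrict _, fun l => ?_,
    integral_norm_sq_add_conj_neg hf hg rfl⟩
  refine (expCoeff_add_conj_neg hvm l).trans ?_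
  rw [expCoeff_indicator_re hf hg]
  congr 1
  ring

lemma hasSum_sq_sinCos_real {f g : ℝ → ℝ} (hf : MemLp f 2 (volume.restrict (Ioo 0 Real.pi)))
    (hg : MemLp g 2 (volume.restrict (Ioo 0 Real.pi))) :
    HasSum (fun n : ℤ => (∫ x in Ioo 0 Real.pi,
        (f x * Real.sin (n * x) - g x * Real.cos (n * x))) ^ 2)
      (Real.pi * ∫ x in Ioo 0 Real.pi, (f x ^ 2 + g x ^ 2)) := by
  obtain ⟨h, hh, hc, hn⟩ := exists_expCoeff_eq hf hg
  have h1 := (hasSum_sq_expCoeff hh).mul_left (1 / 4)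
  rw [hn] at h1
  convert! h1 using 1
  · funext n
    rw [hc, Complex.norm_real, Real.norm_eq_abs, sq_abs]
    ring
  · ring

lemma integral_sq_eq_zero_of_complete {A : Set ℝ} (hA : ExpComplete A) {f g : ℝ → ℝ}
    (hf : MemLp f 2 (volume.restrict (Ioo 0 Real.pi)))
    (hg : MemLp g 2 (volume.restrict (Ioo 0 Real.pi)))
    (h0 : ∀ l ∈ A, ∫ x in Ioo 0 Real.pi, (f x * Real.sin (l * x) - g x * Real.cos (l * x)) = 0) :
    ∫ x in Ioo 0 Real.pi, (f x ^ 2 + g x ^ 2) = 0 := by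
  obtain ⟨h, hh, hc, hn⟩ := exists_expCoeff_eq hf hg
  have h1 := hA h hh fun l hl => by rw [hc, h0 l hl]; simp
  have h2 : ∫ x in (-Real.pi)..Real.pi, ‖h x‖ ^ 2 = 0 := by
    rw [intervalIntegral.integral_of_le neg_pi_lt_pi.le]
    refine integral_eq_zero_of_ae ?_
    filter_upwards [h1] with x hx
    simp [hx]
  linarith

variable {𝕜 : Type*} [RCLike 𝕜]

/-- The pairing on `(0, x)` of a vector function with `φ₀(·, l)`. -/
noncomputable def pairing (x : ℝ) (f g : ℝ → 𝕜) (l : ℝ) : 𝕜 :=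
  ∫ t in Ioo 0 x, (f t * (Real.sin (l * t) : 𝕜) - g t * (Real.cos (l * t) : 𝕜))

lemma memLp_mul_ofReal_continuous {μ : Measure ℝ} {f : ℝ → 𝕜} (hf : MemLp f 2 μ) {c : ℝ → ℝ}
    (hc : Continuous c) (hb : ∀ t, |c t| ≤ 1) : MemLp (fun t => f t * (c t : 𝕜)) 2 μ := by
  refine hf.mono (hf.1.mul (RCLike.continuous_ofReal.comp hc).aestronglyMeasurable)
    (ae_of_all _ fun t => ?_)
  rw [norm_mul, RCLike.norm_ofReal]
  exact mul_le_of_le_one_right (norm_nonneg _) (hb t)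

lemma memLp_mul_sin {μ : Measure ℝ} {f : ℝ → 𝕜} (hf : MemLp f 2 μ) (l : ℝ) :
    MemLp (fun t => f t * (Real.sin (l * t) : 𝕜)) 2 μ :=
  memLp_mul_ofReal_continuous hf (by fun_prop) fun _ => Real.abs_sin_le_one _

lemma memLp_mul_cos {μ : Measure ℝ} {f : ℝ → 𝕜} (hf : MemLp f 2 μ) (l : ℝ) :
    MemLp (fun t => f t * (Real.cos (l * t) : 𝕜)) 2 μ :=
  memLp_mul_ofReal_continuous hf (by fun_prop) fun _ => Real.abs_cos_le_one _

lemma setIntegral_Ioo_indicator {x : ℝ} (hx : x ≤ Real.pi) (F : ℝ → ℝ) :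
    ∫ t in Ioo 0 Real.pi, (Ioo 0 x).indicator F t = ∫ t in Ioo 0 x, F t := by
  rw [setIntegral_indicator measurableSet_Ioo, inter_eq_right.2 (Ioo_subset_Ioo_right hx)]

lemma memLp_indicator_comp {x : ℝ} (hx : x ≤ Real.pi) {f : ℝ → 𝕜}
    (hf : MemLp f 2 (volume.restrict (Ioo 0 x))) (L : 𝕜 →L[ℝ] ℝ) :
    MemLp ((Ioo 0 x).indicator fun t => L (f t)) 2 (volume.restrict (Ioo 0 Real.pi)) := by
  rw [memLp_indicator_iff_restrict measurableSet_Ioo, Measure.restrict_restrict measurableSet_Ioo,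
    inter_eq_left.2 (Ioo_subset_Ioo_right hx)]
  exact L.comp_memLp' hf

lemma pairing_comp {x : ℝ} (hx : x ≤ Real.pi) {f g : ℝ → 𝕜}
    (hf : MemLp f 2 (volume.restrict (Ioo 0 x)))
    (hg : MemLp g 2 (volume.restrict (Ioo 0 x))) (L : 𝕜 →L[ℝ] ℝ)
    (hL : ∀ (z : 𝕜) (r : ℝ), L (z * (r : 𝕜)) = L z * r) (l : ℝ) :
    ∫ t in Ioo 0 Real.pi, ((Ioo 0 x).indicator (fun t => L (f t)) t * Real.sin (l * t) -
      (Ioo 0 x).indicator (fun t => L (g t)) t * Real.cos (l * t)) = L (pairing x f g l) := by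
  have hint : Integrable (fun t => f t * (Real.sin (l * t) : 𝕜) - g t * (Real.cos (l * t) : 𝕜))
      (volume.restrict (Ioo 0 x)) :=
    ((memLp_mul_sin hf l).sub (memLp_mul_cos hg l)).integrable one_le_two
  rw [pairing, ← L.integral_comp_comm hint, ← setIntegral_Ioo_indicator hx]
  refine integral_congr_ae (ae_of_all _ fun t => ?_)
  by_cases ht : t ∈ Ioo 0 x
  · simp only [indicator_of_mem ht, map_sub, hL]
  · simp only [indicator_of_notMem ht, zero_mul, sub_zero]

lemma integral_indicator_sq {x : ℝ} (hx : x ≤ Real.pi) {f g : ℝ → 𝕜}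
    (hf : MemLp f 2 (volume.restrict (Ioo 0 x)))
    (hg : MemLp g 2 (volume.restrict (Ioo 0 x))) (L : 𝕜 →L[ℝ] ℝ) :
    ∫ t in Ioo 0 Real.pi, ((Ioo 0 x).indicator (fun t => L (f t)) t ^ 2 +
      (Ioo 0 x).indicator (fun t => L (g t)) t ^ 2) =
    (∫ t in Ioo 0 x, L (f t) ^ 2) + ∫ t in Ioo 0 x, L (g t) ^ 2 := by
  have i1 : Integrable (fun t => L (f t) ^ 2) (volume.restrict (Ioo 0 x)) :=
    (L.comp_memLp' hf).integrable_sq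
  have i2 : Integrable (fun t => L (g t) ^ 2) (volume.restrict (Ioo 0 x)) :=
    (L.comp_memLp' hg).integrable_sq
  rw [← integral_add i1 i2, ← setIntegral_Ioo_indicator hx]
  refine integral_congr_ae (ae_of_all _ fun t => ?_)
  by_cases ht : t ∈ Ioo 0 x
  · simp only [indicator_of_mem ht]
  · simp only [indicator_of_notMem ht]
    simp

lemma integral_norm_sq_eq {x : ℝ} {f : ℝ → 𝕜}
    (hf : MemLp f 2 (volume.restrict (Ioo 0 x))) :
    ∫ t in Ioo 0 x, ‖f t‖ ^ 2 = (∫ t in Ioo 0 x, (RCLike.reCLM (f t) : ℝ) ^ 2) +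
      ∫ t in Ioo 0 x, (RCLike.imCLM (f t) : ℝ) ^ 2 := by
  have i1 : Integrable (fun t => (RCLike.reCLM (f t) : ℝ) ^ 2) (volume.restrict (Ioo 0 x)) :=
    ((RCLike.reCLM (K := 𝕜)).comp_memLp' hf).integrable_sq
  have i2 : Integrable (fun t => (RCLike.imCLM (f t) : ℝ) ^ 2) (volume.restrict (Ioo 0 x)) :=
    ((RCLike.imCLM (K := 𝕜)).comp_memLp' hf).integrable_sq
  rw [← integral_add i1 i2]
  refine integral_congr_ae (ae_of_all _ fun t => ?_)
  simp only [RCLike.reCLM_apply, RCLike.imCLM_apply]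
  rw [RCLike.norm_sq_eq_def]
  ring

/-- Parseval's identity for the functions `φ₀(·, n)`. -/
lemma hasSum_sq_pairing {x : ℝ} (hx : x ≤ Real.pi) {f g : ℝ → 𝕜}
    (hf : MemLp f 2 (volume.restrict (Ioo 0 x)))
    (hg : MemLp g 2 (volume.restrict (Ioo 0 x))) :
    HasSum (fun n : ℤ => ‖pairing x f g n‖ ^ 2)
      (Real.pi * ((∫ t in Ioo 0 x, ‖f t‖ ^ 2) + ∫ t in Ioo 0 x, ‖g t‖ ^ 2)) := by
  have h1 := hasSum_sq_sinCos_real (memLp_indicator_comp hx hf RCLike.reCLM)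
    (memLp_indicator_comp hx hg RCLike.reCLM)
  have h2 := hasSum_sq_sinCos_real (memLp_indicator_comp hx hf RCLike.imCLM)
    (memLp_indicator_comp hx hg RCLike.imCLM)
  simp_rw [pairing_comp hx hf hg RCLike.reCLM (by simp), integral_indicator_sq hx hf hg] at h1
  simp_rw [pairing_comp hx hf hg RCLike.imCLM (by simp), integral_indicator_sq hx hf hg] at h2
  rw [integral_norm_sq_eq hf, integral_norm_sq_eq hg]
  convert! h1.add h2 using 1
  · funext n
    rw [RCLike.norm_sq_eq_def]
    simp only [RCLike.reCLM_apply, RCLike.imCLM_apply]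
    ring
  · ring

lemma integral_norm_sq_eq_zero_of_pairing {x : ℝ} (hx : x ≤ Real.pi) {f g : ℝ → 𝕜}
    (hf : MemLp f 2 (volume.restrict (Ioo 0 x)))
    (hg : MemLp g 2 (volume.restrict (Ioo 0 x))) {A : Set ℝ} (hA : ExpComplete A)
    (h0 : ∀ l ∈ A, pairing x f g l = 0) :
    (∫ t in Ioo 0 x, ‖f t‖ ^ 2) + ∫ t in Ioo 0 x, ‖g t‖ ^ 2 = 0 := by
  have h1 := integral_sq_eq_zero_of_complete hA (memLp_indicator_comp hx hf RCLike.reCLM)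
    (memLp_indicator_comp hx hg RCLike.reCLM) fun l hl => by
      rw [pairing_comp hx hf hg RCLike.reCLM (by simp), h0 l hl, map_zero]
  have h2 := integral_sq_eq_zero_of_complete hA (memLp_indicator_comp hx hf RCLike.imCLM)
    (memLp_indicator_comp hx hg RCLike.imCLM) fun l hl => by
      rw [pairing_comp hx hf hg RCLike.imCLM (by simp), h0 l hl, map_zero]
  rw [integral_indicator_sq hx hf hg] at h1 h2
  rw [integral_norm_sq_eq hf, integral_norm_sq_eq hg]
  linarith

end DiracGLM

namespace DiracGLM

/-- Lebesgue measure on `(-2π, 2π)`. -/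
noncomputable def mu2 : Measure ℝ := volume.restrict (Ioo (-(2 * Real.pi)) (2 * Real.pi))

instance : IsFiniteMeasure mu2 := by unfold mu2; infer_instance

lemma memLp_mu2_of_continuous {f : ℝ → ℂ} (hf : Continuous f) (p : ENNReal) : MemLp f p mu2 := by
  obtain ⟨C, hC⟩ := isCompact_Icc.exists_bound_of_continuousOn
    (s := Icc (-(2 * Real.pi)) (2 * Real.pi)) hf.continuousOn
  exact MemLp.of_bound hf.aestronglyMeasurable C ((ae_restrict_iff' measurableSet_Ioo).2
    (ae_of_all _ fun x hx => hC x (Ioo_subset_Icc_self hx)))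

lemma continuous_exp_mul (l : ℝ) : Continuous fun s : ℝ => Complex.exp (Complex.I * ((l * s : ℝ) : ℂ)) :=
  (contDiff_exp_mul l).continuous

/-- The normalized exponential with integer frequency as an element of `L₂(-2π, 2π)`. -/
noncomputable def expLp (n : ℤ) : Lp ℂ 2 mu2 :=
  (((√(4 * Real.pi))⁻¹ : ℝ) : ℂ) • (memLp_mu2_of_continuous (continuous_exp_mul n) 2).toLp _

lemma integral_exp_int (k : ℤ) : ∫ s, Complex.exp (Complex.I * (((k : ℝ) * s : ℝ) : ℂ)) ∂mu2 =
    if k = 0 then ((4 * Real.pi : ℝ) : ℂ) else 0 := by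
  have hpi := Real.pi_pos
  unfold mu2
  rw [← integral_Ioc_eq_integral_Ioo, ← intervalIntegral.integral_of_le (by linarith)]
  split_ifs with hk
  · subst hk
    simp
    ring
  · have hc : Complex.I * (k : ℂ) ≠ 0 := mul_ne_zero Complex.I_ne_zero (by exact_mod_cast hk)
    have e : ∀ s : ℝ, Complex.exp (Complex.I * (((k : ℝ) * s : ℝ) : ℂ)) =
        Complex.exp (Complex.I * (k : ℂ) * (s : ℂ)) := fun s => by
      congr 1; push_cast; ring
    simp_rw [e]
    rw [integral_exp_mul_complex hc]
    have e1 : Complex.I * (k : ℂ) * ((2 * Real.pi : ℝ) : ℂ) =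
        Complex.I * (k : ℂ) * ((-(2 * Real.pi) : ℝ) : ℂ) + ((2 * k : ℤ) : ℂ) * (2 * Real.pi * Complex.I) := by
      push_cast; ring
    rw [e1, Complex.exp_add, Complex.exp_int_mul_two_pi_mul_I, mul_one, sub_self, zero_div]

lemma orthonormal_expLp : Orthonormal ℂ expLp := by
  have hpi := Real.pi_pos
  rw [orthonormal_iff_ite]
  intro n m
  rw [expLp, expLp, inner_smul_left, inner_smul_right, L2.inner_def]
  have e : ∫ s, inner ℂ ((memLp_mu2_of_continuous (continuous_exp_mul n) 2).toLp _ s)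
      ((memLp_mu2_of_continuous (continuous_exp_mul m) 2).toLp _ s) ∂mu2 =
      ∫ s, Complex.exp (Complex.I * ((((m - n : ℤ) : ℝ) * s : ℝ) : ℂ)) ∂mu2 := by
    refine integral_congr_ae ?_
    filter_upwards [(memLp_mu2_of_continuous (continuous_exp_mul n) 2).coeFn_toLp,
      (memLp_mu2_of_continuous (continuous_exp_mul m) 2).coeFn_toLp] with s h1 h2
    rw [h1, h2, RCLike.inner_apply, ← Complex.exp_conj, ← Complex.exp_add]
    congr 1
    simp only [map_mul, Complex.conj_I, Complex.conj_ofReal]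
    push_cast
    ring
  rw [e, integral_exp_int]
  by_cases h : n = m
  · subst h
    rw [if_pos (sub_self n), if_pos rfl, Complex.conj_ofReal, ← Complex.ofReal_mul,
      ← Complex.ofReal_mul, ← mul_assoc, ← mul_inv, Real.mul_self_sqrt (by positivity),
      inv_mul_cancel₀ (by positivity), Complex.ofReal_one]
  · rw [if_neg (sub_ne_zero.2 (Ne.symm h)), if_neg h, mul_zero, mul_zero]

lemma summable_smul_expLp {c : ℤ → ℂ} (hc : Summable fun n => ‖c n‖ ^ 2) :
    Summable fun n => c n • expLp n := by
  have h := (orthonormal_expLp.orthogonalFamily.summable_iff_norm_sq_summable c).2 hc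
  simpa [LinearIsometry.toSpanSingleton_apply] using h

/-- Multiplication by the independent variable in `L₂(-2π, 2π)`. -/
noncomputable def mulVar : Lp ℂ 2 mu2 →L[ℂ] Lp ℂ 2 mu2 :=
  (ContinuousLinearMap.mul ℂ ℂ).holderL mu2 ⊤ 2 2
    ((memLp_mu2_of_continuous Complex.continuous_ofReal ⊤).toLp _)

lemma coeFn_mulVar (f : Lp ℂ 2 mu2) : mulVar f =ᵐ[mu2] fun s => (s : ℂ) * f s := by
  have h := (ContinuousLinearMap.mul ℂ ℂ).coeFn_holder (r := 2)
    ((memLp_mu2_of_continuous Complex.continuous_ofReal ⊤).toLp _) f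
  filter_upwards [h, (memLp_mu2_of_continuous Complex.continuous_ofReal ⊤).coeFn_toLp] with s h1 h2
  refine h1.trans ?_
  rw [h2]
  rfl

lemma norm_exp_sub_one_sub_le (t : ℝ) :
    ‖Complex.exp (Complex.I * (t : ℂ)) - 1 - Complex.I * (t : ℂ)‖ ≤ 3 * t ^ 2 := by
  have hn : ‖Complex.I * (t : ℂ)‖ = |t| := by simp
  by_cases h : |t| ≤ 1
  · have h1 := Complex.norm_exp_sub_one_sub_id_le (x := Complex.I * (t : ℂ)) (by rw [hn]; exact h)
    rw [hn, sq_abs] at h1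
    nlinarith [sq_nonneg t]
  · push Not at h
    have h1 : ‖Complex.exp (Complex.I * (t : ℂ)) - 1 - Complex.I * (t : ℂ)‖ ≤ 1 + 1 + |t| := by
      refine (norm_sub_le _ _).trans ?_
      rw [hn]
      gcongr
      refine (norm_sub_le _ _).trans ?_
      rw [norm_exp_I_mul, norm_one]
    have h2 : |t| ^ 2 = t ^ 2 := sq_abs t
    nlinarith

/-- Symmetric partial sums of the scalar series behind the kernel. -/
noncomputable def expSum (lam α : ℤ → ℝ) (N : ℕ) (s : ℝ) : ℂ :=
  ∑ n ∈ Finset.Icc (-(N : ℤ)) (N : ℤ), ((1 / α n : ℝ) * Complex.exp (Complex.I * ((lam n * s : ℝ) : ℂ)) -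
    (1 / Real.pi : ℝ) * Complex.exp (Complex.I * (((n : ℝ) * s : ℝ) : ℂ)))

lemma exists_inv_le {α : ℤ → ℝ} (hpos : ∀ n, 0 < α n)
    (hs : Summable fun n : ℤ => (α n - Real.pi) ^ 2) : ∃ C, ∀ n, 1 / α n ≤ C := by
  have hpi := Real.pi_pos
  have h1 : ∀ᶠ n in cofinite, (α n - Real.pi) ^ 2 < (Real.pi / 2) ^ 2 :=
    hs.tendsto_cofinite_zero.eventually_lt_const (by positivity)
  rw [eventually_cofinite] at h1
  refine ⟨2 / Real.pi + ∑ n ∈ h1.toFinset, 1 / α n, fun n => ?_⟩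
  have hnn : ∀ m ∈ h1.toFinset, 0 ≤ 1 / α m := fun m _ => (one_div_pos.2 (hpos m)).le
  by_cases hn : n ∈ h1.toFinset
  · have := Finset.single_le_sum hnn hn
    have : 0 < 2 / Real.pi := by positivity
    linarith
  · rw [Finite.mem_toFinset, mem_ofPred_eq, not_not] at hn
    have h2 := abs_lt_of_sq_lt_sq hn (by positivity)
    have h3 : Real.pi / 2 ≤ α n := by linarith [(abs_lt.1 h2).1]
    have h4 : 1 / α n ≤ 2 / Real.pi := by
      rw [div_le_div_iff₀ (hpos n) hpi]
      linarith
    linarith [Finset.sum_nonneg hnn]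

lemma summable_inv_sub_sq {α : ℤ → ℝ} (hpos : ∀ n, 0 < α n)
    (hs : Summable fun n : ℤ => (α n - Real.pi) ^ 2) :
    Summable fun n : ℤ => (1 / α n - 1 / Real.pi) ^ 2 := by
  have hpi := Real.pi_pos
  obtain ⟨C, hC⟩ := exists_inv_le hpos hs
  refine Summable.of_nonneg_of_le (fun _ => sq_nonneg _) (fun n => ?_)
    (hs.mul_left ((C * (1 / Real.pi)) ^ 2))
  have e : 1 / α n - 1 / Real.pi = -((1 / α n) * (1 / Real.pi) * (α n - Real.pi)) := by
    have := (hpos n).ne'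
    field_simp
    ring
  rw [e, neg_sq, mul_pow]
  have := one_div_pos.2 (hpos n)
  gcongr
  exact hC n

lemma coeFn_sum_toLp {ι : Type*} {f : ι → ℝ → ℂ} (hf : ∀ n, MemLp (f n) 2 mu2) (S : Finset ι) :
    (∑ n ∈ S, (hf n).toLp (f n) : Lp ℂ 2 mu2) =ᵐ[mu2] fun s => ∑ n ∈ S, f n s := by
  classical
  induction S using Finset.induction_on with
  | empty =>
    simp only [Finset.sum_empty]
    exact Lp.coeFn_zero _ _ _
  | insert a S ha ih =>
    rw [Finset.sum_insert ha]
    filter_upwards [Lp.coeFn_add ((hf a).toLp (f a)) (∑ n ∈ S, (hf n).toLp (f n)), ih,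
      (hf a).coeFn_toLp] with s h1 h2 h3
    rw [h1, Pi.add_apply, h2, h3, Finset.sum_insert ha]

/-- The scalar series behind the kernel converges in `L₂(-2π, 2π)`. -/
lemma exists_tendsto_expSum {lam α : ℤ → ℝ} (hpos : ∀ n, 0 < α n)
    (hl : Summable fun n : ℤ => (lam n - n) ^ 2) (hs : Summable fun n : ℤ => (α n - Real.pi) ^ 2) :
    ∃ A : ℝ → ℂ, StronglyMeasurable A ∧ MemLp A 2 mu2 ∧
      Tendsto (fun N => eLpNorm (fun s => expSum lam α N s - A s) 2 mu2) atTop (𝓝 0) := by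
  have hpi := Real.pi_pos
  obtain ⟨C, hC⟩ := exists_inv_le hpos hs
  set r : ℝ := √(4 * Real.pi) with hr
  have hr0 : 0 < r := Real.sqrt_pos.2 (by positivity)
  set term : ℤ → ℝ → ℂ := fun n s => (1 / α n : ℝ) * Complex.exp (Complex.I * ((lam n * s : ℝ) : ℂ)) -
    (1 / Real.pi : ℝ) * Complex.exp (Complex.I * (((n : ℝ) * s : ℝ) : ℂ)) with hterm
  have hcont : ∀ n, Continuous (term n) := fun n =>
    (continuous_const.mul (continuous_exp_mul _)).sub (continuous_const.mul (continuous_exp_mul _))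
  set rem : ℤ → ℝ → ℂ := fun n s => (1 / α n : ℝ) * (Complex.exp (Complex.I * (((n : ℝ) * s : ℝ) : ℂ)) *
    (Complex.exp (Complex.I * (((lam n - n) * s : ℝ) : ℂ)) - 1 -
      Complex.I * (((lam n - n) * s : ℝ) : ℂ))) with hrem
  have hremc : ∀ n, Continuous (rem n) := fun n => by
    have h1 := continuous_exp_mul (n : ℝ)
    have h2 := continuous_exp_mul (lam n - n)
    have h3 : Continuous fun s : ℝ => (((lam n - n) * s : ℝ) : ℂ) := by fun_prop
    exact continuous_const.mul (h1.mul ((h2.sub continuous_const).sub (continuous_const.mul h3)))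
  have hm : ∀ n, MemLp (term n) 2 mu2 := fun n => memLp_mu2_of_continuous (hcont n) 2
  have hmr : ∀ n, MemLp (rem n) 2 mu2 := fun n => memLp_mu2_of_continuous (hremc n) 2
  set c : ℤ → ℂ := fun n => (r * (1 / α n - 1 / Real.pi) : ℝ) with hc
  set d : ℤ → ℂ := fun n => Complex.I * (r * (1 / α n) * (lam n - n) : ℝ) with hd
  have hC0 : ∀ n, 0 < 1 / α n := fun n => one_div_pos.2 (hpos n)
  have hcs : Summable fun n => ‖c n‖ ^ 2 := by
    refine ((summable_inv_sub_sq hpos hs).mul_left (r ^ 2)).congr fun n => ?_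
    simp only [hc]
    rw [Complex.norm_real, Real.norm_eq_abs, sq_abs, mul_pow]
  have hds : Summable fun n => ‖d n‖ ^ 2 := by
    refine Summable.of_nonneg_of_le (fun _ => sq_nonneg _) (fun n => ?_) (hl.mul_left ((r * C) ^ 2))
    simp only [hd]
    rw [norm_mul, Complex.norm_I, one_mul, Complex.norm_real, Real.norm_eq_abs, sq_abs, mul_pow]
    have := hC0 n
    gcongr
    exact hC n
  have hrs : Summable fun n => (hmr n).toLp (rem n) := by
    refine Summable.of_norm_bounded
      (hl.mul_left ((mu2 univ).toReal ^ (2 : ENNReal).toReal⁻¹ * (C * (3 * (2 * Real.pi) ^ 2))))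
      fun n => ?_
    have hb : ∀ᵐ s ∂mu2, ‖(hmr n).toLp (rem n) s‖ ≤ C * (3 * (2 * Real.pi) ^ 2) * (lam n - n) ^ 2 := by
      filter_upwards [(hmr n).coeFn_toLp, ae_restrict_mem measurableSet_Ioo] with s h1 h2
      rw [h1]
      simp only [hrem]
      rw [norm_mul, norm_mul, norm_exp_I_mul, one_mul, Complex.norm_real, Real.norm_eq_abs,
        abs_of_pos (hC0 n), mul_assoc]
      have h3 : s ^ 2 ≤ (2 * Real.pi) ^ 2 := sq_le_sq' h2.1.le h2.2.le
      have h4 := norm_exp_sub_one_sub_le ((lam n - n) * s)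
      have h5 : 3 * ((lam n - n) * s) ^ 2 ≤ 3 * (2 * Real.pi) ^ 2 * (lam n - n) ^ 2 := by
        rw [mul_pow]
        nlinarith [sq_nonneg (lam n - n)]
      exact mul_le_mul (hC n) (h4.trans h5) (norm_nonneg _) ((hC0 n).le.trans (hC n))
    have h6 := Lp.norm_le_of_ae_bound (by
      have := (hC0 n).le.trans (hC n)
      positivity) hb
    refine h6.trans_eq ?_
    simp only [measureUnivNNReal, ENNReal.coe_toNNReal_eq_toReal]
    ring
  have hsum : Summable fun n => (hm n).toLp (term n) := by
    refine (((summable_smul_expLp hcs).add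
      ((summable_smul_expLp hds).map mulVar mulVar.continuous)).add hrs).congr fun n => ?_
    refine Lp.ext ?_
    simp only [Function.comp_apply]
    filter_upwards [(hm n).coeFn_toLp, (hmr n).coeFn_toLp,
      (memLp_mu2_of_continuous (continuous_exp_mul n) 2).coeFn_toLp,
      Lp.coeFn_add (c n • expLp n + mulVar (d n • expLp n)) ((hmr n).toLp (rem n)),
      Lp.coeFn_add (c n • expLp n) (mulVar (d n • expLp n)),
      Lp.coeFn_smul (c n) (expLp n), Lp.coeFn_smul (d n) (expLp n), coeFn_mulVar (d n • expLp n),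
      Lp.coeFn_smul (((√(4 * Real.pi))⁻¹ : ℝ) : ℂ)
        ((memLp_mu2_of_continuous (continuous_exp_mul n) 2).toLp _)] with s h1 h2 h3 h4 h5 h6 h7 h8 h9
    have hE : expLp n s = ((r⁻¹ : ℝ) : ℂ) * Complex.exp (Complex.I * (((n : ℝ) * s : ℝ) : ℂ)) := by
      rw [expLp, h9, Pi.smul_apply, h3, smul_eq_mul]
    rw [h4, Pi.add_apply, h5, Pi.add_apply, h6, h8, h7, Pi.smul_apply, Pi.smul_apply, h2, h1, hE]
    have e1 : Complex.exp (Complex.I * ((lam n * s : ℝ) : ℂ)) =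
        Complex.exp (Complex.I * (((n : ℝ) * s : ℝ) : ℂ)) *
          Complex.exp (Complex.I * (((lam n - n) * s : ℝ) : ℂ)) := by
      rw [← Complex.exp_add]; congr 1; push_cast; ring
    have hrc : (r : ℂ) ≠ 0 := by exact_mod_cast hr0.ne'
    simp only [hc, hd, hrem, hterm, smul_eq_mul, e1]
    generalize Complex.exp (Complex.I * (((n : ℝ) * s : ℝ) : ℂ)) = X
    generalize Complex.exp (Complex.I * (((lam n - n) * s : ℝ) : ℂ)) = Y
    generalize 1 / α n = a
    push_cast
    field_simp
    ring
  obtain ⟨A, hA⟩ := hsum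
  have hT := hA.comp (Finset.tendsto_Icc_neg (R := ℤ))
  refine ⟨A, Lp.stronglyMeasurable A, Lp.memLp A, ?_⟩
  rw [Lp.tendsto_Lp_iff_tendsto_eLpNorm'] at hT
  refine hT.congr fun N => eLpNorm_congr_ae ?_
  filter_upwards [coeFn_sum_toLp hm (Finset.Icc (-(N : ℤ)) N)] with s h1
  rw [Pi.sub_apply]
  exact congrArg (· - A s) h1

/-- The kernel with entries built from the values of a function at `x - t` and `x + t`. -/
noncomputable def kerOf (A : ℝ → ℂ) (x t : ℝ) : Matrix (Fin 2) (Fin 2) ℝ :=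
  !![((A (x - t)).re - (A (x + t)).re) / 2, -((A (x + t)).im + (A (x - t)).im) / 2;
    -((A (x + t)).im - (A (x - t)).im) / 2, ((A (x - t)).re + (A (x + t)).re) / 2]

lemma kernelSum_eq_kerOf (lam α : ℤ → ℝ) (N : ℕ) (x t : ℝ) (i j : Fin 2) :
    kernelSum lam α N x t i j = kerOf (expSum lam α N) x t i j := by
  have hre : ∀ (a l s : ℝ), ((a : ℂ) * Complex.exp (Complex.I * ((l * s : ℝ) : ℂ))).re =
      a * Real.cos (l * s) := fun a l s => by
    rw [Complex.re_ofReal_mul, mul_comm Complex.I, Complex.exp_ofReal_mul_I_re]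
  have him : ∀ (a l s : ℝ), ((a : ℂ) * Complex.exp (Complex.I * ((l * s : ℝ) : ℂ))).im =
      a * Real.sin (l * s) := fun a l s => by
    rw [Complex.im_ofReal_mul, mul_comm Complex.I, Complex.exp_ofReal_mul_I_im]
  have c1 : ∀ l : ℝ, Real.cos (l * (x - t)) =
      Real.cos (l * x) * Real.cos (l * t) + Real.sin (l * x) * Real.sin (l * t) := fun l => by
    rw [mul_sub, Real.cos_sub]
  have c2 : ∀ l : ℝ, Real.cos (l * (x + t)) =
      Real.cos (l * x) * Real.cos (l * t) - Real.sin (l * x) * Real.sin (l * t) := fun l => by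
    rw [mul_add, Real.cos_add]
  have s1 : ∀ l : ℝ, Real.sin (l * (x - t)) =
      Real.sin (l * x) * Real.cos (l * t) - Real.cos (l * x) * Real.sin (l * t) := fun l => by
    rw [mul_sub, Real.sin_sub]
  have s2 : ∀ l : ℝ, Real.sin (l * (x + t)) =
      Real.sin (l * x) * Real.cos (l * t) + Real.cos (l * x) * Real.sin (l * t) := fun l => by
    rw [mul_add, Real.sin_add]
  rw [kernelSum, Matrix.sum_apply]
  fin_cases i <;> fin_cases j <;>
  · simp only [kerOf, expSum, Complex.re_sum, Complex.im_sum, Complex.sub_re, Complex.sub_im, hre, him,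
      c1, c2, s1, s2, phi0Mat, phi0, Matrix.sub_apply, Matrix.smul_apply, Matrix.vecMulVec_apply,
      Fin.zero_eta, Fin.mk_one, Fin.isValue, Matrix.of_apply, Matrix.cons_val', Matrix.cons_val_zero,
      Matrix.cons_val_one, Matrix.cons_val_fin_one, smul_eq_mul, ← Finset.sum_sub_distrib,
      ← Finset.sum_add_distrib, ← Finset.sum_neg_distrib, Finset.sum_div]
    refine Finset.sum_congr rfl fun n _ => ?_
    ring

lemma kerOf_sub (A B : ℝ → ℂ) (x t : ℝ) (i j : Fin 2) :
    kerOf (fun s => A s - B s) x t i j = kerOf A x t i j - kerOf B x t i j := by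
  fin_cases i <;> fin_cases j <;>
  · simp [kerOf]
    ring

lemma abs_kerOf_le (A : ℝ → ℂ) (x t : ℝ) (i j : Fin 2) :
    |kerOf A x t i j| ≤ (‖A (x - t)‖ + ‖A (x + t)‖) / 2 := by
  have h1 := abs_le.1 (Complex.abs_re_le_norm (A (x - t)))
  have h2 := abs_le.1 (Complex.abs_re_le_norm (A (x + t)))
  have h3 := abs_le.1 (Complex.abs_im_le_norm (A (x - t)))
  have h4 := abs_le.1 (Complex.abs_im_le_norm (A (x + t)))
  fin_cases i <;> fin_cases j <;>
  · simp only [kerOf, Fin.zero_eta, Fin.mk_one, Fin.isValue, Matrix.of_apply, Matrix.cons_val',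
      Matrix.cons_val_zero, Matrix.cons_val_one, Matrix.cons_val_fin_one]
    rw [abs_le]
    constructor <;> linarith

lemma measurable_kerOf {A : ℝ → ℂ} (hA : Measurable A) (i j : Fin 2) :
    Measurable fun z : ℝ × ℝ => kerOf A z.1 z.2 i j := by
  have h1 : Measurable fun z : ℝ × ℝ => A (z.1 - z.2) := hA.comp (measurable_fst.sub measurable_snd)
  have h2 : Measurable fun z : ℝ × ℝ => A (z.1 + z.2) := hA.comp (measurable_fst.add measurable_snd)
  have r1 := Complex.measurable_re.comp h1
  have r2 := Complex.measurable_re.comp h2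
  have i1 := Complex.measurable_im.comp h1
  have i2 := Complex.measurable_im.comp h2
  fin_cases i <;> fin_cases j
  · exact (r1.sub r2).div_const 2
  · exact (i2.add i1).neg.div_const 2
  · exact (i2.sub i1).neg.div_const 2
  · exact (r1.add r2).div_const 2

lemma measurable_kerOf_right {A : ℝ → ℂ} (hA : Measurable A) (x : ℝ) (i j : Fin 2) :
    Measurable fun t : ℝ => kerOf A x t i j := by
  have h := (measurable_kerOf hA i j).comp (measurable_prodMk_left (x := x))
  exact h

lemma eLpNorm_comp_le {A : ℝ → ℂ} (hA : AEStronglyMeasurable A mu2) {e : ℝ → ℝ}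
    (he : MeasurePreserving e volume volume)
    (hs : ∀ t ∈ Ioo 0 Real.pi, e t ∈ Ioo (-(2 * Real.pi)) (2 * Real.pi)) :
    eLpNorm (fun t => ‖A (e t)‖) 2 (volume.restrict (Ioo 0 Real.pi)) ≤ eLpNorm A 2 mu2 := by
  have h1 := he.restrict_preimage (s := Ioo (-(2 * Real.pi)) (2 * Real.pi)) measurableSet_Ioo
  rw [eLpNorm_norm]
  calc _ ≤ eLpNorm (A ∘ e) 2 (volume.restrict (e ⁻¹' Ioo (-(2 * Real.pi)) (2 * Real.pi))) :=
        eLpNorm_mono_measure _ (Measure.restrict_mono_set _ hs)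
    _ = _ := eLpNorm_comp_measurePreserving hA h1

lemma eLpNorm_kerOf_le {A : ℝ → ℂ} (hA : StronglyMeasurable A) {x : ℝ} (hx : x ∈ Icc 0 Real.pi)
    (i j : Fin 2) :
    eLpNorm (fun t => kerOf A x t i j) 2 (volume.restrict (Ioo 0 Real.pi)) ≤ eLpNorm A 2 mu2 := by
  have m1 : Measurable fun t : ℝ => x - t := measurable_const.sub measurable_id
  have m2 : Measurable fun t : ℝ => x + t := measurable_const.add measurable_id
  have a1 : AEStronglyMeasurable (fun t => ‖A (x - t)‖) (volume.restrict (Ioo 0 Real.pi)) :=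
    (hA.comp_measurable m1).norm.aestronglyMeasurable
  have a2 : AEStronglyMeasurable (fun t => ‖A (x + t)‖) (volume.restrict (Ioo 0 Real.pi)) :=
    (hA.comp_measurable m2).norm.aestronglyMeasurable
  have h1 := eLpNorm_comp_le hA.aestronglyMeasurable (Measure.measurePreserving_sub_left volume x)
    fun t ht => ⟨by linarith [hx.1, ht.2, Real.pi_pos], by linarith [hx.2, ht.1, Real.pi_pos]⟩
  have h2 := eLpNorm_comp_le hA.aestronglyMeasurable (measurePreserving_add_left volume x)
    fun t ht => ⟨by linarith [hx.1, ht.1, Real.pi_pos], by linarith [hx.2, ht.2]⟩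
  have h3 : eLpNorm (fun t => kerOf A x t i j) 2 (volume.restrict (Ioo 0 Real.pi)) ≤
      ENNReal.ofReal (1 / 2) * eLpNorm ((fun t => ‖A (x - t)‖) + fun t => ‖A (x + t)‖) 2
        (volume.restrict (Ioo 0 Real.pi)) := by
    refine eLpNorm_le_mul_eLpNorm_of_ae_le_mul (ae_of_all _ fun t => ?_) 2
    refine (abs_kerOf_le A x t i j).trans ?_
    rw [Pi.add_apply, Real.norm_of_nonneg (by positivity)]
    linarith
  refine h3.trans ?_
  have h4 := (eLpNorm_add_le a1 a2 one_le_two).trans (add_le_add h1 h2)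
  calc _ ≤ ENNReal.ofReal (1 / 2) * (eLpNorm A 2 mu2 + eLpNorm A 2 mu2) := by gcongr
    _ = ENNReal.ofReal (1 / 2) * (2 * eLpNorm A 2 mu2) := by rw [two_mul]
    _ = eLpNorm A 2 mu2 := by
      rw [← mul_assoc]
      have : ENNReal.ofReal (1 / 2) * 2 = 1 := by
        rw [← ENNReal.ofReal_ofNat 2, ← ENNReal.ofReal_mul (by norm_num)]
        norm_num
      rw [this, one_mul]

lemma continuous_expSum (lam α : ℤ → ℝ) (N : ℕ) : Continuous (expSum lam α N) :=
  continuous_finsetSum _ fun _ _ => (continuous_const.mul (continuous_exp_mul _)).sub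
    (continuous_const.mul (continuous_exp_mul _))

lemma isKernel_kerOf {lam α : ℤ → ℝ} {A : ℝ → ℂ} (hA : StronglyMeasurable A) (hAm : MemLp A 2 mu2)
    (hT : Tendsto (fun N => eLpNorm (fun s => expSum lam α N s - A s) 2 mu2) atTop (𝓝 0)) :
    IsKernel lam α (kerOf A) := by
  refine ⟨fun i j => (measurable_kerOf hA.measurable i j).aestronglyMeasurable, fun x hx i j => ?_,
    fun x hx i j => ?_⟩
  · have hm := measurable_kerOf_right hA.measurable x i j
    exact ⟨hm.aestronglyMeasurable, (eLpNorm_kerOf_le hA hx i j).trans_lt hAm.2⟩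
  · refine tendsto_of_tendsto_of_tendsto_of_le_of_le tendsto_const_nhds hT (fun _ => zero_le)
      fun N => ?_
    simp_rw [kernelSum_eq_kerOf, ← kerOf_sub]
    exact eLpNorm_kerOf_le ((continuous_expSum lam α N).stronglyMeasurable.sub hA) hx i j

lemma IsKernel.ae_eq {lam α : ℤ → ℝ} {F F' : ℝ → ℝ → Matrix (Fin 2) (Fin 2) ℝ}
    (hF : IsKernel lam α F) (hF' : IsKernel lam α F') {x : ℝ} (hx : x ∈ Icc 0 Real.pi) (i j : Fin 2) :
    (fun t => F x t i j) =ᵐ[volume.restrict (Ioo 0 Real.pi)] fun t => F' x t i j := by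
  have hm : ∀ N, AEStronglyMeasurable (fun t => kernelSum lam α N x t i j)
      (volume.restrict (Ioo 0 Real.pi)) := fun N => by
    simp_rw [kernelSum_eq_kerOf]
    exact (measurable_kerOf_right (continuous_expSum lam α N).measurable x i j).aestronglyMeasurable
  have h1 := (hF.tendsto x hx i j).add (hF'.tendsto x hx i j)
  rw [add_zero] at h1
  have h2 : eLpNorm (fun t => F x t i j - F' x t i j) 2 (volume.restrict (Ioo 0 Real.pi)) ≤ 0 := by
    refine ge_of_tendsto' h1 fun N => ?_
    have m1 := (hm N).sub (hF.memLp x hx i j).1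
    have m2 := (hm N).sub (hF'.memLp x hx i j).1
    have h3 := eLpNorm_sub_le m2 m1 one_le_two
    rw [add_comm]
    refine le_trans (le_of_eq ?_) h3
    congr 1
    funext t
    simp
  have h4 := (eLpNorm_eq_zero_iff ((hF.memLp x hx i j).1.sub (hF'.memLp x hx i j).1) two_ne_zero).1
    (le_antisymm h2 zero_le)
  filter_upwards [h4] with t ht
  exact sub_eq_zero.1 ht

end DiracGLM

namespace DiracGLM

lemma ae_ae_eq_swap {X Y : Type*} [MeasurableSpace X] [MeasurableSpace Y] {μ : Measure X}
    {ν : Measure Y} [SFinite μ] [SFinite ν] {f g : X × Y → ℝ} (hf : AEStronglyMeasurable f (μ.prod ν))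
    (hg : AEStronglyMeasurable g (μ.prod ν)) (h : ∀ᵐ x ∂μ, ∀ᵐ y ∂ν, f (x, y) = g (x, y)) :
    ∀ᵐ y ∂ν, ∀ᵐ x ∂μ, f (x, y) = g (x, y) := by
  have hms : MeasurableSet {z : X × Y | hf.mk f z = hg.mk g z} :=
    measurableSet_eq_fun hf.stronglyMeasurable_mk.measurable hg.stronglyMeasurable_mk.measurable
  have h1 : ∀ᵐ z ∂μ.prod ν, hf.mk f z = hg.mk g z := by
    rw [Measure.ae_prod_iff_ae_ae hms]
    filter_upwards [h, Measure.ae_ae_of_ae_prod hf.ae_eq_mk, Measure.ae_ae_of_ae_prod hg.ae_eq_mk]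
      with x h1 h2 h3
    filter_upwards [h1, h2, h3] with y k1 k2 k3
    rw [← k2, ← k3, k1]
  have h2 : ∀ᵐ z ∂μ.prod ν, f z = g z := by
    filter_upwards [h1, hf.ae_eq_mk, hg.ae_eq_mk] with z k1 k2 k3
    rw [k2, k3, k1]
  have h3 : ∀ᵐ z ∂ν.prod μ, f z.swap = g z.swap :=
    Measure.measurePreserving_swap.quasiMeasurePreserving.ae h2
  exact Measure.ae_ae_of_ae_prod h3

lemma eLpNorm_two_sq {X E : Type*} [MeasurableSpace X] [NormedAddCommGroup E] (f : X → E)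
    (μ : Measure X) : eLpNorm f 2 μ ^ 2 = ∫⁻ x, ‖f x‖ₑ ^ 2 ∂μ := by
  have h := eLpNorm_nnreal_pow_eq_lintegral (f := f) (μ := μ) (p := 2) two_ne_zero
  simpa using h

lemma lintegral_mul_sq_le {X : Type*} [MeasurableSpace X] {μ : Measure X} {f g : X → ENNReal}
    (hf : AEMeasurable f μ) (hg : AEMeasurable g μ) :
    (∫⁻ x, f x * g x ∂μ) ^ 2 ≤ (∫⁻ x, f x ^ 2 ∂μ) * ∫⁻ x, g x ^ 2 ∂μ := by
  have h := ENNReal.lintegral_mul_le_Lp_mul_Lq μ (p := 2) (q := 2)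
    (by constructor <;> norm_num) hf hg
  simp only [ENNReal.rpow_ofNat, Pi.mul_apply] at h
  have e : ∀ a : ENNReal, (a ^ (1 / 2 : ℝ)) ^ 2 = a := fun a => by
    rw [← ENNReal.rpow_natCast, ← ENNReal.rpow_mul]
    norm_num
  calc _ ≤ ((∫⁻ x, f x ^ 2 ∂μ) ^ (1 / 2 : ℝ) * (∫⁻ x, g x ^ 2 ∂μ) ^ (1 / 2 : ℝ)) ^ 2 := by gcongr
    _ = _ := by rw [mul_pow, e, e]

variable {𝕜 : Type*} [RCLike 𝕜]

section IntegralOperator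

variable {μ : Measure ℝ}

lemma lintegral_sq_kernel_le [IsFiniteMeasure μ] {D : ℝ → ℝ → 𝕜} {C : ENNReal}
    (hD : AEStronglyMeasurable (Function.uncurry D) (μ.prod μ))
    (hC : ∀ᵐ s ∂μ, eLpNorm (D s) 2 μ ≤ C) {f : ℝ → 𝕜} (hf : MemLp f 2 μ) :
    ∫⁻ t, (∫⁻ s, ‖f s * D s t‖ₑ ∂μ) ^ 2 ∂μ ≤ (C ^ 2 * μ univ) * eLpNorm f 2 μ ^ 2 := by
  have hm : AEMeasurable (fun z : ℝ × ℝ => ‖D z.1 z.2‖ₑ ^ 2) (μ.prod μ) := hD.enorm.pow_const 2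
  calc ∫⁻ t, (∫⁻ s, ‖f s * D s t‖ₑ ∂μ) ^ 2 ∂μ
      ≤ ∫⁻ t, eLpNorm f 2 μ ^ 2 * ∫⁻ s, ‖D s t‖ₑ ^ 2 ∂μ ∂μ := by
        refine lintegral_mono_ae ?_
        filter_upwards [hD.prodMk_right] with t ht
        rw [eLpNorm_two_sq]
        simp_rw [enorm_mul]
        exact lintegral_mul_sq_le hf.1.enorm ht.enorm
    _ = eLpNorm f 2 μ ^ 2 * ∫⁻ t, ∫⁻ s, ‖D s t‖ₑ ^ 2 ∂μ ∂μ :=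
        lintegral_const_mul' _ _ (ENNReal.pow_ne_top hf.2.ne)
    _ = eLpNorm f 2 μ ^ 2 * ∫⁻ s, ∫⁻ t, ‖D s t‖ₑ ^ 2 ∂μ ∂μ := by
        rw [lintegral_lintegral_swap (f := fun s t => ‖D s t‖ₑ ^ 2) hm]
    _ ≤ eLpNorm f 2 μ ^ 2 * ∫⁻ s, C ^ 2 ∂μ := by
        gcongr 1
        refine lintegral_mono_ae ?_
        filter_upwards [hC] with s hs
        rw [← eLpNorm_two_sq]
        gcongr
    _ = _ := by rw [lintegral_const]; ring

lemma integrable_mul_kernel [IsFiniteMeasure μ] {D : ℝ → ℝ → 𝕜} {C : ENNReal} (hCt : C ≠ ⊤)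
    (hD : AEStronglyMeasurable (Function.uncurry D) (μ.prod μ))
    (hC : ∀ᵐ s ∂μ, eLpNorm (D s) 2 μ ≤ C) {f : ℝ → 𝕜} (hf : MemLp f 2 μ) :
    ∀ᵐ t ∂μ, Integrable (fun s => f s * D s t) μ := by
  have h1 := lintegral_sq_kernel_le hD hC hf
  have h2 : ∫⁻ t, (∫⁻ s, ‖f s * D s t‖ₑ ∂μ) ^ 2 ∂μ ≠ ⊤ := by
    refine (h1.trans_lt ?_).ne
    exact ENNReal.mul_lt_top (ENNReal.mul_lt_top (ENNReal.pow_lt_top hCt.lt_top) (measure_lt_top _ _))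
      (ENNReal.pow_lt_top hf.2)
  have hm : AEMeasurable (fun z : ℝ × ℝ => ‖f z.2 * D z.2 z.1‖ₑ) (μ.prod μ) :=
    (hf.1.comp_snd.mul hD.prod_swap).enorm
  have h3 := ae_lt_top' (hm.lintegral_prod_right'.pow_const 2) h2
  filter_upwards [h3, hD.prodMk_right] with t ht hDt
  refine ⟨hf.1.mul hDt, ?_⟩
  rw [hasFiniteIntegral_iff_enorm]
  by_contra hc
  rw [not_lt, top_le_iff] at hc
  simp only [hc] at ht
  simp at ht

lemma memLp_integral_mul_kernel [IsFiniteMeasure μ] {D : ℝ → ℝ → 𝕜} {C : ENNReal} (hCt : C ≠ ⊤)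
    (hD : AEStronglyMeasurable (Function.uncurry D) (μ.prod μ))
    (hC : ∀ᵐ s ∂μ, eLpNorm (D s) 2 μ ≤ C) {f : ℝ → 𝕜} (hf : MemLp f 2 μ) :
    MemLp (fun t => ∫ s, f s * D s t ∂μ) 2 μ ∧
      (eLpNorm (fun t => ∫ s, f s * D s t ∂μ) 2 μ).toReal ≤
        C.toReal * √(μ univ).toReal * (eLpNorm f 2 μ).toReal := by
  have hle : eLpNorm (fun t => ∫ s, f s * D s t ∂μ) 2 μ ^ 2 ≤ (C ^ 2 * μ univ) * eLpNorm f 2 μ ^ 2 := by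
    rw [eLpNorm_two_sq]
    refine le_trans (lintegral_mono fun t => ?_) (lintegral_sq_kernel_le hD hC hf)
    gcongr
    exact enorm_integral_le_lintegral_enorm _
  have hfin : (C ^ 2 * μ univ) * eLpNorm f 2 μ ^ 2 < ⊤ :=
    ENNReal.mul_lt_top (ENNReal.mul_lt_top (ENNReal.pow_lt_top hCt.lt_top) (measure_lt_top _ _))
      (ENNReal.pow_lt_top hf.2)
  have hlt : eLpNorm (fun t => ∫ s, f s * D s t ∂μ) 2 μ < ⊤ := by
    by_contra hc
    rw [not_lt, top_le_iff] at hc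
    rw [hc] at hle
    exact absurd (hle.trans_lt hfin) (by simp)
  have hms : AEStronglyMeasurable (fun z : ℝ × ℝ => f z.2 * D z.2 z.1) (μ.prod μ) :=
    hf.1.comp_snd.mul hD.prod_swap
  refine ⟨⟨hms.integral_prod_right', hlt⟩, ?_⟩
  have h4 := ENNReal.toReal_mono hfin.ne hle
  simp only [ENNReal.toReal_mul, ENNReal.toReal_pow] at h4
  refine le_of_sq_le_sq ?_ (by positivity)
  rw [mul_pow, mul_pow, Real.sq_sqrt ENNReal.toReal_nonneg]
  exact h4

lemma exists_scalar_integral_operator [IsFiniteMeasure μ] {D : ℝ → ℝ → 𝕜} {C : ENNReal} (hCt : C ≠ ⊤)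
    (hD : AEStronglyMeasurable (Function.uncurry D) (μ.prod μ))
    (hC : ∀ᵐ s ∂μ, eLpNorm (D s) 2 μ ≤ C) :
    ∃ T : Lp 𝕜 2 μ →L[𝕜] Lp 𝕜 2 μ, (∀ f, T f =ᵐ[μ] fun t => ∫ s, f s * D s t ∂μ) ∧
      ‖T‖ ≤ C.toReal * √(μ univ).toReal := by
  have hm := fun f : Lp 𝕜 2 μ => memLp_integral_mul_kernel hCt hD hC (Lp.memLp f)
  have hi := fun f : Lp 𝕜 2 μ => integrable_mul_kernel hCt hD hC (Lp.memLp f)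
  let L : Lp 𝕜 2 μ →ₗ[𝕜] Lp 𝕜 2 μ :=
    { toFun := fun f => (hm f).1.toLp _
      map_add' := fun f g => by
        refine Lp.ext ?_
        filter_upwards [(hm (f + g)).1.coeFn_toLp, (hm f).1.coeFn_toLp, (hm g).1.coeFn_toLp,
          Lp.coeFn_add ((hm f).1.toLp _) ((hm g).1.toLp _), hi f, hi g] with t h1 h2 h3 h4 h5 h6
        rw [h1, h4, Pi.add_apply, h2, h3, ← integral_add h5 h6]
        refine integral_congr_ae ?_
        filter_upwards [Lp.coeFn_add f g] with s hs
        rw [hs, Pi.add_apply, add_mul]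
      map_smul' := fun c f => by
        refine Lp.ext ?_
        filter_upwards [(hm (c • f)).1.coeFn_toLp, (hm f).1.coeFn_toLp,
          Lp.coeFn_smul c ((hm f).1.toLp _)] with t h1 h2 h4
        rw [RingHom.id_apply, h1, h4, Pi.smul_apply, h2, smul_eq_mul, ← integral_const_mul]
        refine integral_congr_ae ?_
        filter_upwards [Lp.coeFn_smul c f] with s hs
        rw [hs, Pi.smul_apply, smul_eq_mul, mul_assoc] }
  have hb : ∀ f, ‖L f‖ ≤ C.toReal * √(μ univ).toReal * ‖f‖ := fun f => by
    have h := (hm f).2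
    change ‖(hm f).1.toLp _‖ ≤ _
    rw [Lp.norm_toLp, Lp.norm_def f]
    exact h
  refine ⟨L.mkContinuous _ hb, fun f => (hm f).1.coeFn_toLp, ?_⟩
  exact L.mkContinuous_norm_le (by positivity) hb

variable (𝕜 μ) in
/-- Row vectors with entries in `L₂`. -/
abbrev RowL2 : Type _ := Fin 2 → Lp 𝕜 2 μ

/-- `T` is the operator that multiplies a row vector by the matrix kernel `g` and integrates. -/
def IsIntOp (g : ℝ → ℝ → Matrix (Fin 2) (Fin 2) ℝ) (T : RowL2 𝕜 μ →L[𝕜] RowL2 𝕜 μ) : Prop :=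
  ∀ (k : RowL2 𝕜 μ) (j : Fin 2), ∀ᵐ t ∂μ,
    Integrable (fun s => ∑ l, k l s * ((g s t l j : ℝ) : 𝕜)) μ ∧
      T k j t = ∫ s, ∑ l, k l s * ((g s t l j : ℝ) : 𝕜) ∂μ

lemma IsIntOp.add {g g' : ℝ → ℝ → Matrix (Fin 2) (Fin 2) ℝ} {T T' : RowL2 𝕜 μ →L[𝕜] RowL2 𝕜 μ}
    (h : IsIntOp g T) (h' : IsIntOp g' T') : IsIntOp (fun s t => g s t + g' s t) (T + T') := by
  intro k j
  filter_upwards [h k j, h' k j, Lp.coeFn_add (T k j) (T' k j)] with t h1 h2 h3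
  have e : ∀ s, ∑ l, k l s * (((g s t + g' s t) l j : ℝ) : 𝕜) =
      (∑ l, k l s * ((g s t l j : ℝ) : 𝕜)) + ∑ l, k l s * ((g' s t l j : ℝ) : 𝕜) := fun s => by
    rw [← Finset.sum_add_distrib]
    refine Finset.sum_congr rfl fun l _ => ?_
    rw [Matrix.add_apply]; push_cast; ring
  simp_rw [e]
  refine ⟨h1.1.add h2.1, ?_⟩
  rw [integral_add h1.1 h2.1, ← h1.2, ← h2.2]
  exact h3

lemma IsIntOp.smul {g : ℝ → ℝ → Matrix (Fin 2) (Fin 2) ℝ} {T : RowL2 𝕜 μ →L[𝕜] RowL2 𝕜 μ}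
    (h : IsIntOp g T) (c : ℝ) : IsIntOp (fun s t => c • g s t) ((c : 𝕜) • T) := by
  intro k j
  filter_upwards [h k j, Lp.coeFn_smul (c : 𝕜) (T k j)] with t h1 h3
  have e : ∀ s, ∑ l, k l s * (((c • g s t) l j : ℝ) : 𝕜) =
      (c : 𝕜) * ∑ l, k l s * ((g s t l j : ℝ) : 𝕜) := fun s => by
    rw [Finset.mul_sum]
    refine Finset.sum_congr rfl fun l _ => ?_
    rw [Matrix.smul_apply, smul_eq_mul]; push_cast; ring
  simp_rw [e]
  refine ⟨h1.1.const_mul _, ?_⟩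
  rw [integral_const_mul, ← h1.2]
  exact h3

lemma IsIntOp.sub {g g' : ℝ → ℝ → Matrix (Fin 2) (Fin 2) ℝ} {T T' : RowL2 𝕜 μ →L[𝕜] RowL2 𝕜 μ}
    (h : IsIntOp g T) (h' : IsIntOp g' T') : IsIntOp (fun s t => g s t - g' s t) (T - T') := by
  have e : T - T' = T + ((-1 : ℝ) : 𝕜) • T' := by
    refine ContinuousLinearMap.ext fun k => ?_
    change T k - T' k = T k + ((-1 : ℝ) : 𝕜) • T' k
    rw [RCLike.ofReal_neg, RCLike.ofReal_one, neg_one_smul, sub_eq_add_neg]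
  have e' : (fun s t => g s t - g' s t) = fun s t => g s t + (-1 : ℝ) • g' s t := by
    funext s t
    rw [neg_one_smul, sub_eq_add_neg]
  rw [e, e']
  exact h.add (h'.smul (-1))

lemma isIntOp_zero : IsIntOp (μ := μ) (fun _ _ => 0) (0 : RowL2 𝕜 μ →L[𝕜] RowL2 𝕜 μ) := by
  intro k j
  filter_upwards [Lp.coeFn_zero 𝕜 2 μ] with t h
  simpa using h

lemma IsIntOp.sum {ι : Type*} {g : ι → ℝ → ℝ → Matrix (Fin 2) (Fin 2) ℝ}
    {T : ι → RowL2 𝕜 μ →L[𝕜] RowL2 𝕜 μ} (h : ∀ i, IsIntOp (g i) (T i)) (S : Finset ι) :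
    IsIntOp (fun s t => ∑ i ∈ S, g i s t) (∑ i ∈ S, T i) := by
  classical
  induction S using Finset.induction_on with
  | empty => simpa using isIntOp_zero
  | insert a S ha ih =>
    simp_rw [Finset.sum_insert ha]
    exact (h a).add ih

lemma IsIntOp.congr {g g' : ℝ → ℝ → Matrix (Fin 2) (Fin 2) ℝ} {T : RowL2 𝕜 μ →L[𝕜] RowL2 𝕜 μ}
    (h : IsIntOp g T) (hg : ∀ l j, ∀ᵐ t ∂μ, ∀ᵐ s ∂μ, g s t l j = g' s t l j) : IsIntOp g' T := by
  intro k j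
  filter_upwards [h k j, ae_all_iff.2 fun l => hg l j] with t h1 h2
  have e : (fun s => ∑ l, k l s * ((g s t l j : ℝ) : 𝕜)) =ᵐ[μ]
      fun s => ∑ l, k l s * ((g' s t l j : ℝ) : 𝕜) := by
    filter_upwards [ae_all_iff.2 h2] with s hs
    exact Finset.sum_congr rfl fun l _ => by rw [hs l]
  exact ⟨h1.1.congr e, by rw [h1.2, integral_congr_ae e]⟩

lemma IsIntOp.unique {g : ℝ → ℝ → Matrix (Fin 2) (Fin 2) ℝ} {T T' : RowL2 𝕜 μ →L[𝕜] RowL2 𝕜 μ}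
    (h : IsIntOp g T) (h' : IsIntOp g T') : T = T' := by
  refine ContinuousLinearMap.ext fun k => funext fun j => Lp.ext ?_
  filter_upwards [h k j, h' k j] with t h1 h2
  rw [h1.2, h2.2]

lemma exists_isIntOp [IsFiniteMeasure μ] {g : ℝ → ℝ → Matrix (Fin 2) (Fin 2) ℝ} {C : ENNReal} (hCt : C ≠ ⊤)
    (hg : ∀ l j, AEStronglyMeasurable (fun z : ℝ × ℝ => g z.1 z.2 l j) (μ.prod μ))
    (hC : ∀ l j, ∀ᵐ s ∂μ, eLpNorm (fun t => g s t l j) 2 μ ≤ C) :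
    ∃ T : RowL2 𝕜 μ →L[𝕜] RowL2 𝕜 μ, IsIntOp g T ∧ ‖T‖ ≤ 2 * (C.toReal * √(μ univ).toReal) := by
  have hm : ∀ l j, AEStronglyMeasurable (Function.uncurry fun s t => ((g s t l j : ℝ) : 𝕜))
      (μ.prod μ) := fun l j => RCLike.continuous_ofReal.comp_aestronglyMeasurable (hg l j)
  have hC' : ∀ l j, ∀ᵐ s ∂μ, eLpNorm (fun t => ((g s t l j : ℝ) : 𝕜)) 2 μ ≤ C := fun l j => by
    filter_upwards [hC l j] with s hs
    refine le_trans (le_of_eq (eLpNorm_congr_norm_ae (ae_of_all _ fun t => ?_))) hs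
    rw [RCLike.norm_ofReal, Real.norm_eq_abs]
  choose I hI hIn using fun l j => exists_scalar_integral_operator hCt (hm l j) (hC' l j)
  have happ : ∀ k j, (ContinuousLinearMap.pi fun j => ∑ l, (I l j).comp
      (ContinuousLinearMap.proj (R := 𝕜) (φ := fun _ : Fin 2 => Lp 𝕜 2 μ) l)) k j =
        I 0 j (k 0) + I 1 j (k 1) := fun k j => by
    simp [Fin.sum_univ_two]
  refine ⟨ContinuousLinearMap.pi fun j => ∑ l, (I l j).comp (ContinuousLinearMap.proj l), ?_, ?_⟩
  · intro k j
    rw [happ]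
    filter_upwards [integrable_mul_kernel hCt (hm 0 j) (hC' 0 j) (Lp.memLp (k 0)),
      integrable_mul_kernel hCt (hm 1 j) (hC' 1 j) (Lp.memLp (k 1)), hI 0 j (k 0), hI 1 j (k 1),
      Lp.coeFn_add (I 0 j (k 0)) (I 1 j (k 1))] with t h1 h2 h3 h4 h5
    simp_rw [Fin.sum_univ_two]
    refine ⟨h1.add h2, ?_⟩
    rw [h5, Pi.add_apply, h3, h4, integral_add h1 h2]
  · refine ContinuousLinearMap.opNorm_le_bound _ (by positivity) fun k => ?_
    rw [pi_norm_le_iff_of_nonneg (by positivity)]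
    intro j
    rw [happ]
    have hb : ∀ l, ‖I l j (k l)‖ ≤ (C.toReal * √(μ univ).toReal) * ‖k‖ := fun l =>
      ((I l j).le_opNorm _).trans (mul_le_mul (hIn l j) (norm_le_pi_norm k l) (norm_nonneg _)
        (by positivity))
    refine (norm_add_le _ _).trans ?_
    linarith [hb 0, hb 1]

/-- The functions `φ₀(·, l)` as an element of `L₂`. -/
noncomputable def phiLp (𝕜 : Type*) [RCLike 𝕜] (μ : Measure ℝ) [IsFiniteMeasure μ] (l : ℝ) :
    RowL2 𝕜 μ := fun j => MemLp.toLp (fun t => ((phi0 t l j : ℝ) : 𝕜))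
  (MemLp.of_bound (C := 1) (by
    refine (RCLike.continuous_ofReal.comp ?_).aestronglyMeasurable
    fin_cases j <;> simp only [phi0] <;> fun_prop) (ae_of_all _ fun t => by
    rw [RCLike.norm_ofReal]
    fin_cases j
    · exact Real.abs_sin_le_one _
    · simpa [phi0] using Real.abs_cos_le_one _))

lemma coeFn_phiLp [IsFiniteMeasure μ] (l : ℝ) (j : Fin 2) :
    phiLp 𝕜 μ l j =ᵐ[μ] fun t => ((phi0 t l j : ℝ) : 𝕜) := MemLp.coeFn_toLp _

/-- The pairing with `φ₀(·, l)` as a functional. -/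
noncomputable def phiFunctional (𝕜 : Type*) [RCLike 𝕜] (μ : Measure ℝ) [IsFiniteMeasure μ] (l : ℝ) :
    RowL2 𝕜 μ →L[𝕜] 𝕜 :=
  ∑ j, (innerSL 𝕜 (phiLp 𝕜 μ l j)).comp (ContinuousLinearMap.proj j)

lemma phiFunctional_apply [IsFiniteMeasure μ] (l : ℝ) (k : RowL2 𝕜 μ) :
    phiFunctional 𝕜 μ l k = ∑ j, inner 𝕜 (phiLp 𝕜 μ l j) (k j) := by
  simp [phiFunctional]

lemma inner_phiLp [IsFiniteMeasure μ] (l : ℝ) (k : RowL2 𝕜 μ) (j : Fin 2) :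
    Integrable (fun s => k j s * ((phi0 s l j : ℝ) : 𝕜)) μ ∧
    inner 𝕜 (phiLp 𝕜 μ l j) (k j) = ∫ s, k j s * ((phi0 s l j : ℝ) : 𝕜) ∂μ := by
  have e : (fun s => inner 𝕜 (phiLp 𝕜 μ l j s) (k j s)) =ᵐ[μ]
      fun s => k j s * ((phi0 s l j : ℝ) : 𝕜) := by
    filter_upwards [coeFn_phiLp (𝕜 := 𝕜) (μ := μ) l j] with s hs
    rw [hs, RCLike.inner_apply, RCLike.conj_ofReal]
  exact ⟨(L2.integrable_inner (𝕜 := 𝕜) (phiLp 𝕜 μ l j) (k j)).congr e,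
    by rw [L2.inner_def, integral_congr_ae e]⟩

lemma phiFunctional_eq_integral [IsFiniteMeasure μ] (l : ℝ) (k : RowL2 𝕜 μ) :
    phiFunctional 𝕜 μ l k = ∫ s, ∑ j, k j s * ((phi0 s l j : ℝ) : 𝕜) ∂μ := by
  rw [phiFunctional_apply, integral_finsetSum _ fun j _ => (inner_phiLp l k j).1]
  exact Finset.sum_congr rfl fun j _ => (inner_phiLp l k j).2

/-- The operator of rank one with kernel `φ₀(s, l) φ₀(t, l)ᵀ`. -/
noncomputable def phiOp (𝕜 : Type*) [RCLike 𝕜] (μ : Measure ℝ) [IsFiniteMeasure μ] (l : ℝ) :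
    RowL2 𝕜 μ →L[𝕜] RowL2 𝕜 μ :=
  (phiFunctional 𝕜 μ l).smulRight (phiLp 𝕜 μ l)

lemma isIntOp_phiOp [IsFiniteMeasure μ] (l : ℝ) : IsIntOp (fun s t => phi0Mat s t l) (phiOp 𝕜 μ l) := by
  intro k j
  filter_upwards [Lp.coeFn_smul (phiFunctional 𝕜 μ l k) (phiLp 𝕜 μ l j),
    coeFn_phiLp (𝕜 := 𝕜) (μ := μ) l j] with t h1 h2
  have e : ∀ s, ∑ i, k i s * ((phi0Mat s t l i j : ℝ) : 𝕜) =
      (∑ i, k i s * ((phi0 s l i : ℝ) : 𝕜)) * ((phi0 t l j : ℝ) : 𝕜) := fun s => by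
    rw [Finset.sum_mul]
    refine Finset.sum_congr rfl fun i _ => ?_
    rw [phi0Mat, Matrix.vecMulVec_apply]
    push_cast
    ring
  simp_rw [e]
  refine ⟨(integrable_finsetSum _ fun i _ => (inner_phiLp l k i).1).mul_const _, ?_⟩
  rw [integral_mul_const, ← phiFunctional_eq_integral]
  change (phiFunctional 𝕜 μ l k • phiLp 𝕜 μ l j : Lp 𝕜 2 μ) t = _
  rw [h1, Pi.smul_apply, h2, smul_eq_mul]

lemma isCompactOperator_phiOp [IsFiniteMeasure μ] (l : ℝ) : IsCompactOperator (phiOp 𝕜 μ l) := by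
  have h : IsCompactOperator (ContinuousLinearMap.toSpanSingleton 𝕜 (phiLp 𝕜 μ l)) :=
    isCompactOperator_of_locallyCompactSpace_rng _
  exact h.comp_clm (phiFunctional 𝕜 μ l)

/-- The pairing of row vectors. -/
noncomputable def rowInner (k v : RowL2 𝕜 μ) : 𝕜 := ∑ j, inner 𝕜 (k j) (v j)

lemma rowInner_add (k v w : RowL2 𝕜 μ) : rowInner k (v + w) = rowInner k v + rowInner k w := by
  simp [rowInner, inner_add_right, Finset.sum_add_distrib]

lemma rowInner_smul (k v : RowL2 𝕜 μ) (c : 𝕜) : rowInner k (c • v) = c * rowInner k v := by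
  simp [rowInner, inner_smul_right, mul_add]

lemma rowInner_zero (k : RowL2 𝕜 μ) : rowInner k 0 = 0 := by simp [rowInner]

lemma rowInner_sum {ι : Type*} (k : RowL2 𝕜 μ) (S : Finset ι) (v : ι → RowL2 𝕜 μ) :
    rowInner k (∑ i ∈ S, v i) = ∑ i ∈ S, rowInner k (v i) := by
  classical
  induction S using Finset.induction_on with
  | empty => simp [rowInner_zero]
  | insert a S ha ih => rw [Finset.sum_insert ha, Finset.sum_insert ha, rowInner_add, ih]

lemma continuous_rowInner (k : RowL2 𝕜 μ) : Continuous (rowInner k) :=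
  continuous_finsetSum _ fun j _ => continuous_const.inner (continuous_apply j)

lemma rowInner_phiOp [IsFiniteMeasure μ] (l : ℝ) (k : RowL2 𝕜 μ) :
    rowInner k (phiOp 𝕜 μ l k) = ((‖phiFunctional 𝕜 μ l k‖ ^ 2 : ℝ) : 𝕜) := by
  have : phiOp 𝕜 μ l k = phiFunctional 𝕜 μ l k • phiLp 𝕜 μ l := rfl
  rw [this, rowInner_smul]
  have e : rowInner k (phiLp 𝕜 μ l) = (starRingEnd 𝕜) (phiFunctional 𝕜 μ l k) := by
    rw [phiFunctional_apply, map_sum]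
    exact Finset.sum_congr rfl fun j _ => (inner_conj_symm _ _).symm
  rw [e, RCLike.mul_conj]
  push_cast
  rfl

end IntegralOperator

end DiracGLM

namespace DiracGLM

variable {𝕜 : Type*} [RCLike 𝕜]

lemma phiFunctional_eq_pairing (x l : ℝ) (k : RowL2 𝕜 (volume.restrict (Ioo 0 x))) :
    phiFunctional 𝕜 (volume.restrict (Ioo 0 x)) l k = pairing x (k 0) (k 1) l := by
  rw [phiFunctional_eq_integral, pairing]
  refine integral_congr_ae (ae_of_all _ fun s => ?_)
  simp only [Fin.sum_univ_two, phi0, Matrix.cons_val_zero, Matrix.cons_val_one, Matrix.cons_val_fin_one]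
  push_cast
  ring

lemma norm_sq_eq_integral {μ : Measure ℝ} (f : Lp 𝕜 2 μ) : ‖f‖ ^ 2 = ∫ t, ‖f t‖ ^ 2 ∂μ := by
  have h := congrArg RCLike.re (L2.inner_def (𝕜 := 𝕜) f f)
  rw [inner_self_eq_norm_sq, ← integral_re (L2.integrable_inner f f)] at h
  simpa only [inner_self_eq_norm_sq] using h

lemma hasSum_sq_phiFunctional {x : ℝ} (hx : x ≤ Real.pi)
    (k : RowL2 𝕜 (volume.restrict (Ioo 0 x))) :
    HasSum (fun n : ℤ => 1 / Real.pi * ‖phiFunctional 𝕜 (volume.restrict (Ioo 0 x)) n k‖ ^ 2)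
      (‖k 0‖ ^ 2 + ‖k 1‖ ^ 2) := by
  have h := (hasSum_sq_pairing hx (Lp.memLp (k 0)) (Lp.memLp (k 1))).mul_left (1 / Real.pi)
  simp_rw [phiFunctional_eq_pairing]
  rw [norm_sq_eq_integral, norm_sq_eq_integral]
  convert! h using 1
  have := Real.pi_pos.ne'
  field_simp

lemma eq_zero_of_phiFunctional {x : ℝ} (hx : x ≤ Real.pi) {A : Set ℝ} (hA : ExpComplete A)
    {k : RowL2 𝕜 (volume.restrict (Ioo 0 x))}
    (h0 : ∀ l ∈ A, phiFunctional 𝕜 (volume.restrict (Ioo 0 x)) l k = 0) : k = 0 := by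
  have h := integral_norm_sq_eq_zero_of_pairing hx (Lp.memLp (k 0)) (Lp.memLp (k 1)) hA
    fun l hl => by rw [← phiFunctional_eq_pairing, h0 l hl]
  rw [← norm_sq_eq_integral, ← norm_sq_eq_integral] at h
  have h1 : ‖k 0‖ ^ 2 = 0 := by nlinarith [sq_nonneg ‖k 0‖, sq_nonneg ‖k 1‖]
  have h2 : ‖k 1‖ ^ 2 = 0 := by nlinarith [sq_nonneg ‖k 0‖, sq_nonneg ‖k 1‖]
  funext j
  fin_cases j
  · exact norm_eq_zero.1 (pow_eq_zero_iff two_ne_zero |>.1 h1)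
  · exact norm_eq_zero.1 (pow_eq_zero_iff two_ne_zero |>.1 h2)

lemma rowInner_self {μ : Measure ℝ} (k : RowL2 𝕜 μ) :
    rowInner k k = ((‖k 0‖ ^ 2 + ‖k 1‖ ^ 2 : ℝ) : 𝕜) := by
  rw [rowInner, Fin.sum_univ_two, inner_self_eq_norm_sq_to_K, inner_self_eq_norm_sq_to_K]
  push_cast
  rfl

/-- Symmetric partial sums of the operator series. -/
noncomputable def opSum (𝕜 : Type*) [RCLike 𝕜] (μ : Measure ℝ) [IsFiniteMeasure μ] (lam α : ℤ → ℝ)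
    (N : ℕ) : RowL2 𝕜 μ →L[𝕜] RowL2 𝕜 μ :=
  ∑ n ∈ Finset.Icc (-(N : ℤ)) (N : ℤ),
    (((1 / α n : ℝ) : 𝕜) • phiOp 𝕜 μ (lam n) - ((1 / Real.pi : ℝ) : 𝕜) • phiOp 𝕜 μ (n : ℝ))

lemma isIntOp_opSum {μ : Measure ℝ} [IsFiniteMeasure μ] (lam α : ℤ → ℝ) (N : ℕ) :
    IsIntOp (kernelSum lam α N) (opSum 𝕜 μ lam α N) :=
  IsIntOp.sum (fun n : ℤ => ((isIntOp_phiOp (lam n)).smul _).sub ((isIntOp_phiOp n).smul _)) _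

lemma isCompactOperator_smul_phiOp {μ : Measure ℝ} [IsFiniteMeasure μ] (c : 𝕜) (l : ℝ) :
    IsCompactOperator (c • phiOp 𝕜 μ l) := (isCompactOperator_phiOp l).smul c

lemma isCompactOperator_sum {E ι : Type*} [NormedAddCommGroup E] [NormedSpace 𝕜 E] (S : Finset ι)
    (T : ι → E →L[𝕜] E) (h : ∀ i ∈ S, IsCompactOperator (T i)) :
    IsCompactOperator (∑ i ∈ S, T i : E →L[𝕜] E) := by
  classical
  induction S using Finset.induction_on with
  | empty => rw [Finset.sum_empty]; exact isCompactOperator_zero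
  | insert a S ha ih =>
    rw [Finset.sum_insert ha]
    exact (h a (Finset.mem_insert_self _ _)).add
      (ih fun i hi => h i (Finset.mem_insert_of_mem hi))

lemma isCompactOperator_opSum {μ : Measure ℝ} [IsFiniteMeasure μ] (lam α : ℤ → ℝ) (N : ℕ) :
    IsCompactOperator (opSum 𝕜 μ lam α N) :=
  isCompactOperator_sum _ _ fun _ _ =>
    (isCompactOperator_smul_phiOp _ _).sub (isCompactOperator_smul_phiOp _ _)

lemma rowInner_opSum {μ : Measure ℝ} [IsFiniteMeasure μ] (lam α : ℤ → ℝ) (N : ℕ) (k : RowL2 𝕜 μ) :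
    rowInner k (opSum 𝕜 μ lam α N k) =
      ((∑ n ∈ Finset.Icc (-(N : ℤ)) (N : ℤ), 1 / α n * ‖phiFunctional 𝕜 μ (lam n) k‖ ^ 2 -
        ∑ n ∈ Finset.Icc (-(N : ℤ)) (N : ℤ), 1 / Real.pi * ‖phiFunctional 𝕜 μ n k‖ ^ 2 : ℝ) : 𝕜) := by
  rw [opSum, sum_apply, rowInner_sum, ← Finset.sum_sub_distrib,
    RCLike.ofReal_sum]
  refine Finset.sum_congr rfl fun n _ => ?_
  have e : (((1 / α n : ℝ) : 𝕜) • phiOp 𝕜 μ (lam n) - ((1 / Real.pi : ℝ) : 𝕜) • phiOp 𝕜 μ (n : ℝ)) k =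
      ((1 / α n : ℝ) : 𝕜) • phiOp 𝕜 μ (lam n) k + (-((1 / Real.pi : ℝ) : 𝕜)) • phiOp 𝕜 μ (n : ℝ) k := by
    rw [neg_smul, ← sub_eq_add_neg]
    rfl
  rw [e, rowInner_add, rowInner_smul, rowInner_smul, rowInner_phiOp, rowInner_phiOp]
  push_cast
  ring

lemma restrict_Ioo_le {x : ℝ} (hx : x ≤ Real.pi) :
    (volume.restrict (Ioo 0 x) : Measure ℝ) ≤ volume.restrict (Ioo 0 Real.pi) :=
  Measure.restrict_mono_set _ (Ioo_subset_Ioo_right hx)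

lemma exists_isIntOp_kerOf {x : ℝ} (hx : x ≤ Real.pi) {A : ℝ → ℂ} (hA : StronglyMeasurable A)
    (hAm : MemLp A 2 mu2) :
    ∃ T : RowL2 𝕜 (volume.restrict (Ioo 0 x)) →L[𝕜] RowL2 𝕜 (volume.restrict (Ioo 0 x)),
      IsIntOp (kerOf A) T ∧ ‖T‖ ≤ 2 * ((eLpNorm A 2 mu2).toReal *
        √((volume.restrict (Ioo 0 x) : Measure ℝ) univ).toReal) := by
  refine exists_isIntOp hAm.2.ne
    (fun l j => (measurable_kerOf hA.measurable l j).aestronglyMeasurable) fun l j => ?_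
  refine (ae_restrict_iff' measurableSet_Ioo).2 (ae_of_all _ fun s hs => ?_)
  exact (eLpNorm_mono_measure _ (restrict_Ioo_le hx)).trans
    (eLpNorm_kerOf_le hA ⟨hs.1.le, hs.2.le.trans hx⟩ l j)

lemma tendsto_opSum {x : ℝ} (hx : x ≤ Real.pi) {lam α : ℤ → ℝ} {A : ℝ → ℂ}
    (hA : StronglyMeasurable A) (hAm : MemLp A 2 mu2)
    (hT : Tendsto (fun N => eLpNorm (fun s => expSum lam α N s - A s) 2 mu2) atTop (𝓝 0))
    {T : RowL2 𝕜 (volume.restrict (Ioo 0 x)) →L[𝕜] RowL2 𝕜 (volume.restrict (Ioo 0 x))}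
    (h : IsIntOp (kerOf A) T) :
    Tendsto (opSum 𝕜 (volume.restrict (Ioo 0 x)) lam α) atTop (𝓝 T) := by
  have h1 : Tendsto (fun N => 2 * ((eLpNorm (fun s => expSum lam α N s - A s) 2 mu2).toReal *
      √((volume.restrict (Ioo 0 x) : Measure ℝ) univ).toReal)) atTop (𝓝 0) := by
    have := (ENNReal.tendsto_toReal ENNReal.zero_ne_top).comp hT
    have := (this.mul_const √((volume.restrict (Ioo 0 x) : Measure ℝ) univ).toReal).const_mul 2
    simpa using this
  rw [tendsto_iff_norm_sub_tendsto_zero]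
  refine squeeze_zero (fun _ => norm_nonneg _) (fun N => ?_) h1
  have hc := continuous_expSum lam α N
  obtain ⟨T', hT', hn⟩ := exists_isIntOp_kerOf (𝕜 := 𝕜) hx (hc.stronglyMeasurable.sub hA)
    ((memLp_mu2_of_continuous hc 2).sub hAm)
  have h2 := (isIntOp_opSum (𝕜 := 𝕜) (μ := volume.restrict (Ioo 0 x)) lam α N).sub h
  have e : (fun s t => kernelSum lam α N s t - kerOf A s t) =
      kerOf (expSum lam α N - A) := by
    funext s t
    ext i j
    rw [Matrix.sub_apply, kernelSum_eq_kerOf]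
    exact (kerOf_sub _ _ s t i j).symm
  rw [e] at h2
  rw [h2.unique hT']
  exact hn

lemma bijective_one_add_of_isCompactOperator {E : Type*} [NormedAddCommGroup E] [NormedSpace 𝕜 E]
    [CompleteSpace E] {T : E →L[𝕜] E} (hT : IsCompactOperator T) (h0 : ∀ k, k + T k = 0 → k = 0) :
    Function.Bijective fun k => k + T k := by
  have hne : (-1 : 𝕜) ≠ 0 := neg_ne_zero.2 one_ne_zero
  rcases hT.hasEigenvalue_or_mem_resolventSet hne with h | h
  · obtain ⟨v, hv⟩ := h.exists_hasEigenvector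
    have h1 := hv.apply_eq_smul
    refine absurd (h0 v ?_) hv.2
    change T v = (-1 : 𝕜) • v at h1
    rw [h1, neg_one_smul, add_neg_cancel]
  · rw [spectrum.mem_resolventSet_iff, ← IsUnit.neg_iff,
      ContinuousLinearMap.isUnit_iff_bijective] at h
    convert h using 1
    funext k
    rw [map_neg, map_one, neg_sub, sub_neg_eq_add, add_comm]
    rfl

/-- Unique solvability of the main equation with the kernel of a convergent series to which finitely
many nonnegative terms have been added. -/
theorem existsUnique_mainEquation {lam α : ℤ → ℝ} (hpos : ∀ n, 0 < α n)
    (hl : Summable fun n : ℤ => (lam n - n) ^ 2) (hs : Summable fun n : ℤ => (α n - Real.pi) ^ 2)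
    (hinj : Function.Injective lam) {F : ℝ → ℝ → Matrix (Fin 2) (Fin 2) ℝ} (hF : IsKernel lam α F)
    (E : Finset ℝ) (β : ℝ → ℝ) (hβ : ∀ m ∈ E, 0 < β m) {x : ℝ} (hx : x ∈ Ioc 0 Real.pi) :
    ∃! K : L2Mat 𝕜 x, SolvesMainEquation
      (fun s t => F s t + ∑ m ∈ E, (1 / β m) • phi0Mat s t m) x K := by
  obtain ⟨A, hA, hAm, hT⟩ := exists_tendsto_expSum hpos hl hs
  set μ : Measure ℝ := volume.restrict (Ioo 0 x) with hμ
  obtain ⟨T₀, hT₀, -⟩ := exists_isIntOp_kerOf (𝕜 := 𝕜) hx.2 hA hAm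
  have hlim := tendsto_opSum hx.2 hA hAm hT hT₀
  have hcpt : IsCompactOperator T₀ :=
    isCompactOperator_of_tendsto hlim (Eventually.of_forall fun N => isCompactOperator_opSum _ _ N)
  set TE : RowL2 𝕜 μ →L[𝕜] RowL2 𝕜 μ := ∑ m ∈ E, ((1 / β m : ℝ) : 𝕜) • phiOp 𝕜 μ m with hTE
  have hcptE : IsCompactOperator TE :=
    isCompactOperator_sum _ _ fun _ _ => isCompactOperator_smul_phiOp _ _
  have hFT : IsIntOp F T₀ := by
    refine hT₀.congr fun l j => ?_
    have hm : AEStronglyMeasurable (fun z : ℝ × ℝ => F z.1 z.2 l j) (μ.prod μ) :=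
      (hF.measurable l j).mono_measure
        (Measure.prod_mono (restrict_Ioo_le hx.2) (restrict_Ioo_le hx.2))
    refine ae_ae_eq_swap (f := fun z : ℝ × ℝ => kerOf A z.1 z.2 l j)
      (g := fun z : ℝ × ℝ => F z.1 z.2 l j)
      (measurable_kerOf hA.measurable l j).aestronglyMeasurable hm ?_
    refine (ae_restrict_iff' measurableSet_Ioo).2 (ae_of_all _ fun s hs => ?_)
    exact ae_mono (restrict_Ioo_le hx.2)
      ((isKernel_kerOf hA hAm hT).ae_eq hF ⟨hs.1.le, hs.2.le.trans hx.2⟩ l j)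
  have hG : IsIntOp (fun s t => F s t + ∑ m ∈ E, (1 / β m) • phi0Mat s t m) (T₀ + TE) :=
    hFT.add (IsIntOp.sum (fun m => (isIntOp_phiOp m).smul _) E)
  have hbij : Function.Bijective fun k => k + (T₀ + TE) k := by
    refine bijective_one_add_of_isCompactOperator (hcpt.add hcptE) fun k hk => ?_
    have hE : rowInner k (TE k) =
        ((∑ m ∈ E, 1 / β m * ‖phiFunctional 𝕜 μ m k‖ ^ 2 : ℝ) : 𝕜) := by
      rw [hTE, sum_apply, rowInner_sum, RCLike.ofReal_sum]
      refine Finset.sum_congr rfl fun m _ => ?_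
      change rowInner k (((1 / β m : ℝ) : 𝕜) • phiOp 𝕜 μ m k) = _
      rw [rowInner_smul, rowInner_phiOp]
      push_cast
      rfl
    have hEnn : 0 ≤ ∑ m ∈ E, 1 / β m * ‖phiFunctional 𝕜 μ m k‖ ^ 2 :=
      Finset.sum_nonneg fun m hm => mul_nonneg (one_div_pos.2 (hβ m hm)).le (sq_nonneg _)
    have h1 : rowInner k (k + (T₀ k + TE k)) = 0 := by
      have : k + (T₀ k + TE k) = 0 := hk
      rw [this, rowInner_zero]
    rw [rowInner_add, rowInner_add, rowInner_self, hE] at h1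
    have h2 : Tendsto (fun N => RCLike.re (rowInner k (opSum 𝕜 μ lam α N k))) atTop
        (𝓝 (RCLike.re (rowInner k (T₀ k)))) := by
      have e1 : Tendsto (fun N => opSum 𝕜 μ lam α N k) atTop (𝓝 (T₀ k)) :=
        ((ContinuousLinearMap.apply 𝕜 _ k).continuous.tendsto T₀).comp hlim
      exact (RCLike.continuous_re.tendsto _).comp (((continuous_rowInner k).tendsto _).comp e1)
    have h3 := (hasSum_sq_phiFunctional hx.2 k).comp (Finset.tendsto_Icc_neg (R := ℤ))
    have h4 : Tendsto (fun N : ℕ => ∑ n ∈ Finset.Icc (-(N : ℤ)) (N : ℤ),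
        1 / α n * ‖phiFunctional 𝕜 μ (lam n) k‖ ^ 2) atTop
        (𝓝 (RCLike.re (rowInner k (T₀ k)) + (‖k 0‖ ^ 2 + ‖k 1‖ ^ 2))) := by
      refine (h2.add h3).congr fun N => ?_
      rw [rowInner_opSum, RCLike.ofReal_re]
      exact sub_add_cancel _ _
    have h5 : RCLike.re (rowInner k (T₀ k)) + (‖k 0‖ ^ 2 + ‖k 1‖ ^ 2) ≤ 0 := by
      have := congrArg RCLike.re h1
      rw [map_add, map_add, RCLike.ofReal_re, RCLike.ofReal_re, map_zero] at this
      linarith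
    have hnn : ∀ n, 0 ≤ 1 / α n * ‖phiFunctional 𝕜 μ (lam n) k‖ ^ 2 := fun n =>
      mul_nonneg (one_div_pos.2 (hpos n)).le (sq_nonneg _)
    refine eq_zero_of_phiFunctional hx.2 (expComplete_range hinj hl) ?_
    rintro _ ⟨n, rfl⟩
    have h6 : 1 / α n * ‖phiFunctional 𝕜 μ (lam n) k‖ ^ 2 ≤ 0 := by
      refine le_trans (ge_of_tendsto h4 ?_) h5
      filter_upwards [eventually_ge_atTop n.natAbs] with N hN
      refine Finset.single_le_sum (f := fun n => 1 / α n * ‖phiFunctional 𝕜 μ (lam n) k‖ ^ 2)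
        (fun i _ => hnn i) ?_
      rw [Finset.mem_Icc]
      omega
    have h7 : ‖phiFunctional 𝕜 μ (lam n) k‖ ^ 2 = 0 := by
      have h8 := le_antisymm h6 (hnn n)
      rcases mul_eq_zero.1 h8 with h9 | h9
      · exact absurd h9 (one_div_pos.2 (hpos n)).ne'
      · exact h9
    exact norm_eq_zero.1 (pow_eq_zero_iff two_ne_zero |>.1 h7)
  set G : ℝ → ℝ → Matrix (Fin 2) (Fin 2) ℝ :=
    fun s t => F s t + ∑ m ∈ E, (1 / β m) • phi0Mat s t m with hGdef
  have hGm : ∀ i j, MemLp (fun t => ((G x t i j : ℝ) : 𝕜)) 2 μ := by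
    intro i j
    refine MemLp.ofReal ?_
    simp only [hGdef, Matrix.add_apply, Matrix.sum_apply, Matrix.smul_apply, smul_eq_mul]
    refine ((hF.memLp x ⟨hx.1.le, hx.2⟩ i j).mono_measure (restrict_Ioo_le hx.2)).add ?_
    refine memLp_finsetSum _ fun m _ => MemLp.const_mul ?_ _
    have hc : Continuous fun t => phi0Mat x t m i j := by
      simp only [phi0Mat, Matrix.vecMulVec_apply]
      refine continuous_const.mul ?_
      fin_cases j <;> simp only [phi0] <;> fun_prop
    obtain ⟨C, hC⟩ := isCompact_Icc.exists_bound_of_continuousOn (s := Icc 0 x) hc.continuousOn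
    exact MemLp.of_bound hc.aestronglyMeasurable C ((ae_restrict_iff' measurableSet_Ioo).2
      (ae_of_all _ fun t ht => hC t (Ioo_subset_Icc_self ht)))
  have hiff : ∀ K : L2Mat 𝕜 x, SolvesMainEquation G x K ↔
      ∀ i, K i + (T₀ + TE) (K i) = fun j => -(hGm i j).toLp _ := by
    intro K
    refine forall_congr' fun i => ?_
    rw [funext_iff]
    refine forall_congr' fun j => ?_
    have hbase : ∀ᵐ t ∂μ, (((G x t i j : ℝ) : 𝕜) + K i j t +
        ∫ s in Ioo 0 x, ∑ l, K i l s * ((G s t l j : ℝ) : 𝕜) = 0 ↔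
        (K i + (T₀ + TE) (K i)) j t = (-(hGm i j).toLp _ : Lp 𝕜 2 μ) t) := by
      filter_upwards [hG (K i) j, (hGm i j).coeFn_toLp, Lp.coeFn_neg ((hGm i j).toLp _),
        Lp.coeFn_add (K i j) ((T₀ + TE) (K i) j)] with t h1 h2 h3 h4
      have h5 : (K i + (T₀ + TE) (K i)) j t = K i j t + (T₀ + TE) (K i) j t := h4
      rw [h5, h3, Pi.neg_apply, h2, h1.2]
      constructor
      · intro h; linear_combination h
      · intro h; linear_combination h
    constructor
    · intro h
      refine Lp.ext ?_
      filter_upwards [h, hbase] with t h1 h2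
      exact h2.1 h1
    · intro h
      filter_upwards [hbase] with t h2
      exact h2.2 (by rw [h])
  choose K hK using fun i => hbij.2 (fun j => -(hGm i j).toLp _)
  refine ⟨K, (hiff K).2 hK, fun K' hK' => ?_⟩
  funext i
  exact hbij.1 (((hiff K').1 hK' i).trans (hK i).symm)

end DiracGLM

namespace DiracGLM

/-- The potential as a complex function. -/
noncomputable def pot (p q : ℝ → ℝ) (x : ℝ) : ℂ := (q x : ℂ) + (p x : ℂ) * Complex.I

/-- A vector function in the rotating complex coordinate of the free system. -/
noncomputable def rotated (m : ℝ) (y : ℝ → Fin 2 → ℝ) (x : ℝ) : ℂ :=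
  Complex.exp (Complex.I * ((m * x : ℝ) : ℂ)) • ((y x 1 : ℂ) + (y x 0 : ℂ) * Complex.I)

lemma norm_rotated_sq (m : ℝ) (y : ℝ → Fin 2 → ℝ) (x : ℝ) :
    ‖rotated m y x‖ ^ 2 = y x 0 ^ 2 + y x 1 ^ 2 := by
  rw [rotated, norm_smul, norm_exp_I_mul, one_mul, ← Complex.normSq_eq_norm_sq,
    Complex.normSq_add_mul_I]
  ring

lemma ac_rotated {p q : ℝ → ℝ} {m : ℝ} {y : ℝ → Fin 2 → ℝ} (hy : IsDiracSolution p q m y) :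
    AbsolutelyContinuousOnInterval (rotated m y) 0 Real.pi :=
  (ac_of_contDiff (contDiff_exp_mul m) _ _).fun_smul (ac_of_re_im (hy.absCont 1) (hy.absCont 0))

lemma hasDerivAt_rotated {p q : ℝ → ℝ} {m : ℝ} {y : ℝ → Fin 2 → ℝ} (hy : IsDiracSolution p q m y) :
    ∀ᵐ x, x ∈ Icc 0 Real.pi → HasDerivAt (rotated m y)
      (-(pot p q x * Complex.exp (Complex.I * ((2 * m * x : ℝ) : ℂ)) *
        (starRingEnd ℂ) (rotated m y x))) x := by
  have h1 := (ae_restrict_iff' (measurableSet_Ioo (a := (0 : ℝ)) (b := Real.pi))).1 hy.eqn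
  have h0 : ∀ᵐ x : ℝ, x ≠ 0 := by simp [ae_iff, measure_singleton]
  have hp : ∀ᵐ x : ℝ, x ≠ Real.pi := by simp [ae_iff, measure_singleton]
  filter_upwards [h1, h0, hp] with x hx hx0 hxp hmem
  obtain ⟨y', hd, he⟩ := hx ⟨lt_of_le_of_ne hmem.1 (Ne.symm hx0), lt_of_le_of_ne hmem.2 hxp⟩
  rw [hasDerivAt_pi] at hd
  have e0 := congrFun he 0
  have e1 := congrFun he 1
  simp [B, Om, Matrix.vecHead, Matrix.vecTail] at e0 e1
  have d1 : HasDerivAt (fun x => (y x 1 : ℂ) + (y x 0 : ℂ) * Complex.I)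
      ((y' 1 : ℂ) + (y' 0 : ℂ) * Complex.I) x :=
    (hd 1).ofReal_comp.add ((hd 0).ofReal_comp.mul_const _)
  refine ((hasDerivAt_exp_mul m x).smul d1).congr_deriv ?_
  have e2 : Complex.exp (Complex.I * ((2 * m * x : ℝ) : ℂ)) *
      Complex.exp (-(Complex.I * ((m * x : ℝ) : ℂ))) = Complex.exp (Complex.I * ((m * x : ℝ) : ℂ)) := by
    rw [← Complex.exp_add]; congr 1; push_cast; ring
  have e3 : (starRingEnd ℂ) (rotated m y x) =
      Complex.exp (-(Complex.I * ((m * x : ℝ) : ℂ))) * ((y x 1 : ℂ) - (y x 0 : ℂ) * Complex.I) := by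
    simp only [rotated, smul_eq_mul, map_mul, map_add, ← Complex.exp_conj, Complex.conj_I,
      Complex.conj_ofReal]
    ring_nf
  have h3 : (y' 1 : ℂ) = m * y x 0 - p x * y x 0 - q x * y x 1 := by
    have : y' 1 = m * y x 0 - p x * y x 0 - q x * y x 1 := by linarith
    rw [this]; push_cast; ring
  have h4 : (y' 0 : ℂ) = -(m * y x 1) + q x * y x 0 - p x * y x 1 := by
    have : y' 0 = -(m * y x 1) + q x * y x 0 - p x * y x 1 := by linarith
    rw [this]; push_cast; ring
  rw [e3, mul_assoc (pot p q x), ← mul_assoc (Complex.exp (Complex.I * ((2 * m * x : ℝ) : ℂ))), e2,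
    h3, h4, pot, smul_eq_mul, smul_eq_mul]
  generalize Complex.exp (Complex.I * ((m * x : ℝ) : ℂ)) = Z
  linear_combination (Z * (m * y x 0 - p x * y x 0)) * Complex.I_sq

lemma rotated_eq {p q : ℝ → ℝ} {m : ℝ} {y : ℝ → Fin 2 → ℝ} (hy : IsDiracSolution p q m y) {x : ℝ}
    (hx : x ∈ Icc 0 Real.pi) :
    IntervalIntegrable (fun s => pot p q s * Complex.exp (Complex.I * ((2 * m * s : ℝ) : ℂ)) *
      (starRingEnd ℂ) (rotated m y s)) volume 0 x ∧
    rotated m y x = rotated m y 0 - ∫ s in (0 : ℝ)..x,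
      pot p q s * Complex.exp (Complex.I * ((2 * m * s : ℝ) : ℂ)) *
        (starRingEnd ℂ) (rotated m y s) := by
  have hsub : uIcc 0 x ⊆ uIcc 0 Real.pi := by
    rw [uIcc_of_le hx.1, uIcc_of_le Real.pi_pos.le]
    exact Icc_subset_Icc_right hx.2
  have h := ac_integral_eq_sub ((ac_rotated hy).mono hsub) (by
    filter_upwards [hasDerivAt_rotated hy] with s hs hs'
    refine hs ?_
    have := hsub hs'
    rwa [uIcc_of_le Real.pi_pos.le] at this)
  refine ⟨by have h1 := h.1.neg; simpa only [Pi.neg_def, neg_neg] using h1, ?_⟩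
  have h2 := h.2
  rw [intervalIntegral.integral_neg] at h2
  linear_combination -h2

lemma lipschitzOnWith_exp_neg : LipschitzOnWith 1 (fun z : ℝ => Real.exp (-z)) (Ici 0) := by
  refine (convex_Ici 0).lipschitzOnWith_of_nnnorm_hasDerivWithin_le
    (f' := fun z => -Real.exp (-z)) (fun z _ => ?_) fun z hz => ?_
  · have := ((hasDerivAt_id z).neg.exp).hasDerivWithinAt (s := Ici 0)
    simpa using this
  · rw [nnnorm_neg, ← NNReal.coe_le_coe, coe_nnnorm, Real.norm_of_nonneg (Real.exp_pos _).le]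
    simpa using hz

/-- Gronwall's inequality with an integrable coefficient. -/
lemma gronwall_integral {g u a : ℝ → ℝ} {b : ℝ} (hg0 : ∀ x, 0 ≤ g x) (ha0 : ∀ x, 0 ≤ a x)
    (hg : IntervalIntegrable g volume 0 b) (hgu : IntervalIntegrable (fun x => g x * u x) volume 0 b)
    (hga : IntervalIntegrable (fun x => g x * a x) volume 0 b)
    (h : ∀ x ∈ Icc 0 b, u x ≤ a x + ∫ s in (0 : ℝ)..x, g s * u s) :
    ∀ x ∈ Icc 0 b, u x ≤ a x + Real.exp (∫ s in (0 : ℝ)..b, g s) * ∫ s in (0 : ℝ)..b, g s * a s := by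
  intro x hx
  have hb : 0 ≤ b := hx.1.trans hx.2
  have hsub : uIcc 0 x ⊆ uIcc 0 b := by
    rw [uIcc_of_le hx.1, uIcc_of_le hb]; exact Icc_subset_Icc_right hx.2
  obtain ⟨G, hG⟩ : ∃ G : ℝ → ℝ, G = fun x => ∫ s in (0 : ℝ)..x, g s := ⟨_, rfl⟩
  obtain ⟨D, hD⟩ : ∃ D : ℝ → ℝ, D = fun x => ∫ s in (0 : ℝ)..x, g s * u s := ⟨_, rfl⟩
  have hGac : AbsolutelyContinuousOnInterval G 0 b := by
    rw [hG]; exact hg.absolutelyContinuousOnInterval_intervalIntegral left_mem_uIcc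
  have hDac : AbsolutelyContinuousOnInterval D 0 b := by
    rw [hD]; exact hgu.absolutelyContinuousOnInterval_intervalIntegral left_mem_uIcc
  have hG0 : ∀ z, 0 ≤ z → 0 ≤ G z := fun z hz => by
    rw [hG]; exact intervalIntegral.integral_nonneg hz fun s _ => hg0 s
  have hGd : ∀ᵐ z, z ∈ uIcc 0 b → HasDerivAt G (g z) z := by
    filter_upwards [hg.ae_hasDerivAt_integral] with z h1 hz
    rw [hG]; exact h1 hz 0 left_mem_uIcc
  have hDd : ∀ᵐ z, z ∈ uIcc 0 b → HasDerivAt D (g z * u z) z := by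
    filter_upwards [hgu.ae_hasDerivAt_integral] with z h1 hz
    rw [hD]; exact h1 hz 0 left_mem_uIcc
  have hD0 : D 0 = 0 := by rw [hD]; exact intervalIntegral.integral_same
  have h' : ∀ x ∈ Icc 0 b, u x ≤ a x + D x := by rw [hD]; exact h
  have hGm : G x ≤ G b := by
    rw [hG]
    exact intervalIntegral.integral_mono_interval le_rfl hx.1 hx.2 (ae_of_all _ hg0) hg
  have hGb : ∫ s in (0 : ℝ)..b, g s = G b := by rw [hG]
  rw [hGb]
  clear hG hD h hGb
  have hEac : AbsolutelyContinuousOnInterval (fun z => Real.exp (-G z)) 0 b := by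
    have hmem : ∀ z ∈ uIcc 0 b, G z ∈ Ici (0 : ℝ) := fun z hz => by
      rw [uIcc_of_le hb] at hz
      exact hG0 z hz.1
    have := ac_lipschitzOn_comp lipschitzOnWith_exp_neg hGac hmem
    exact this
  obtain ⟨H, hH⟩ : ∃ H : ℝ → ℝ, H = fun z => Real.exp (-G z) * D z := ⟨_, rfl⟩
  have hfac : AbsolutelyContinuousOnInterval H 0 x := by
    rw [hH]; exact (hEac.fun_mul hDac).mono hsub
  have hder : ∀ᵐ z, z ∈ uIoc 0 x → deriv H z ≤ g z * a z := by
    filter_upwards [hGd, hDd] with z h1 h2 hz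
    have hz' : z ∈ uIcc 0 b := hsub (uIoc_subset_uIcc hz)
    have hz2 : z ∈ Icc 0 b := by rwa [uIcc_of_le hb] at hz'
    have e : deriv H z = Real.exp (-G z) * -g z * D z + Real.exp (-G z) * (g z * u z) := by
      rw [hH]
      exact (((h1 hz').fun_neg.exp).fun_mul (h2 hz')).deriv
    rw [e]
    have h3 := h' z hz2
    have h4 : Real.exp (-G z) ≤ 1 := Real.exp_le_one_iff.2 (by linarith [hG0 z hz2.1])
    have h6 : g z * (u z - D z) ≤ g z * a z :=
      mul_le_mul_of_nonneg_left (by linarith) (hg0 z)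
    have h7 : 0 ≤ g z * a z := mul_nonneg (hg0 z) (ha0 z)
    calc _ = Real.exp (-G z) * (g z * (u z - D z)) := by ring
      _ ≤ Real.exp (-G z) * (g z * a z) := mul_le_mul_of_nonneg_left h6 (Real.exp_pos _).le
      _ ≤ 1 * (g z * a z) := mul_le_mul_of_nonneg_right h4 h7
      _ = _ := one_mul _
  have hint := hfac.integral_deriv_eq_sub
  have hHx : H x = Real.exp (-G x) * D x := by rw [hH]
  have hH0 : H 0 = 0 := by rw [hH]; simp [hD0]
  have hle : ∫ z in (0 : ℝ)..x, deriv H z ≤ ∫ z in (0 : ℝ)..x, g z * a z := by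
    refine intervalIntegral.integral_mono_ae_restrict hx.1 hfac.intervalIntegrable_deriv
      (hga.mono_set hsub) ?_
    rw [uIoc_of_le hx.1] at hder
    rw [← restrict_Ioc_eq_restrict_Icc]
    exact (ae_restrict_iff' measurableSet_Ioc).2 hder
  have hnn : ∀ z, 0 ≤ g z * a z := fun z => mul_nonneg (hg0 z) (ha0 z)
  have hle2 : ∫ z in (0 : ℝ)..x, g z * a z ≤ ∫ z in (0 : ℝ)..b, g z * a z :=
    intervalIntegral.integral_mono_interval le_rfl hx.1 hx.2 (ae_of_all _ hnn) hga
  have hI : 0 ≤ ∫ z in (0 : ℝ)..b, g z * a z :=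
    intervalIntegral.integral_nonneg hb fun s _ => hnn s
  have hDx : D x ≤ Real.exp (G b) * ∫ z in (0 : ℝ)..b, g z * a z := by
    calc D x = Real.exp (G x) * (Real.exp (-G x) * D x) := by
          rw [← mul_assoc, ← Real.exp_add, add_neg_cancel, Real.exp_zero, one_mul]
      _ ≤ Real.exp (G x) * ∫ z in (0 : ℝ)..b, g z * a z := by
          refine mul_le_mul_of_nonneg_left ?_ (Real.exp_pos _).le
          linarith
      _ ≤ _ := mul_le_mul_of_nonneg_right (Real.exp_le_exp.2 hGm) hI
  linarith [h' x hx]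

end DiracGLM

namespace DiracGLM

/-- The integral of `h` against the exponential with frequency `l` over `(0, x)`. -/
noncomputable def oscInt (h : ℝ → ℂ) (l x : ℝ) : ℂ :=
  ∫ s in (0 : ℝ)..x, h s * Complex.exp (Complex.I * ((l * s : ℝ) : ℂ))

section oscInt

variable {h : ℝ → ℂ}

lemma uIcc_zero_pi : uIcc 0 Real.pi = Icc 0 Real.pi := uIcc_of_le Real.pi_pos.le

lemma uIcc_zero_subset {x : ℝ} (hx : x ∈ Icc 0 Real.pi) : uIcc 0 x ⊆ uIcc 0 Real.pi := by
  rw [uIcc_of_le hx.1, uIcc_zero_pi]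
  exact Icc_subset_Icc_right hx.2

lemma ac_oscInt (hh : MemLp h 2 (volume.restrict (Ioc 0 Real.pi))) (l : ℝ) :
    AbsolutelyContinuousOnInterval (oscInt h l) 0 Real.pi :=
  ac_intervalIntegral (intervalIntegrable_of_memLp Real.pi_pos.le (memLp_mul_exp hh l))

lemma continuousOn_oscInt (hh : MemLp h 2 (volume.restrict (Ioc 0 Real.pi))) (l : ℝ) :
    ContinuousOn (oscInt h l) (uIcc 0 Real.pi) := (ac_oscInt hh l).continuousOn

lemma memLp_of_continuousOn {E : Type*} [NormedAddCommGroup E] {f : ℝ → E}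
    (hf : ContinuousOn f (uIcc 0 Real.pi)) :
    MemLp f 2 (volume.restrict (Ioc 0 Real.pi)) := by
  rw [uIcc_zero_pi] at hf
  obtain ⟨C, hC⟩ := isCompact_Icc.exists_bound_of_continuousOn hf
  refine MemLp.of_bound ?_ C ?_
  · exact (hf.mono Ioc_subset_Icc_self).aestronglyMeasurable measurableSet_Ioc
  · exact (ae_restrict_iff' measurableSet_Ioc).2
      (ae_of_all _ fun x hx => hC x (Ioc_subset_Icc_self hx))

lemma intervalIntegral_sq_le {f : ℝ → ℝ} (hf : ContinuousOn f (uIcc 0 Real.pi)) :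
    (∫ x in (0 : ℝ)..Real.pi, f x) ^ 2 ≤ Real.pi * ∫ x in (0 : ℝ)..Real.pi, f x ^ 2 := by
  have h1 := norm_integral_mul_sq_le (𝕜 := ℝ) (μ := volume.restrict (Ioc 0 Real.pi))
    (f := fun _ => (1 : ℝ)) (g := f) (memLp_const 1) (memLp_of_continuousOn hf)
  rw [intervalIntegral.integral_of_le Real.pi_pos.le, intervalIntegral.integral_of_le Real.pi_pos.le]
  simpa [Real.pi_pos.le] using h1

lemma oscInt_shift (hh : MemLp h 2 (volume.restrict (Ioc 0 Real.pi))) (l l' : ℝ) {x : ℝ}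
    (hx : x ∈ Icc 0 Real.pi) :
    oscInt h l x = oscInt h l' x * Complex.exp (Complex.I * (((l - l') * x : ℝ) : ℂ)) -
      ∫ s in (0 : ℝ)..x, oscInt h l' s * (Complex.exp (Complex.I * (((l - l') * s : ℝ) : ℂ)) *
        (Complex.I * ((l - l' : ℝ) : ℂ))) := by
  have hg := intervalIntegrable_of_memLp Real.pi_pos.le (memLp_mul_exp hh l')
  have hg2 := intervalIntegrable_of_memLp Real.pi_pos.le (memLp_mul_exp hh l)
  have hexp : Continuous fun x : ℝ => Complex.exp (Complex.I * (((l - l') * x : ℝ) : ℂ)) := by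
    fun_prop
  have hd : ∀ᵐ s, s ∈ uIcc 0 x →
      HasDerivAt (fun s => Complex.exp (Complex.I * (((l - l') * s : ℝ) : ℂ)) • oscInt h l' s)
        (h s * Complex.exp (Complex.I * ((l * s : ℝ) : ℂ)) + oscInt h l' s *
          (Complex.exp (Complex.I * (((l - l') * s : ℝ) : ℂ)) * (Complex.I * ((l - l' : ℝ) : ℂ)))) s := by
    filter_upwards [hg.ae_hasDerivAt_integral] with s hs hs'
    have h1 := hs (uIcc_zero_subset hx hs') 0 left_mem_uIcc
    have h2 := hasDerivAt_exp_mul (l - l') s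
    refine (h2.smul h1).congr_deriv ?_
    have e2 : Complex.exp (Complex.I * ((l * s : ℝ) : ℂ)) =
        Complex.exp (Complex.I * (((l - l') * s : ℝ) : ℂ)) *
          Complex.exp (Complex.I * ((l' * s : ℝ) : ℂ)) := by
      rw [← Complex.exp_add]; congr 1; push_cast; ring
    rw [e2, smul_eq_mul, smul_eq_mul, oscInt]
    ring
  have hac : AbsolutelyContinuousOnInterval
      (fun s => Complex.exp (Complex.I * (((l - l') * s : ℝ) : ℂ)) • oscInt h l' s) 0 x := by
    have := ((ac_of_contDiff (contDiff_exp_mul (l - l')) 0 Real.pi).fun_smul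
      (ac_oscInt hh l')).mono (uIcc_zero_subset hx)
    exact this
  obtain ⟨_, h2⟩ := ac_integral_eq_sub hac hd
  have hu : IntervalIntegrable (fun s => oscInt h l' s *
      (Complex.exp (Complex.I * (((l - l') * s : ℝ) : ℂ)) * (Complex.I * ((l - l' : ℝ) : ℂ))))
      volume 0 x := by
    refine ContinuousOn.intervalIntegrable ?_
    exact ((continuousOn_oscInt hh l').mono (uIcc_zero_subset hx)).mul
      (hexp.mul continuous_const).continuousOn
  rw [intervalIntegral.integral_add (hg2.mono_set (uIcc_zero_subset hx)) hu] at h2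
  have h0 : oscInt h l' 0 = 0 := intervalIntegral.integral_same
  rw [h0, smul_zero, sub_zero, smul_eq_mul] at h2
  rw [oscInt]
  linear_combination h2

lemma norm_oscInt_sq_le (hh : MemLp h 2 (volume.restrict (Ioc 0 Real.pi))) {l l' : ℝ}
    (hl : |l - l'| ≤ 1) {x : ℝ} (hx : x ∈ Icc 0 Real.pi) :
    ‖oscInt h l x‖ ^ 2 ≤ 2 * ‖oscInt h l' x‖ ^ 2 +
      2 * Real.pi * ∫ s in (0 : ℝ)..Real.pi, ‖oscInt h l' s‖ ^ 2 := by
  have hc := (continuousOn_oscInt hh l').norm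
  have h1 : ‖∫ s in (0 : ℝ)..x, oscInt h l' s * (Complex.exp (Complex.I * (((l - l') * s : ℝ) : ℂ)) *
      (Complex.I * ((l - l' : ℝ) : ℂ)))‖ ≤ ∫ s in (0 : ℝ)..x, ‖oscInt h l' s‖ := by
    refine intervalIntegral.norm_integral_le_of_norm_le hx.1 (ae_of_all _ fun s _ => ?_)
      (hc.mono (uIcc_zero_subset hx)).intervalIntegrable
    rw [norm_mul, norm_mul, norm_exp_I_mul, norm_mul, Complex.norm_I, Complex.norm_real,
      Real.norm_eq_abs, one_mul, one_mul]
    exact mul_le_of_le_one_right (norm_nonneg _) hl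
  have h2 : ∫ s in (0 : ℝ)..x, ‖oscInt h l' s‖ ≤ ∫ s in (0 : ℝ)..Real.pi, ‖oscInt h l' s‖ :=
    intervalIntegral.integral_mono_interval le_rfl hx.1 hx.2 (ae_of_all _ fun s => norm_nonneg _)
      hc.intervalIntegrable
  have h3 := intervalIntegral_sq_le hc
  have h4 : ‖oscInt h l x‖ ≤ ‖oscInt h l' x‖ + ∫ s in (0 : ℝ)..Real.pi, ‖oscInt h l' s‖ := by
    rw [oscInt_shift hh l l' hx]
    refine (norm_sub_le _ _).trans ?_
    rw [norm_mul, norm_exp_I_mul, mul_one]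
    linarith
  have h5 := pow_le_pow_left₀ (norm_nonneg _) h4 2
  nlinarith [sq_nonneg (‖oscInt h l' x‖ - ∫ s in (0 : ℝ)..Real.pi, ‖oscInt h l' s‖)]

lemma sum_norm_oscInt_sq_le (hh : MemLp h 2 (volume.restrict (Ioc 0 Real.pi))) (S : Finset ℤ) {x : ℝ}
    (hx : x ∈ Icc 0 Real.pi) :
    ∑ n ∈ S, ‖oscInt h (2 * n) x‖ ^ 2 ≤ Real.pi * ∫ s in (0 : ℝ)..Real.pi, ‖h s‖ ^ 2 := by
  have hsub : Ioc 0 x ⊆ Ioc 0 Real.pi := Ioc_subset_Ioc_right hx.2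
  have hf : MemLp ((Ioc 0 x).indicator h) 2 (volume.restrict (Ioc 0 Real.pi)) :=
    hh.indicator measurableSet_Ioc
  have h1 := hasSum_sq_expIntegral Real.pi_pos hf
  rw [sub_zero] at h1
  have e : ∀ n : ℤ, ∫ s in (0 : ℝ)..Real.pi, (Ioc 0 x).indicator h s *
      Complex.exp (Complex.I * ((2 * Real.pi * n / Real.pi * s : ℝ) : ℂ)) = oscInt h (2 * n) x := by
    intro n
    have e1 : 2 * Real.pi * n / Real.pi = 2 * (n : ℝ) := by
      field_simp [Real.pi_pos.ne']
    rw [oscInt, intervalIntegral.integral_of_le Real.pi_pos.le, intervalIntegral.integral_of_le hx.1,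
      e1]
    have e2 : (fun s => (Ioc 0 x).indicator h s * Complex.exp (Complex.I * ((2 * n * s : ℝ) : ℂ))) =
        (Ioc 0 x).indicator fun s => h s * Complex.exp (Complex.I * ((2 * n * s : ℝ) : ℂ)) := by
      funext s
      rw [indicator_mul_left]
    rw [e2, setIntegral_indicator measurableSet_Ioc, inter_eq_self_of_subset_right hsub]
  simp_rw [e] at h1
  refine (sum_le_hasSum S (fun _ _ => sq_nonneg _) h1).trans ?_
  refine mul_le_mul_of_nonneg_left ?_ Real.pi_pos.le
  rw [intervalIntegral.integral_of_le Real.pi_pos.le, intervalIntegral.integral_of_le Real.pi_pos.le]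
  refine integral_mono hf.norm.integrable_sq hh.norm.integrable_sq fun s => ?_
  exact pow_le_pow_left₀ (norm_nonneg _) (norm_indicator_le_norm_self _ _) 2

lemma intervalIntegrable_oscInt_sq (hh : MemLp h 2 (volume.restrict (Ioc 0 Real.pi))) (l : ℝ) :
    IntervalIntegrable (fun s => ‖oscInt h l s‖ ^ 2) volume 0 Real.pi :=
  ((continuousOn_oscInt hh l).norm.pow 2).intervalIntegrable

lemma summable_oscInt_int (hh : MemLp h 2 (volume.restrict (Ioc 0 Real.pi))) :
    Summable (fun n : ℤ => ‖oscInt h (2 * n) Real.pi‖ ^ 2) ∧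
      Summable fun n : ℤ => ∫ s in (0 : ℝ)..Real.pi, ‖oscInt h (2 * n) s‖ ^ 2 := by
  refine ⟨summable_of_sum_le (fun _ => sq_nonneg _)
    fun S => sum_norm_oscInt_sq_le hh S (right_mem_Icc.2 Real.pi_pos.le),
    summable_of_sum_le (c := Real.pi * (Real.pi * ∫ s in (0 : ℝ)..Real.pi, ‖h s‖ ^ 2))
      (fun n => intervalIntegral.integral_nonneg Real.pi_pos.le fun _ _ => sq_nonneg _) fun S => ?_⟩
  rw [← intervalIntegral.integral_finsetSum fun n _ => intervalIntegrable_oscInt_sq hh _]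
  have hle := intervalIntegral.integral_mono_on Real.pi_pos.le
    (IntervalIntegrable.sum S fun n _ => intervalIntegrable_oscInt_sq hh (2 * n))
    (intervalIntegrable_const (c := Real.pi * ∫ s in (0 : ℝ)..Real.pi, ‖h s‖ ^ 2))
    fun x hx => by
      rw [Finset.sum_apply]
      exact sum_norm_oscInt_sq_le hh S hx
  rw [intervalIntegral.integral_const, sub_zero, smul_eq_mul] at hle
  simpa only [Finset.sum_apply] using hle

/-- Bessel's inequality for frequencies near the even integers. -/
lemma summable_oscInt (hh : MemLp h 2 (volume.restrict (Ioc 0 Real.pi))) {m : ℤ → ℝ}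
    (hm : ∀ n : ℤ, |m n - n| ≤ 1 / 2) :
    Summable (fun n : ℤ => ‖oscInt h (2 * m n) Real.pi‖ ^ 2) ∧
      Summable fun n : ℤ => ∫ s in (0 : ℝ)..Real.pi, ‖oscInt h (2 * m n) s‖ ^ 2 := by
  obtain ⟨h1, h2⟩ := summable_oscInt_int hh
  have hm2 : ∀ n : ℤ, |2 * m n - 2 * n| ≤ 1 := fun n => by
    rw [← mul_sub, abs_mul, abs_two]
    linarith [hm n]
  refine ⟨Summable.of_nonneg_of_le (fun _ => sq_nonneg _)
    (fun n => norm_oscInt_sq_le hh (hm2 n) (right_mem_Icc.2 Real.pi_pos.le))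
    ((h1.mul_left 2).add (h2.mul_left (2 * Real.pi))),
    Summable.of_nonneg_of_le
      (fun n => intervalIntegral.integral_nonneg Real.pi_pos.le fun _ _ => sq_nonneg _)
      (fun n => ?_) (h2.mul_left (2 + 2 * Real.pi ^ 2))⟩
  have hle := intervalIntegral.integral_mono_on Real.pi_pos.le (intervalIntegrable_oscInt_sq hh _)
    (((intervalIntegrable_oscInt_sq hh (2 * n)).const_mul 2).add intervalIntegrable_const)
    fun x hx => norm_oscInt_sq_le hh (hm2 n) hx
  rw [intervalIntegral.integral_add ((intervalIntegrable_oscInt_sq hh (2 * n)).const_mul 2)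
    intervalIntegrable_const, intervalIntegral.integral_const_mul, intervalIntegral.integral_const,
    sub_zero, smul_eq_mul] at hle
  linarith

end oscInt

end DiracGLM

namespace DiracGLM

lemma memLp_pot {p q : ℝ → ℝ} (hp : MemLp p 2 (volume.restrict (Ioo 0 Real.pi)))
    (hq : MemLp q 2 (volume.restrict (Ioo 0 Real.pi))) :
    MemLp (pot p q) 2 (volume.restrict (Ioc 0 Real.pi)) := by
  rw [← restrict_Ioo_eq_restrict_Ioc]
  exact memLp_complex_of_re_im hq hp

/-- The size of the potential in the perturbation estimates. -/
noncomputable def potBound (p q : ℝ → ℝ) : ℝ :=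
  Real.exp (∫ s in (0 : ℝ)..Real.pi, ‖pot p q s‖) ^ 2 * ∫ s in (0 : ℝ)..Real.pi, ‖pot p q s‖ ^ 2

lemma potBound_nonneg (p q : ℝ → ℝ) : 0 ≤ potBound p q :=
  mul_nonneg (sq_nonneg _) (intervalIntegral.integral_nonneg Real.pi_pos.le fun _ _ => sq_nonneg _)

section

variable {p q : ℝ → ℝ} {m : ℝ} {y : ℝ → Fin 2 → ℝ}

lemma norm_rotated_sub_le (hpot : MemLp (pot p q) 2 (volume.restrict (Ioc 0 Real.pi)))
    (hy : IsDiracSolution p q m y) {x : ℝ} (hx : x ∈ Icc 0 Real.pi) :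
    ‖rotated m y x - rotated m y 0‖ ≤ ‖rotated m y 0‖ * ‖oscInt (pot p q) (2 * m) x‖ +
      Real.exp (∫ s in (0 : ℝ)..Real.pi, ‖pot p q s‖) * ∫ s in (0 : ℝ)..Real.pi,
        ‖pot p q s‖ * (‖rotated m y 0‖ * ‖oscInt (pot p q) (2 * m) s‖) := by
  have hpi := intervalIntegrable_of_memLp Real.pi_pos.le hpot
  have hVc : ContinuousOn (rotated m y) (uIcc 0 Real.pi) := (ac_rotated hy).continuousOn
  have hdc : ContinuousOn (fun s => ‖rotated m y s - rotated m y 0‖) (uIcc 0 Real.pi) :=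
    (hVc.sub continuousOn_const).norm
  have hac : ContinuousOn (fun s => ‖rotated m y 0‖ * ‖oscInt (pot p q) (2 * m) s‖)
      (uIcc 0 Real.pi) := continuousOn_const.mul (continuousOn_oscInt hpot _).norm
  refine gronwall_integral (g := fun s => ‖pot p q s‖)
    (u := fun s => ‖rotated m y s - rotated m y 0‖)
    (a := fun s => ‖rotated m y 0‖ * ‖oscInt (pot p q) (2 * m) s‖) (fun _ => norm_nonneg _)
    (fun _ => by positivity) hpi.norm (hpi.norm.mul_continuousOn hdc)
    (hpi.norm.mul_continuousOn hac) (fun z hz => ?_) x hx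
  obtain ⟨h1, h2⟩ := rotated_eq hy hz
  have h3 := (intervalIntegrable_of_memLp Real.pi_pos.le (memLp_mul_exp hpot (2 * m))).mono_set
    (uIcc_zero_subset hz)
  have h4 : IntervalIntegrable (fun s => pot p q s * Complex.exp (Complex.I * ((2 * m * s : ℝ) : ℂ)) *
      (starRingEnd ℂ) (rotated m y s - rotated m y 0)) volume 0 z := by
    simp_rw [map_sub, mul_sub]
    exact h1.sub (h3.mul_const _)
  have e : rotated m y z - rotated m y 0 =
      -((starRingEnd ℂ) (rotated m y 0) * oscInt (pot p q) (2 * m) z +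
        ∫ s in (0 : ℝ)..z, pot p q s * Complex.exp (Complex.I * ((2 * m * s : ℝ) : ℂ)) *
          (starRingEnd ℂ) (rotated m y s - rotated m y 0)) := by
    rw [oscInt, ← intervalIntegral.integral_const_mul, ← intervalIntegral.integral_add
      (h3.const_mul _) h4, h2, sub_sub_cancel_left]
    congr 1
    refine intervalIntegral.integral_congr fun s _ => ?_
    simp only [map_sub]
    ring
  change ‖rotated m y z - rotated m y 0‖ ≤ _
  rw [e, norm_neg]
  refine (norm_add_le _ _).trans ?_
  rw [norm_mul, RCLike.norm_conj]
  refine add_le_add_right ?_ _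
  refine intervalIntegral.norm_integral_le_of_norm_le hz.1 (ae_of_all _ fun s _ => ?_)
    ((hpi.norm.mul_continuousOn hdc).mono_set (uIcc_zero_subset hz))
  rw [norm_mul, norm_mul, norm_exp_I_mul, RCLike.norm_conj, mul_one]

lemma rotated_eq_zero (hpot : MemLp (pot p q) 2 (volume.restrict (Ioc 0 Real.pi)))
    (hy : IsDiracSolution p q m y) (h0 : y 0 = 0) {x : ℝ} (hx : x ∈ Icc 0 Real.pi) : y x = 0 := by
  have hV : rotated m y 0 = 0 := by simp [rotated, h0]
  have h1 := norm_rotated_sub_le hpot hy hx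
  simp only [hV, norm_zero, zero_mul, mul_zero, intervalIntegral.integral_zero, add_zero,
    sub_zero] at h1
  have h2 := norm_rotated_sq m y x
  rw [le_antisymm h1 (norm_nonneg _), zero_pow two_ne_zero] at h2
  have hy0 : y x 0 = 0 := pow_eq_zero_iff two_ne_zero |>.1
    (le_antisymm (by linarith [sq_nonneg (y x 1)]) (sq_nonneg _))
  have hy1 : y x 1 = 0 := pow_eq_zero_iff two_ne_zero |>.1
    (le_antisymm (by linarith [sq_nonneg (y x 0)]) (sq_nonneg _))
  funext i
  fin_cases i
  · exact hy0
  · exact hy1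

lemma rotated_zero (h0 : y 0 = ![0, -1]) : rotated m y 0 = -1 := by
  simp [rotated, h0]

/-- The solution with initial value `(0, -1)` is close to the free one. -/
lemma norm_rotated_add_one_sq_le (hpot : MemLp (pot p q) 2 (volume.restrict (Ioc 0 Real.pi)))
    (hy : IsDiracSolution p q m y) (h0 : y 0 = ![0, -1]) {x : ℝ} (hx : x ∈ Icc 0 Real.pi) :
    ‖rotated m y x + 1‖ ^ 2 ≤ 2 * ‖oscInt (pot p q) (2 * m) x‖ ^ 2 +
      2 * potBound p q * ∫ s in (0 : ℝ)..Real.pi, ‖oscInt (pot p q) (2 * m) s‖ ^ 2 := by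
  have h1 := norm_rotated_sub_le hpot hy hx
  rw [rotated_zero h0, norm_neg, norm_one, one_mul, sub_neg_eq_add] at h1
  simp only [one_mul] at h1
  have h2 := norm_integral_mul_sq_le (𝕜 := ℝ) hpot.norm
    (memLp_of_continuousOn (continuousOn_oscInt hpot (2 * m)).norm)
  simp only [Real.norm_eq_abs, sq_abs,
    ← intervalIntegral.integral_of_le Real.pi_pos.le] at h2
  have h3 := pow_le_pow_left₀ (norm_nonneg _) h1 2
  rw [potBound]
  generalize ∫ s in (0 : ℝ)..Real.pi, ‖pot p q s‖ * ‖oscInt (pot p q) (2 * m) s‖ = J at *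
  generalize Real.exp (∫ s in (0 : ℝ)..Real.pi, ‖pot p q s‖) = E at *
  have h4 := mul_le_mul_of_nonneg_left h2 (sq_nonneg E)
  nlinarith [sq_nonneg (‖oscInt (pot p q) (2 * m) x‖ - E * J)]

lemma IsDiracSolution.add_smul {z : ℝ → Fin 2 → ℝ} (hz : IsDiracSolution p q m z)
    (hy : IsDiracSolution p q m y) (c : ℝ) : IsDiracSolution p q m fun x => z x + c • y x where
  absCont i := (hz.absCont i).fun_add ((hy.absCont i).const_smul c)
  eqn := by
    filter_upwards [hz.eqn, hy.eqn] with x h1 h2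
    obtain ⟨z', hz1, hz2⟩ := h1
    obtain ⟨y', hy1, hy2⟩ := h2
    refine ⟨z' + c • y', hz1.add (hy1.const_smul c), ?_⟩
    rw [Matrix.mulVec_add, Matrix.mulVec_add, Matrix.mulVec_smul, Matrix.mulVec_smul, smul_add,
      smul_comm m c, ← hz2, ← hy2, smul_add]
    abel

lemma integral_sq_eq (m : ℝ) (y : ℝ → Fin 2 → ℝ) :
    ∫ x in Ioo 0 Real.pi, (y x 0 ^ 2 + y x 1 ^ 2) = ∫ x in (0 : ℝ)..Real.pi, ‖rotated m y x‖ ^ 2 := by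
  simp_rw [norm_rotated_sq]
  rw [intervalIntegral.integral_of_le Real.pi_pos.le, restrict_Ioo_eq_restrict_Ioc]

lemma IsNormalizingNumber.pos {h₂ a : ℝ} (hh : 0 < h₂) (ha : IsNormalizingNumber p q h₂ m a) :
    0 < a := by
  obtain ⟨y, hy, h0, rfl⟩ := ha
  rw [integral_sq_eq m]
  have hVc : ContinuousOn (rotated m y) (uIcc 0 Real.pi) := (ac_rotated hy).continuousOn
  rw [uIcc_zero_pi] at hVc
  have h1 : 0 < ∫ x in (0 : ℝ)..Real.pi, ‖rotated m y x‖ ^ 2 :=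
    intervalIntegral.integral_pos Real.pi_pos (hVc.norm.pow 2) (fun _ _ => sq_nonneg _)
      ⟨0, left_mem_Icc.2 Real.pi_pos.le, by rw [rotated_zero h0]; simp⟩
  have h2 : 0 ≤ 1 / h₂ * y Real.pi 0 ^ 2 := by positivity
  linarith

/-- At an eigenvalue, the solution that defines the normalizing number is an eigenfunction. -/
lemma exists_eigenfunction (hpot : MemLp (pot p q) 2 (volume.restrict (Ioc 0 Real.pi))) {h₁ h₂ a : ℝ}
    (he : IsEigenvalue p q h₁ h₂ m) (ha : IsNormalizingNumber p q h₂ m a) :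
    ∃ y : ℝ → Fin 2 → ℝ, IsDiracSolution p q m y ∧ y 0 = ![0, -1] ∧
      a = (∫ x in (0 : ℝ)..Real.pi, ‖rotated m y x‖ ^ 2) + 1 / h₂ * y Real.pi 0 ^ 2 ∧
      (m + h₁) * y Real.pi 0 + h₂ * y Real.pi 1 = 0 := by
  obtain ⟨y, hy, h0, rfl⟩ := ha
  obtain ⟨z, hz, ⟨x, hx, hzx⟩, hz0, hbc⟩ := he
  refine ⟨y, hy, h0, by rw [integral_sq_eq m], ?_⟩
  have hw : ∀ x ∈ Icc 0 Real.pi, z x + z 0 1 • y x = 0 := fun x hx =>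
    rotated_eq_zero hpot (hz.add_smul hy (z 0 1)) (by
      funext i
      fin_cases i <;> simp [h0, hz0]) hx
  have hne : z 0 1 ≠ 0 := by
    intro h
    have := hw x hx
    rw [h, zero_smul, add_zero] at this
    exact hzx this
  have hpi := hw Real.pi (right_mem_Icc.2 Real.pi_pos.le)
  have e0 := congrFun hpi 0
  have e1 := congrFun hpi 1
  simp only [Pi.add_apply, Pi.smul_apply, smul_eq_mul, Pi.zero_apply] at e0 e1
  refine (mul_eq_zero.1 (?_ : z 0 1 * _ = 0)).resolve_left hne
  linear_combination (m + h₁) * e0 + h₂ * e1 - hbc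

end

end DiracGLM

namespace DiracGLM

variable {p q : ℝ → ℝ}

lemma four_mul_sq_le_sin_sq {l : ℝ} {n : ℤ} (hl : |l - n| ≤ 1 / 2) :
    4 * (l - n) ^ 2 ≤ Real.sin (l * Real.pi) ^ 2 := by
  have e : Real.sin ((l - n) * Real.pi) ^ 2 = Real.sin (l * Real.pi) ^ 2 := by
    rw [sub_mul, Real.sin_sub_int_mul_pi, mul_pow]
    rcases Int.even_or_odd n with h | h
    · rw [h.neg_one_zpow]; ring
    · rw [h.neg_one_zpow]; ring
  have hpi := Real.pi_pos
  have h1 := Real.mul_le_sin (x := |l - n| * Real.pi) (by positivity) (by nlinarith)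
  have e2 : 2 / Real.pi * (|l - n| * Real.pi) = 2 * |l - n| := by
    field_simp
  have e3 : Real.sin (|l - n| * Real.pi) ^ 2 = Real.sin ((l - n) * Real.pi) ^ 2 := by
    rcases abs_choice (l - n) with h | h
    · rw [h]
    · rw [h, neg_mul, Real.sin_neg, neg_sq]
  rw [← e, ← e3, ← sq_abs (l - n)]
  rw [e2] at h1
  have := pow_le_pow_left₀ (by positivity) h1 2
  linarith

lemma abs_norm_sq_sub_one_le (V : ℂ) : |‖V‖ ^ 2 - 1| ≤ 2 * ‖V + 1‖ + ‖V + 1‖ ^ 2 := by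
  have h1 : |‖V‖ - 1| ≤ ‖V + 1‖ := by
    have := abs_norm_sub_norm_le V (-1)
    rwa [norm_neg, norm_one, sub_neg_eq_add] at this
  have h2 := abs_le.1 h1
  rw [abs_le]
  constructor <;> nlinarith [norm_nonneg V, norm_nonneg (V + 1)]

lemma component_sq_le {m : ℝ} (y : ℝ → Fin 2 → ℝ) (x : ℝ) :
    (y x 0 - Real.sin (m * x)) ^ 2 ≤ ‖rotated m y x + 1‖ ^ 2 := by
  have e : (y x 1 : ℂ) + (y x 0 : ℂ) * Complex.I + Complex.exp (-(Complex.I * ((m * x : ℝ) : ℂ))) =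
      Complex.exp (-(Complex.I * ((m * x : ℝ) : ℂ))) * (rotated m y x + 1) := by
    rw [rotated, smul_eq_mul, mul_add, ← mul_assoc, ← Complex.exp_add, neg_add_cancel,
      Complex.exp_zero]
    ring
  have e2 : Complex.exp (-(Complex.I * ((m * x : ℝ) : ℂ))) =
      (Real.cos (m * x) : ℂ) + (-Real.sin (m * x) : ℝ) * Complex.I := by
    rw [show -(Complex.I * ((m * x : ℝ) : ℂ)) = ((-(m * x) : ℝ) : ℂ) * Complex.I by push_cast; ring,
      Complex.exp_mul_I, ← Complex.ofReal_cos, ← Complex.ofReal_sin, Real.cos_neg, Real.sin_neg]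
  have h1 : ‖Complex.exp (-(Complex.I * ((m * x : ℝ) : ℂ)))‖ = 1 := by
    rw [← mul_neg, ← Complex.ofReal_neg, norm_exp_I_mul]
  have h2 : ‖(y x 1 : ℂ) + (y x 0 : ℂ) * Complex.I + Complex.exp (-(Complex.I * ((m * x : ℝ) : ℂ)))‖ =
      ‖rotated m y x + 1‖ := by
    rw [e, norm_mul, h1, one_mul]
  rw [← h2, e2, ← sq_abs (y x 0 - _)]
  refine pow_le_pow_left₀ (abs_nonneg _) ?_ 2
  refine le_trans (le_of_eq ?_) (Complex.abs_im_le_norm _)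
  simp only [Complex.add_im, Complex.ofReal_im, Complex.im_ofReal_mul, Complex.I_im, mul_one, zero_add]
  rw [sub_eq_add_neg]

/-- Bounds for one eigenvalue and its normalizing number in terms of the integrals of the
potential against exponentials. -/
lemma eigenvalue_estimate (hpot : MemLp (pot p q) 2 (volume.restrict (Ioc 0 Real.pi))) {h₁ h₂ l a : ℝ}
    (hh : 0 < h₂) (he : IsEigenvalue p q h₁ h₂ l) (ha : IsNormalizingNumber p q h₂ l a) {n : ℤ}
    (hl : |l - n| ≤ 1 / 2) (hn : 1 + 2 * |h₁| ≤ |(n : ℝ)|) {D e Y : ℝ}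
    (hD : D = 2 * ‖oscInt (pot p q) (2 * l) Real.pi‖ ^ 2 + 2 * potBound p q *
      ∫ s in (0 : ℝ)..Real.pi, ‖oscInt (pot p q) (2 * l) s‖ ^ 2)
    (hE : e = (2 + 2 * Real.pi * potBound p q) *
      ∫ s in (0 : ℝ)..Real.pi, ‖oscInt (pot p q) (2 * l) s‖ ^ 2)
    (hY : Y = 8 * h₂ ^ 2 * (1 / (n : ℝ) ^ 2 + D)) :
    (l - n) ^ 2 ≤ 1 / 2 * (Y + D) ∧
      (a - Real.pi) ^ 2 ≤ 12 * Real.pi * e + 3 * e ^ 2 + 3 / h₂ ^ 2 * Y ^ 2 := by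
  obtain ⟨y, hy, h0, hav, hbc⟩ := exists_eigenfunction hpot he ha
  have hpi := Real.pi_pos
  have hVc : ContinuousOn (rotated l y) (uIcc 0 Real.pi) := (ac_rotated hy).continuousOn
  have hdc : ContinuousOn (fun s => ‖rotated l y s + 1‖) (uIcc 0 Real.pi) :=
    (hVc.add continuousOn_const).norm
  have hdi : IntervalIntegrable (fun s => ‖rotated l y s + 1‖ ^ 2) volume 0 Real.pi :=
    (hdc.pow 2).intervalIntegrable
  have hVi : IntervalIntegrable (fun s => ‖rotated l y s‖ ^ 2) volume 0 Real.pi :=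
    (hVc.norm.pow 2).intervalIntegrable
  have hDle : ‖rotated l y Real.pi + 1‖ ^ 2 ≤ D := by
    rw [hD]
    exact norm_rotated_add_one_sq_le hpot hy h0 (right_mem_Icc.2 hpi.le)
  have hD0 : 0 ≤ D := (sq_nonneg _).trans hDle
  have hEle : ∫ x in (0 : ℝ)..Real.pi, ‖rotated l y x + 1‖ ^ 2 ≤ e := by
    have hle := intervalIntegral.integral_mono_on hpi.le hdi
      (((intervalIntegrable_oscInt_sq hpot (2 * l)).const_mul 2).add intervalIntegrable_const)
      fun x hx => norm_rotated_add_one_sq_le hpot hy h0 hx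
    rw [intervalIntegral.integral_add ((intervalIntegrable_oscInt_sq hpot (2 * l)).const_mul 2)
      intervalIntegrable_const, intervalIntegral.integral_const_mul, intervalIntegral.integral_const,
      sub_zero, smul_eq_mul] at hle
    rw [hE]
    linarith
  have hE0 : 0 ≤ ∫ x in (0 : ℝ)..Real.pi, ‖rotated l y x + 1‖ ^ 2 :=
    intervalIntegral.integral_nonneg hpi.le fun _ _ => sq_nonneg _
  have hn1 : 1 ≤ |(n : ℝ)| := by linarith [abs_nonneg h₁]
  have hn2 : 0 < (n : ℝ) ^ 2 := by rw [← sq_abs]; positivity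
  have hn3 : 1 ≤ (n : ℝ) ^ 2 := by rw [← sq_abs]; nlinarith
  have hlow : (n : ℝ) ^ 2 / 4 ≤ (l + h₁) ^ 2 := by
    have h1 : |(n : ℝ)| ≤ |l + h₁| + |l - n| + |h₁| := by
      have e1 : (n : ℝ) = (l + h₁) - (l - n) - h₁ := by ring
      calc |(n : ℝ)| = |(l + h₁) - (l - n) - h₁| := by rw [← e1]
        _ ≤ |(l + h₁) - (l - n)| + |h₁| := abs_sub _ _
        _ ≤ _ := by linarith [abs_sub (l + h₁) (l - n)]
    have h2 : |(n : ℝ)| / 2 ≤ |l + h₁| := by linarith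
    have h3 := pow_le_pow_left₀ (by positivity) h2 2
    rw [div_pow, sq_abs, sq_abs] at h3
    linarith
  have hYle : y Real.pi 0 ^ 2 ≤ Y := by
    have h1 : (l + h₁) ^ 2 * y Real.pi 0 ^ 2 = h₂ ^ 2 * y Real.pi 1 ^ 2 := by
      have : (l + h₁) * y Real.pi 0 = -(h₂ * y Real.pi 1) := by linarith
      rw [← mul_pow, this, neg_sq, mul_pow]
    have h2 : y Real.pi 1 ^ 2 ≤ 2 + 2 * D := by
      have h3 := norm_rotated_sq l y Real.pi
      have h4 := abs_le.1 (abs_norm_sq_sub_one_le (rotated l y Real.pi))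
      have h5 : ‖rotated l y Real.pi‖ ≤ ‖rotated l y Real.pi + 1‖ + 1 := by
        have := norm_sub_le (rotated l y Real.pi + 1) 1
        rwa [add_sub_cancel_right, norm_one] at this
      nlinarith [sq_nonneg (y Real.pi 0), sq_nonneg (‖rotated l y Real.pi + 1‖ - 1),
        pow_le_pow_left₀ (norm_nonneg _) h5 2]
    have h3 : (n : ℝ) ^ 2 / 4 * y Real.pi 0 ^ 2 ≤ h₂ ^ 2 * (2 + 2 * D) :=
      (mul_le_mul_of_nonneg_right hlow (sq_nonneg _)).trans
        (h1.trans_le (mul_le_mul_of_nonneg_left h2 (sq_nonneg _)))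
    have h4 : y Real.pi 0 ^ 2 ≤ 8 * h₂ ^ 2 * (1 + D) / (n : ℝ) ^ 2 := by
      rw [le_div_iff₀ hn2]
      linarith
    refine h4.trans ?_
    rw [hY, mul_div_assoc, add_div]
    have h5 : D / (n : ℝ) ^ 2 ≤ D := div_le_self hD0 hn3
    exact mul_le_mul_of_nonneg_left (by linarith) (by positivity)
  constructor
  · have h1 := four_mul_sq_le_sin_sq hl
    have h2 := component_sq_le (m := l) y Real.pi
    nlinarith [sq_nonneg (2 * y Real.pi 0 - Real.sin (l * Real.pi))]
  · have h1 : a - Real.pi = (∫ x in (0 : ℝ)..Real.pi, (‖rotated l y x‖ ^ 2 - 1)) +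
        1 / h₂ * y Real.pi 0 ^ 2 := by
      rw [intervalIntegral.integral_sub hVi intervalIntegrable_const,
        intervalIntegral.integral_const, sub_zero, smul_eq_mul, mul_one, hav]
      ring
    have h2 : |∫ x in (0 : ℝ)..Real.pi, (‖rotated l y x‖ ^ 2 - 1)| ≤
        2 * (∫ x in (0 : ℝ)..Real.pi, ‖rotated l y x + 1‖) +
          ∫ x in (0 : ℝ)..Real.pi, ‖rotated l y x + 1‖ ^ 2 := by
      rw [← intervalIntegral.integral_const_mul, ← intervalIntegral.integral_add
        (hdc.intervalIntegrable.const_mul 2) hdi]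
      rw [← Real.norm_eq_abs]
      exact intervalIntegral.norm_integral_le_of_norm_le hpi.le
        (ae_of_all _ fun x _ => (Real.norm_eq_abs _).trans_le
          (abs_norm_sq_sub_one_le (rotated l y x)))
        ((hdc.intervalIntegrable.const_mul 2).add hdi)
    have h3 := intervalIntegral_sq_le hdc
    generalize (∫ x in (0 : ℝ)..Real.pi, ‖rotated l y x + 1‖) = J at *
    generalize (∫ x in (0 : ℝ)..Real.pi, ‖rotated l y x + 1‖ ^ 2) = L at *
    generalize (∫ x in (0 : ℝ)..Real.pi, (‖rotated l y x‖ ^ 2 - 1)) = W at *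
    have hW : W ^ 2 ≤ (2 * J + L) ^ 2 := by
      rw [← sq_abs W]
      exact pow_le_pow_left₀ (abs_nonneg _) h2 2
    have h4 : (2 * J + L + 1 / h₂ * y Real.pi 0 ^ 2) ^ 2 ≤
        3 * ((2 * J) ^ 2 + L ^ 2 + (1 / h₂ * y Real.pi 0 ^ 2) ^ 2) := by
      nlinarith [sq_nonneg (2 * J - L), sq_nonneg (2 * J - 1 / h₂ * y Real.pi 0 ^ 2),
        sq_nonneg (L - 1 / h₂ * y Real.pi 0 ^ 2)]
    have h5 : (a - Real.pi) ^ 2 ≤ (2 * J + L + 1 / h₂ * y Real.pi 0 ^ 2) ^ 2 := by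
      have hz : 0 ≤ 1 / h₂ * y Real.pi 0 ^ 2 := by positivity
      have := abs_le.1 h2
      rw [h1]
      exact sq_le_sq' (by linarith) (by linarith)
    have h6 : (1 / h₂ * y Real.pi 0 ^ 2) ^ 2 ≤ 1 / h₂ ^ 2 * Y ^ 2 := by
      rw [mul_pow, div_pow, one_pow]
      exact mul_le_mul_of_nonneg_left (pow_le_pow_left₀ (sq_nonneg _) hYle 2) (by positivity)
    have h7 : L ^ 2 ≤ e ^ 2 := pow_le_pow_left₀ hE0 hEle 2
    have h8 : J ^ 2 ≤ Real.pi * e := h3.trans (mul_le_mul_of_nonneg_left hEle hpi.le)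
    have e9 : 3 / h₂ ^ 2 * Y ^ 2 = 3 * (1 / h₂ ^ 2 * Y ^ 2) := by ring
    rw [e9]
    linarith

lemma summable_sq_of_summable {f : ℤ → ℝ} (hf : Summable f) (h0 : ∀ n, 0 ≤ f n) :
    Summable fun n => f n ^ 2 := by
  refine Summable.of_norm_bounded_eventually hf ?_
  filter_upwards [hf.tendsto_cofinite_zero.eventually (gt_mem_nhds one_pos)] with n hn
  rw [Real.norm_of_nonneg (sq_nonneg _)]
  nlinarith [h0 n]

/-- The asymptotics of the eigenvalues and of the normalizing numbers. -/
lemma IsSpectralData.summable (hpot : MemLp (pot p q) 2 (volume.restrict (Ioc 0 Real.pi)))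
    {h₁ h₂ : ℝ} (hh : 0 < h₂) {lam α : ℤ → ℝ} (hsd : IsSpectralData p q h₁ h₂ lam α) :
    Summable (fun n : ℤ => (lam n - n) ^ 2) ∧ Summable fun n : ℤ => (α n - Real.pi) ^ 2 := by
  classical
  obtain ⟨m, hm⟩ : ∃ m : ℤ → ℝ, m = fun n : ℤ => if |lam n - n| ≤ 1 / 2 then lam n else n := ⟨_, rfl⟩
  have hm1 : ∀ n : ℤ, |m n - n| ≤ 1 / 2 := by
    intro n
    rw [hm]
    dsimp only
    split_ifs with h
    · exact h
    · simp
  obtain ⟨s1, s2⟩ := summable_oscInt hpot hm1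
  obtain ⟨D, hD⟩ : ∃ D : ℤ → ℝ, D = fun n => 2 * ‖oscInt (pot p q) (2 * m n) Real.pi‖ ^ 2 +
      2 * potBound p q * ∫ s in (0 : ℝ)..Real.pi, ‖oscInt (pot p q) (2 * m n) s‖ ^ 2 := ⟨_, rfl⟩
  obtain ⟨e, hE⟩ : ∃ e : ℤ → ℝ, e = fun n => (2 + 2 * Real.pi * potBound p q) *
      ∫ s in (0 : ℝ)..Real.pi, ‖oscInt (pot p q) (2 * m n) s‖ ^ 2 := ⟨_, rfl⟩
  obtain ⟨Y, hY⟩ : ∃ Y : ℤ → ℝ, Y = fun n : ℤ => 8 * h₂ ^ 2 * (1 / (n : ℝ) ^ 2 + D n) := ⟨_, rfl⟩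
  have hb := potBound_nonneg p q
  have hI0 : ∀ n, 0 ≤ ∫ s in (0 : ℝ)..Real.pi, ‖oscInt (pot p q) (2 * m n) s‖ ^ 2 := fun n =>
    intervalIntegral.integral_nonneg Real.pi_pos.le fun _ _ => sq_nonneg _
  have hpi := Real.pi_pos
  have hD0 : ∀ n, 0 ≤ D n := fun n => by
    rw [hD]
    have := hI0 n
    positivity
  have hE0 : ∀ n, 0 ≤ e n := fun n => by
    rw [hE]
    have := hI0 n
    positivity
  have hY0 : ∀ n, 0 ≤ Y n := fun n => by
    rw [hY]
    have := hD0 n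
    positivity
  have hDs : Summable D := by
    rw [hD]; exact (s1.mul_left 2).add (s2.mul_left _)
  have hEs : Summable e := by
    rw [hE]; exact s2.mul_left _
  have hYs : Summable Y := by
    rw [hY]; exact ((Real.summable_one_div_int_pow.2 one_lt_two).add hDs).mul_left _
  have hlarge : ∀ᶠ n : ℤ in cofinite, 1 + 2 * |h₁| ≤ |(n : ℝ)| := by
    have : Tendsto (fun n : ℤ => |(n : ℝ)|) cofinite atTop := by
      have h1 := tendsto_norm_cocompact_atTop (E := ℤ)
      rw [cocompact_eq_cofinite] at h1
      exact h1
    exact this.eventually_ge_atTop _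
  have hev : ∀ᶠ n : ℤ in cofinite, (lam n - n) ^ 2 ≤ 1 / 2 * (Y n + D n) ∧
      (α n - Real.pi) ^ 2 ≤ 12 * Real.pi * e n + 3 * e n ^ 2 + 3 / h₂ ^ 2 * Y n ^ 2 := by
    filter_upwards [hlarge, hsd.numbering] with n h1 h2
    have hmn : m n = lam n := by rw [hm]; exact if_pos h2.le
    refine eigenvalue_estimate hpot hh (hsd.eigenvalue n) (hsd.normalizing n) h2.le h1 ?_ ?_ ?_
    · rw [hD, ← hmn]
    · rw [hE, ← hmn]
    · rw [hY]
  constructor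
  · refine Summable.of_norm_bounded_eventually ((hYs.add hDs).mul_left (1 / 2)) ?_
    filter_upwards [hev] with n hn
    rw [Real.norm_of_nonneg (sq_nonneg _)]
    exact hn.1
  · refine Summable.of_norm_bounded_eventually (((hEs.mul_left (12 * Real.pi)).add
      ((summable_sq_of_summable hEs hE0).mul_left 3)).add
      ((summable_sq_of_summable hYs hY0).mul_left (3 / h₂ ^ 2))) ?_
    filter_upwards [hev] with n hn
    rw [Real.norm_of_nonneg (sq_nonneg _)]
    exact hn.2

lemma exists_isKernel {lam α : ℤ → ℝ} (hpos : ∀ n, 0 < α n)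
    (hl : Summable fun n : ℤ => (lam n - n) ^ 2) (hs : Summable fun n : ℤ => (α n - Real.pi) ^ 2) :
    ∃ F, IsKernel lam α F := by
  obtain ⟨A, hA, hAm, hT⟩ := exists_tendsto_expSum hpos hl hs
  exact ⟨_, isKernel_kerOf hA hAm hT⟩

end DiracGLM

theorem mainTheorem6 {𝕜 : Type*} [RCLike 𝕜] :
    (∀ (p q : ℝ → ℝ) (h₁ h₂ : ℝ),
      MemLp p 2 (volume.restrict (Ioo 0 Real.pi)) →
      MemLp q 2 (volume.restrict (Ioo 0 Real.pi)) →
      0 < h₂ →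
      ∀ lam α : ℤ → ℝ, DiracGLM.IsSpectralData p q h₁ h₂ lam α →
      ∀ (E : Finset ℝ) (β : ℝ → ℝ),
        (∀ μ ∈ E, DiracGLM.IsEigenvalue p q h₁ h₂ μ ∧ (∀ n, lam n ≠ μ) ∧
          DiracGLM.IsNormalizingNumber p q h₂ μ (β μ)) →
        (∃ F, DiracGLM.IsKernel lam α F) ∧
        ∀ F, DiracGLM.IsKernel lam α F → ∀ x ∈ Ioc 0 Real.pi,
          ∃! K : DiracGLM.L2Mat 𝕜 x,
            DiracGLM.SolvesMainEquation
              (fun s t => F s t + ∑ μ ∈ E, (1 / β μ) • DiracGLM.phi0Mat s t μ) x K) ∧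
    (∀ lam α : ℤ → ℝ, Function.Injective lam → (∀ n, 0 < α n) →
      Summable (fun n : ℤ => (lam n - n) ^ 2) →
      Summable (fun n : ℤ => (α n - Real.pi) ^ 2) →
        (∃ F, DiracGLM.IsKernel lam α F) ∧
        ∀ F, DiracGLM.IsKernel lam α F → ∀ x ∈ Ioc 0 Real.pi,
          ∃! K : DiracGLM.L2Mat 𝕜 x, DiracGLM.SolvesMainEquation F x K) := by
  refine ⟨fun p q h₁ h₂ hp hq hh lam α hsd E β hE => ?_, fun lam α hinj hpos hl hs => ?_⟩
  · have hpos : ∀ n, 0 < α n := fun n => (hsd.normalizing n).pos hh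
    obtain ⟨hl, hs⟩ := hsd.summable (DiracGLM.memLp_pot hp hq) hh
    exact ⟨DiracGLM.exists_isKernel hpos hl hs, fun F hF x hx =>
      DiracGLM.existsUnique_mainEquation hpos hl hs hsd.injective hF E β
        (fun μ hμ => (hE μ hμ).2.2.pos hh) hx⟩
  · refine ⟨DiracGLM.exists_isKernel hpos hl hs, fun F hF x hx => ?_⟩
    simpa only [Finset.sum_empty, add_zero] using DiracGLM.existsUnique_mainEquation (𝕜 := 𝕜) hpos hl
      hs hinj hF ∅ 0 (fun μ hμ => absurd hμ (Finset.notMem_empty μ)) hx
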